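/- **Setting.** Let $n_e\in C^2(\mathbb R)$ with $n_e(0)=1$, $n_e'(0)=-1$. Write $\mathbb R_+=(0,\infty)$, $\overline{\mathbb R_+}=[0,\infty)$, $\xi=(\xi_1,\xi')\in\mathbb R\times\mathbb R^2=\mathbb R^3$, $\mathbb R^3_+=\{\xi\in\mathbb R^3:\xi_1>0\}$, and let $\chi$ be the indicator function of $\{s>0\}$. Given $\alpha\in[0,1]$, $\phi_b\in\mathbb R$ and nonnegative functions $f_b$ on $\mathbb R^3_+$ and $f_\infty$ on $\mathbb R^3$, consider the stationary Vlasov–Poisson problem $$\xi_1\partial_xf+\partial_x\phi\,\partial_{\xi_1}f=0,\qquad \partial_{xx}\phi=\int_{\mathbb R^3}f\,d\xi-n_e(\phi),\qquad x>0,\ \xi\in\mathbb R^3,$$ $$f(0,\xi)=f_b(\xi)+\alpha f(0,-\xi_1,\xi')\ (\xi_1>0),\quad \phi(0)=\phi_b,\quad \lim_{x\to\infty}f(x,\xi)=f_\infty(\xi),\quad \lim_{x\to\infty}\phi(x)=0. \tag{P}$$ A pair $(f,\phi)$ is a *solution* of (P) if: - $f\in L^1_{loc}(\overline{\mathbb R_+}\times\mathbb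 R^3)\cap C(\overline{\mathbb R_+};L^1(\mathbb R^3))$ and $\phi\in C^1(\overline{\mathbb R_+})\cap C^2(\mathbb R_+)$; - $f\ge0$, and either $\partial_x\phi>0$ on all of $\overline{\mathbb R_+}$ or $\partial_x\phi<0$ on all of $\overline{\mathbb R_+}$; - $\int_{\mathbb R_+\times\mathbb R^3}f\,(\xi_1\partial_x\psi+\partial_x\phi\,\partial_{\xi_1}\psi)\,dx\,d\xi+\int_{\mathbb R^3_+}f_b\,\xi_1\psi(0,\xi)\,d\xi=0$ for every compactly supported $\psi\in C^1(\overline{\mathbb R_+}\times\mathbb R^3)$ with $\alpha\psi(0,\xi_1,\xi')=\psi(0,-\xi_1,\xi')$ for $\xi_1>0$, and $\lim_{x\to\infty}\|f(x,\cdot)-f_\infty\|_{L^1(\mathbb R^3)}=0$; - $\partial_{xx}\phi=\int_{\mathbb R^3} f\,d\xi-n_e(\phi)$ for $x>0$, $\phi(0)=\phi_b$ and $\lim_{x\to\infty}\phi(x)=0$ in the classical sense. Here $f(x,\cdot)$ is understood up to null sets for each $x\ge 0$. **Theorem.** Let $\phi_b>0$, $\alpha\in[0,1)$, $r\in(2,\infty)$,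 $0\le f_\infty\in L^1(\mathbb R^3)$, and $0\le f_b\in L^1(\mathbb R^3_+)$ with $$\int_0^{\sqrt{2\phi_b}}\Big(\int_{\mathbb R^2}f_b(\xi_1,\xi')\,d\xi'\Big)^r d\xi_1<\infty .$$ For $\phi\ge0$ put $$\rho_i^+(\phi)=\int_{\mathbb R^3}f_\infty(\xi)\frac{|\xi_1|}{\sqrt{\xi_1^2+2\phi}}\,d\xi+\frac{2}{1-\alpha}\int_{\sqrt{2(\phi_b-\phi)\chi(\phi_b-\phi)}}^{\sqrt{2\phi_b}}\int_{\mathbb R^2}f_b(\xi)\frac{\xi_1}{\sqrt{\xi_1^2+2(\phi-\phi_b)}}\,d\xi'\,d\xi_1,$$ $$V^+(\phi)=\int_0^\phi\big(\rho_i^+(\varphi)-n_e(\varphi)\big)\,d\varphi,\qquad B^+=\{\varphi>0: V^+(\phi)>0\text{ for all }\phi\in(0,\varphi]\},$$ with $\sup B^+\in(0,\infty]$ if $B^+\ne\emptyset$. Suppose that $\int_{\mathbb R^3}f_\infty\,d\xi=1$, that $$f_\infty(\xi)=f_b\big(\sqrt{\xi_1^2+2\phi_b},\xi'\big)+\alpha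 f_\infty(-\xi_1,\xi')\quad\text{for a.e. }\xi\in\mathbb R^3_+,$$ and that $V^+\in C^2([0,\phi_b])$. (i) Assume $\frac{d^2V^+}{d\phi^2}(0)>0$. Then $B^+\neq\emptyset$. Problem (P) has a unique solution if $\phi_b<\sup B^+$, and has no solution otherwise. The solution $(f,\phi)$ satisfies, for every $x\ge 0$ and a.e. $\xi$, $$f(x,\xi)=f_\infty\big(-\sqrt{\xi_1^2-2\phi(x)},\xi'\big)\chi(\xi_1^2-2\phi(x))\chi(-\xi_1)+\frac1{1-\alpha}f_b\big(\sqrt{\xi_1^2-2\phi(x)+2\phi_b},\xi'\big)\chi(-\xi_1^2+2\phi(x))+f_\infty\big(\sqrt{\xi_1^2-2\phi(x)},\xi'\big)\chi(\xi_1^2-2\phi(x))\chi(\xi_1),\tag{F}$$ and there are constants $c,C>0$ such that $|\partial_x^l\phi(x)|\le Ce^{-cx}$ for all $x\ge0$ and $l=0,1,2$ (one-sided derivatives at $x=0$). (ii) Assume $\frac{d^2V^+}{d\phi^2}(0)=0$ and $B^+\ne\emptyset$. Problem (P) has a unique solution if $\phi_b<\sup B^+$, and has no solution otherwise. The solution satisfies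 (F). (iii) If $\frac{d^2V^+}{d\phi^2}(0)=0$ and $B^+=\emptyset$, then (P) has no solution. (iv) If $\frac{d^2V^+}{d\phi^2}(0)<0$, then (P) has no solution. -/

import Mathlib

open MeasureTheory Set Filter Topology

noncomputable section

namespace VlasovPoisson

/-- Velocity space `ℝ³`, written as `ξ = (ξ₁, ξ')` with `ξ₁ = ξ.1` and `ξ' = ξ.2 ∈ ℝ²`;
its `volume` is three-dimensional Lebesgue measure. -/
abbrev Vel : Type := ℝ × ℝ × ℝ

/-- The half space `ℝ³₊ = {ξ₁ > 0}`. -/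
def posVel : Set Vel := {ξ | 0 < ξ.1}

/-- The indicator function of `{s > 0}`. -/
def chi (s : ℝ) : ℝ := if 0 < s then 1 else 0

/-- `∂ₓᵏ φ(x)` for functions on the closed half line (one-sided at `x = 0`). -/
def dx (k : ℕ) (φ : ℝ → ℝ) (x : ℝ) : ℝ := iteratedDerivWithin k φ (Ici 0) x

/-- The `L¹(ℝ³)` distance of two integrable functions. -/
def distL1 (g h : Vel → ℝ) : ℝ := ∫ ξ, |g ξ - h ξ|

/-- Finiteness of the norm of `L^r(a, b; L¹(ℝ²))`. -/
def FiniteLrL1 (r a b : ℝ) (g : Vel → ℝ) : Prop :=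
  (∫⁻ s in Ioo a b, (∫⁻ η : ℝ × ℝ, ‖g (s, η)‖ₑ) ^ r) < ⊤

/-- Test functions: `C¹`, compactly supported in `[0, ∞) × ℝ³` (given as restrictions of `C¹`
functions with compact support on `ℝ × ℝ³`; values at `x < 0` are never used), with
`α ψ(0, ξ₁, ξ') = ψ(0, -ξ₁, ξ')` for `ξ₁ > 0`. -/
structure IsTest (α : ℝ) (ψ : ℝ × Vel → ℝ) : Prop where
  contDiff : ContDiff ℝ 1 ψ
  compact : HasCompactSupport ψ
  bdry : ∀ ξ ∈ posVel, α * ψ (0, ξ) = ψ (0, (-ξ.1, ξ.2))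

/-- Solutions `(f, φ)` of the stationary Vlasov–Poisson boundary value problem on `x > 0` with
electron density `ne`, reflection rate `α`, boundary potential `φb`, boundary datum `fb` and
far-field datum `finf`. Only values at `x ≥ 0` matter, and each `f x` matters up to null sets. -/
structure IsSolution (ne : ℝ → ℝ) (α φb : ℝ) (fb finf : Vel → ℝ)
    (f : ℝ → Vel → ℝ) (φ : ℝ → ℝ) : Prop where
  locInt : LocallyIntegrableOn (fun p : ℝ × Vel => f p.1 p.2) (Ici 0 ×ˢ univ) volume
  integrable : ∀ x, 0 ≤ x → Integrable (f x) volume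
  continuous : ∀ x₀, 0 ≤ x₀ → Tendsto (fun x => distL1 (f x) (f x₀)) (𝓝[Ici 0] x₀) (𝓝 0)
  phi_C1 : ContDiffOn ℝ 1 φ (Ici 0)
  phi_C2 : ContDiffOn ℝ 2 φ (Ioi 0)
  nonneg : ∀ x, 0 ≤ x → ∀ᵐ ξ : Vel, 0 ≤ f x ξ
  monotone : (∀ x, 0 ≤ x → 0 < dx 1 φ x) ∨ (∀ x, 0 ≤ x → dx 1 φ x < 0)
  vlasov : ∀ ψ : ℝ × Vel → ℝ, IsTest α ψ →
    (∫ p in (Ioi 0 ×ˢ univ : Set (ℝ × Vel)), f p.1 p.2 *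
        (p.2.1 * fderiv ℝ ψ p (1, 0) + dx 1 φ p.1 * fderiv ℝ ψ p (0, (1, 0))))
      + (∫ ξ in posVel, fb ξ * (ξ.1 * ψ (0, ξ))) = 0
  farField : Tendsto (fun x => distL1 (f x) finf) atTop (𝓝 0)
  poisson : ∀ x, 0 < x → dx 2 φ x = (∫ ξ, f x ξ) - ne (φ x)
  phi_zero : φ 0 = φb
  phi_infty : Tendsto φ atTop (𝓝 0)

/-- There is exactly one solution (`f x` being an element of `L¹(ℝ³)` for each `x ≥ 0`,
and `φ` a function on `[0, ∞)`). -/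
def HasUniqueSolution (ne : ℝ → ℝ) (α φb : ℝ) (fb finf : Vel → ℝ) : Prop :=
  (∃ f φ, IsSolution ne α φb fb finf f φ) ∧
  ∀ f φ g ψ, IsSolution ne α φb fb finf f φ → IsSolution ne α φb fb finf g ψ →
    (∀ x, 0 ≤ x → f x =ᵐ[volume] g x) ∧ EqOn φ ψ (Ici 0)

/-- The ion density `ρᵢ⁺` as a function of the potential `s ≥ 0`. -/
def rhoPlus (α φb : ℝ) (fb finf : Vel → ℝ) (s : ℝ) : ℝ :=
  (∫ ξ : Vel, finf ξ * (|ξ.1| / √(ξ.1 ^ 2 + 2 * s)))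
  + 2 / (1 - α) *
    ∫ ξ in (Ioo √(2 * (φb - s) * chi (φb - s)) √(2 * φb) ×ˢ univ : Set Vel),
      fb ξ * (ξ.1 / √(ξ.1 ^ 2 + 2 * (s - φb)))

/-- `V⁺(s) = ∫₀ˢ (ρᵢ⁺ - nₑ)`. -/
def VPlus (ne : ℝ → ℝ) (α φb : ℝ) (fb finf : Vel → ℝ) (s : ℝ) : ℝ :=
  ∫ t in (0 : ℝ)..s, (rhoPlus α φb fb finf t - ne t)

/-- `B⁺ = {β > 0 : V⁺ > 0 on (0, β]}`. -/
def BPlus (ne : ℝ → ℝ) (α φb : ℝ) (fb finf : Vel → ℝ) : Set ℝ :=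
  {β | 0 < β ∧ ∀ s ∈ Ioc 0 β, 0 < VPlus ne α φb fb finf s}

/-- `sup B⁺`, possibly infinite. -/
def supBPlus (ne : ℝ → ℝ) (α φb : ℝ) (fb finf : Vel → ℝ) : EReal :=
  sSup (Real.toEReal '' BPlus ne α φb fb finf)

/-- The second derivative of `V⁺` on `[0, φb]` at `0`. -/
def d2VPlusZero (ne : ℝ → ℝ) (α φb : ℝ) (fb finf : Vel → ℝ) : ℝ :=
  iteratedDerivWithin 2 (VPlus ne α φb fb finf) (Icc 0 φb) 0

/-- The explicit distribution function determined by the potential `φ`. -/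
def explicitF (α φb : ℝ) (fb finf : Vel → ℝ) (φ : ℝ → ℝ) (x : ℝ) (ξ : Vel) : ℝ :=
  finf (-√(ξ.1 ^ 2 - 2 * φ x), ξ.2) * chi (ξ.1 ^ 2 - 2 * φ x) * chi (-ξ.1)
  + 1 / (1 - α) * fb (√(ξ.1 ^ 2 - 2 * φ x + 2 * φb), ξ.2) * chi (-ξ.1 ^ 2 + 2 * φ x)
  + finf (√(ξ.1 ^ 2 - 2 * φ x), ξ.2) * chi (ξ.1 ^ 2 - 2 * φ x) * chi ξ.1

/-- `|∂ₓˡ φ(x)| ≤ C e^{-cx}` for `l = 0, 1, 2`, with positive constants `c`, `C`. -/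
def ExpDecay (φ : ℝ → ℝ) : Prop :=
  ∃ c > 0, ∃ C > 0, ∀ l ≤ 2, ∀ x, 0 ≤ x → |dx l φ x| ≤ C * Real.exp (-c * x)

end VlasovPoisson

end

noncomputable section

namespace VlasovPoisson

section

/-! ### Changes of variables -/

/-! The conserved quantity along characteristics is the energy `e = ξ₁² / 2 - φ(x)`. Any solution
has φ strictly decreasing from φb to 0, so a particle with `e > 0` travels between the wall and
infinity, while one with `e < 0` is emitted at the wall, turns back where `φ = -e` and returns. The
density is therefore a function of `(e, ξ')` and of the sign of `ξ₁`, with profiles `hp` and `hm`.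
For `e > 0` the far-field datum fixes both. For `e < 0` turning forces `hp = hm = h`, and the wall
condition `h = fb + α h` gives `h = fb / (1 - α)`. The compatibility condition on `finf` says
exactly that the far field and the wall prescribe the same profiles (`exists_energyProfile`).

The converse, that a weak solution must have these profiles, is `IsSolution.ae_eq_profileDensity`.
One tests with functions of the energy, multiplied by a smoothed indicator of right-moving particles
that is exact wherever the energy weight is nonzero. Net and right-moving fluxes through each energy
window are then constant in x; they are computed at infinity for `e > 0` and at the wall for `e <
0`. Since `ξ₁ dξ₁ = de`, these fluxes determine the density almost everywhere.

The problem is thereby reduced to `φ'' = g(φ)` with `g = ρᵢ⁺ - nₑ` (`charge`), and V⁺ is the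
primitive of g. The energy of this equation vanishes at infinity, so `φ' = -√(2 V⁺(φ))` and `V⁺ > 0`
at every value taken by φ, that is on `(0, φb]`. This gives necessity of `φb < sup B⁺` and, after
separation of variables, uniqueness. Conversely, if `V⁺ > 0` on `(0, φb]`, the travel time `∫ ds /
√(2 V⁺)` is inverted. It diverges at `s = 0` because `g(0) = 0` (neutrality at infinity) and the C²
hypothesis give `V⁺ ≤ C s²`, so φ exists on the whole half line and tends to 0. The sign of `g'(0)`
decides the sign of V⁺ near 0; if it is positive, `V⁺ ≥ k s²` yields exponential decay.

The analytic difficulty is the weight `1 / √(2 (e + s))`, singular at turning points, when the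
density is integrated in energy. The L^r condition with `r > 2` controls it uniformly
(`RegularProfile.exists_tail_le`) and makes `s ↦ h(ξ₁² / 2 - s, ξ')` continuous into L¹. -/

/-- One-dimensional change of variables as a measure preserving map. -/
theorem measurePreserving_withDensity_abs_deriv {S : Set ℝ} {f f' : ℝ → ℝ} (hS : MeasurableSet S)
    (hf : Measurable f) (hderiv : ∀ x ∈ S, HasDerivWithinAt f (f' x) S x) (hinj : InjOn f S) :
    MeasurePreserving f ((volume.restrict S).withDensity fun x => ENNReal.ofReal |f' x|)
      (volume.restrict (f '' S)) := by
  refine ⟨hf, ?_⟩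
  ext A hA
  rw [Measure.map_apply hf hA, withDensity_apply _ (hf hA), ← lintegral_indicator (hf hA),
    ← lintegral_indicator_one hA, lintegral_image_eq_lintegral_abs_deriv_mul hS hderiv hinj]
  refine lintegral_congr fun x => ?_
  by_cases hx : f x ∈ A
  · rw [indicator_of_mem (show x ∈ f ⁻¹' A from hx), indicator_of_mem hx]; simp
  · rw [indicator_of_notMem (show x ∉ f ⁻¹' A from hx), indicator_of_notMem hx]; simp

theorem image_half_sq_sub (s : ℝ) : (fun v : ℝ => v ^ 2 / 2 - s) '' Ioi 0 = Ioi (-s) := by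
  ext e
  simp only [mem_image, mem_Ioi]
  constructor
  · rintro ⟨v, hv, rfl⟩
    nlinarith [pow_pos hv 2]
  · intro he
    refine ⟨√(2 * (e + s)), Real.sqrt_pos.2 (by linarith), ?_⟩
    rw [Real.sq_sqrt (by linarith)]; ring

theorem injOn_half_sq_sub (s : ℝ) : InjOn (fun v : ℝ => v ^ 2 / 2 - s) (Ioi 0) := by
  intro a ha b hb h
  simp only [mem_Ioi] at ha hb
  have : a ^ 2 = b ^ 2 := by simp only at h; linarith
  exact (pow_left_inj₀ ha.le hb.le two_ne_zero).1 this

theorem hasDerivAt_half_sq_sub (s v : ℝ) : HasDerivAt (fun v : ℝ => v ^ 2 / 2 - s) v v := by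
  have := (((hasDerivAt_id v).pow 2).div_const 2).sub_const s
  simpa using this

theorem measurePreserving_half_sq_sub (s : ℝ) :
    MeasurePreserving (fun v : ℝ => v ^ 2 / 2 - s)
      ((volume.restrict (Ioi 0)).withDensity fun v => ENNReal.ofReal v)
      (volume.restrict (Ioi (-s))) := by
  have h := measurePreserving_withDensity_abs_deriv (S := Ioi 0)
    (f := fun v : ℝ => v ^ 2 / 2 - s) (f' := fun v => v) measurableSet_Ioi (by fun_prop)
    (fun x _ => (hasDerivAt_half_sq_sub s x).hasDerivWithinAt) (injOn_half_sq_sub s)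
  rw [image_half_sq_sub] at h
  convert h using 1
  refine withDensity_congr_ae ?_
  filter_upwards [ae_restrict_mem measurableSet_Ioi] with v hv
  rw [abs_of_pos hv]

/-- The kinetic map `(v, ξ') ↦ (v² / 2 - s, ξ')` from velocities to energies. -/
def kin (s : ℝ) (ξ : Vel) : Vel := (ξ.1 ^ 2 / 2 - s, ξ.2)

@[fun_prop]
theorem measurable_kin (s : ℝ) : Measurable (kin s) := by
  unfold kin; fun_prop

theorem measurableSet_posVel : MeasurableSet posVel :=
  measurableSet_lt measurable_const measurable_fst

theorem posVel_eq : posVel = Ioi (0 : ℝ) ×ˢ (univ : Set (ℝ × ℝ)) := by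
  ext ξ; simp [posVel]

theorem restrict_posVel :
    (volume.restrict posVel : Measure Vel) = (volume.restrict (Ioi (0 : ℝ))).prod volume := by
  rw [posVel_eq, Measure.volume_eq_prod, ← Measure.prod_restrict, Measure.restrict_univ]

/-- The energies exceeding `c`. -/
def energyGT (c : ℝ) : Set Vel := {q | c < q.1}

theorem measurableSet_energyGT (c : ℝ) : MeasurableSet (energyGT c) :=
  measurableSet_lt measurable_const measurable_fst

/-- The Jacobian of `v ↦ v² / 2 - s` is v, so the flux measure `ξ₁ dξ` becomes Lebesgue measure in
`(e, ξ')` whatever s is. This is why fluxes, unlike densities, do not see the potential. -/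
theorem measurePreserving_kin (s : ℝ) :
    MeasurePreserving (kin s) ((volume.restrict posVel).withDensity fun ξ => ENNReal.ofReal ξ.1)
      (volume.restrict (energyGT (-s))) := by
  have h := (measurePreserving_half_sq_sub s).prod (MeasurePreserving.id (volume : Measure (ℝ × ℝ)))
  rw [prod_withDensity_left (by fun_prop)] at h
  have h2 : energyGT (-s) = Ioi (-s) ×ˢ (univ : Set (ℝ × ℝ)) := by ext; simp [energyGT]
  rw [restrict_posVel, h2, Measure.volume_eq_prod (α := ℝ) (β := ℝ × ℝ), ← Measure.prod_restrict,
    Measure.restrict_univ]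
  exact h

theorem kin_mem {s : ℝ} {ξ : Vel} (hξ : ξ ∈ posVel) : kin s ξ ∈ energyGT (-s) := by
  have : 0 < ξ.1 := hξ
  change -s < ξ.1 ^ 2 / 2 - s
  nlinarith [pow_pos this 2]

theorem sqrt_kin {s : ℝ} {ξ : Vel} (hξ : ξ ∈ posVel) : √(2 * ((kin s ξ).1 + s)) = ξ.1 := by
  have : 0 < ξ.1 := hξ
  have h : 2 * ((kin s ξ).1 + s) = ξ.1 ^ 2 := by simp only [kin]; ring
  rw [h, Real.sqrt_sq this.le]

theorem lintegral_mul_comp_kin (s : ℝ) {F : Vel → ENNReal} (hF : Measurable F) :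
    ∫⁻ ξ in posVel, ENNReal.ofReal ξ.1 * F (kin s ξ) = ∫⁻ q in energyGT (-s), F q := by
  rw [← (measurePreserving_kin s).lintegral_comp hF,
    lintegral_withDensity_eq_lintegral_mul _ (by fun_prop)
      (show Measurable fun ξ => F (kin s ξ) from hF.comp (measurable_kin s))]
  rfl

/-- Without the factor `ξ₁` the inverse speed appears as a weight, singular at the turning point `e
= -s`. -/
theorem lintegral_comp_kin (s : ℝ) {F : Vel → ENNReal} (hF : Measurable F) :
    ∫⁻ ξ in posVel, F (kin s ξ) =
      ∫⁻ q in energyGT (-s), ENNReal.ofReal (1 / √(2 * (q.1 + s))) * F q := by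
  rw [← lintegral_mul_comp_kin s (by fun_prop)]
  refine setLIntegral_congr_fun measurableSet_posVel fun ξ hξ => ?_
  have h0 : 0 < ξ.1 := hξ
  rw [sqrt_kin hξ, ← mul_assoc, ← ENNReal.ofReal_mul h0.le, mul_one_div_cancel h0.ne',
    ENNReal.ofReal_one, one_mul]

theorem integral_mul_comp_kin (s : ℝ) {F : Vel → ℝ} (hF : Measurable F) :
    ∫ ξ in posVel, ξ.1 * F (kin s ξ) = ∫ q in energyGT (-s), F q := by
  have h1 : ∫ q in energyGT (-s), F q = ∫ ξ, F (kin s ξ)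
      ∂((volume.restrict posVel).withDensity fun ξ => ENNReal.ofReal ξ.1) := by
    rw [← (measurePreserving_kin s).map_eq,
      integral_map (measurable_kin s).aemeasurable hF.aestronglyMeasurable]
  rw [h1, integral_withDensity_eq_integral_toReal_smul (by fun_prop) (by simp)]
  refine setIntegral_congr_fun measurableSet_posVel fun ξ hξ => ?_
  have h0 : 0 < ξ.1 := hξ
  simp [ENNReal.toReal_ofReal h0.le]

theorem integral_comp_kin (s : ℝ) {F : Vel → ℝ} (hF : Measurable F) :
    ∫ ξ in posVel, F (kin s ξ) = ∫ q in energyGT (-s), 1 / √(2 * (q.1 + s)) * F q := by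
  rw [← integral_mul_comp_kin s (by fun_prop)]
  refine setIntegral_congr_fun measurableSet_posVel fun ξ hξ => ?_
  have h0 : 0 < ξ.1 := hξ
  rw [sqrt_kin hξ, ← mul_assoc, mul_one_div_cancel h0.ne', one_mul]

/-- Almost everywhere statements on energies pull back to velocities. -/
theorem ae_comp_kin (s : ℝ) {P : Vel → Prop} (h : ∀ᵐ q ∂(volume.restrict (energyGT (-s))), P q) :
    ∀ᵐ ξ ∂(volume.restrict posVel), P (kin s ξ) := by
  have h1 := (measurePreserving_kin s).quasiMeasurePreserving.ae h
  rw [ae_withDensity_iff (by fun_prop)] at h1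
  filter_upwards [h1, ae_restrict_mem measurableSet_posVel] with ξ hξ hp
  have h0 : 0 < ξ.1 := hp
  exact hξ (by simpa using h0)

/-- Almost everywhere statements on velocities push forward to energies. -/
theorem ae_of_ae_posVel (s : ℝ) {P : Vel → Prop} (h : ∀ᵐ ξ ∂(volume.restrict posVel), P ξ) :
    ∀ᵐ q ∂(volume.restrict (energyGT (-s))), P (√(2 * (q.1 + s)), q.2) := by
  rw [← (measurePreserving_kin s).map_eq]
  obtain ⟨A, hA, hAm, hA0⟩ : ∃ A : Set Vel, (∀ ξ ∈ A, P ξ) ∧ MeasurableSet A ∧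
      (volume.restrict posVel) Aᶜ = 0 := by
    obtain ⟨t, h1, h2, h3⟩ := exists_measurable_superset_of_null (ae_iff.1 h)
    refine ⟨tᶜ, fun ξ hξ => ?_, h2.compl, by simpa using h3⟩
    by_contra hP
    exact hξ (h1 hP)
  have hm : Measurable fun q : Vel => ((√(2 * (q.1 + s)), q.2) : Vel) := by fun_prop
  have key : ∀ᵐ q ∂(Measure.map (kin s)
      ((volume.restrict posVel).withDensity fun ξ => ENNReal.ofReal ξ.1)),
      ((√(2 * (q.1 + s)), q.2) : Vel) ∈ A := by
    rw [ae_map_iff (measurable_kin s).aemeasurable (hm hAm)]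
    rw [ae_withDensity_iff (by fun_prop)]
    have : ∀ᵐ ξ ∂(volume.restrict posVel), ξ ∈ A := by
      rw [ae_iff]; exact hA0
    filter_upwards [this, ae_restrict_mem measurableSet_posVel] with ξ hξ hp _
    rw [sqrt_kin hp]
    exact hξ
  filter_upwards [key] with q hq using hA _ hq

/-! ### Reflection of velocities and splitting into half spaces -/

/-- Reflection of the first velocity component. -/
def refl (ξ : Vel) : Vel := (-ξ.1, ξ.2)

theorem measurePreserving_refl : MeasurePreserving refl (volume : Measure Vel) volume := by
  have := (Measure.measurePreserving_neg (volume : Measure ℝ)).prod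
    (MeasurePreserving.id (volume : Measure (ℝ × ℝ)))
  exact this

@[fun_prop]
theorem measurable_refl : Measurable refl := measurePreserving_refl.measurable

@[simp] theorem refl_refl (ξ : Vel) : refl (refl ξ) = ξ := by simp [refl]

theorem measurableEmbedding_refl : MeasurableEmbedding refl :=
  (MeasurableEquiv.mk ⟨refl, refl, refl_refl, refl_refl⟩ measurable_refl
    measurable_refl).measurableEmbedding

@[simp] theorem kin_refl (s : ℝ) (ξ : Vel) : kin s (refl ξ) = kin s ξ := by simp [kin, refl]

/-- The half space `{ξ₁ < 0}`. -/
def negVel : Set Vel := {ξ | ξ.1 < 0}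

theorem measurableSet_negVel : MeasurableSet negVel :=
  measurableSet_lt measurable_fst measurable_const

theorem refl_preimage_posVel : refl ⁻¹' posVel = negVel := by
  ext ξ; simp [refl, posVel, negVel]

theorem measurePreserving_refl_neg :
    MeasurePreserving refl (volume.restrict negVel) (volume.restrict posVel) := by
  rw [← refl_preimage_posVel]
  exact measurePreserving_refl.restrict_preimage measurableSet_posVel

theorem setIntegral_negVel (F : Vel → ℝ) : ∫ ξ in negVel, F ξ = ∫ ξ in posVel, F (refl ξ) := by
  rw [← measurePreserving_refl_neg.integral_comp measurableEmbedding_refl]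
  simp

theorem ae_fst_ne (c : ℝ) : ∀ᵐ ξ : Vel, ξ.1 ≠ c := by
  have : (volume : Measure Vel) {ξ | ξ.1 = c} = 0 := by
    have h : {ξ : Vel | ξ.1 = c} = ({c} : Set ℝ) ×ˢ (univ : Set (ℝ × ℝ)) := by ext; simp
    rw [h, Measure.volume_eq_prod, Measure.prod_prod]; simp
  rw [ae_iff]; simpa using this

theorem restrict_compl_posVel :
    (volume.restrict posVelᶜ : Measure Vel) = volume.restrict negVel := by
  refine Measure.restrict_congr_set ?_
  filter_upwards [ae_fst_ne 0] with ξ hξ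
  refine propext ⟨fun h => ?_, fun h => ?_⟩
  · exact lt_of_le_of_ne (not_lt.1 h) hξ
  · exact not_lt.2 (le_of_lt h)

/-- A velocity-space integral as the sum over the two half spaces. -/
theorem integral_eq_add_refl {F : Vel → ℝ} (hF : Integrable F) :
    ∫ ξ, F ξ = (∫ ξ in posVel, F ξ) + ∫ ξ in posVel, F (refl ξ) := by
  rw [← integral_add_compl measurableSet_posVel hF, restrict_compl_posVel, setIntegral_negVel]

theorem ae_of_posVel {P : Vel → Prop} (h1 : ∀ᵐ ξ ∂(volume.restrict posVel), P ξ)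
    (h2 : ∀ᵐ ξ ∂(volume.restrict posVel), P (refl ξ)) : ∀ᵐ ξ, P ξ := by
  have h3 := measurePreserving_refl_neg.quasiMeasurePreserving.ae h2
  rw [ae_restrict_iff' measurableSet_posVel] at h1
  rw [ae_restrict_iff' measurableSet_negVel] at h3
  filter_upwards [h1, h3, ae_fst_ne 0] with ξ a b c
  rcases lt_or_gt_of_ne c with h | h
  · simpa using b h
  · exact a h

theorem ae_posVel_of_ae {P : Vel → Prop} (h : ∀ᵐ ξ, P ξ) :
    ∀ᵐ ξ ∂(volume.restrict posVel), P ξ ∧ P (refl ξ) :=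
  ae_restrict_of_ae (h.and (measurePreserving_refl.quasiMeasurePreserving.ae h))

end

section

/-! ### Continuity in `L¹` of densities depending on the energy -/

/-- Profiles `h(e, ξ')` supported in `e > -φb` for which `ξ ↦ h(ξ₁² / 2 - s, ξ')` is integrable,
uniformly in `s ≥ 0`. -/
structure RegularProfile (φb r : ℝ) (h : Vel → ℝ) : Prop where
  meas : Measurable h
  zero : ∀ q : Vel, q.1 ≤ -φb → h q = 0
  int_pos : ∫⁻ ξ in posVel, ‖h (kin 0 ξ)‖ₑ ≠ ⊤
  int_neg : ∫⁻ e in Iic (0 : ℝ), (∫⁻ η : ℝ × ℝ, ‖h (e, η)‖ₑ) ^ r ≠ ⊤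

/-- Dominated convergence: the indicators of sets that eventually leave every point tend to 0 under
the integrable majorant `F`. -/
theorem exists_setLIntegral_le {X : Type*} [MeasurableSpace X] {μ : Measure X} {F : X → ENNReal}
    (hF : Measurable F) (hfin : ∫⁻ x, F x ∂μ ≠ ⊤) {W : ℕ → Set X} (hW : ∀ n, MeasurableSet (W n))
    (hlim : ∀ x, ∀ᶠ n in atTop, x ∉ W n) {ε : ENNReal} (hε : ε ≠ 0) :
    ∀ᶠ n in atTop, ∫⁻ x in W n, F x ∂μ ≤ ε := by
  have h : Tendsto (fun n => ∫⁻ x, (W n).indicator F x ∂μ) atTop (𝓝 (∫⁻ _, 0 ∂μ)) := by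
    refine tendsto_lintegral_of_dominated_convergence F (fun n => hF.indicator (hW n))
      (fun n => Eventually.of_forall fun x => indicator_le_self _ _ x) hfin
      (Eventually.of_forall fun x => ?_)
    refine tendsto_const_nhds.congr' ?_
    filter_upwards [hlim x] with n hn
    rw [indicator_of_notMem hn]
  rw [lintegral_zero] at h
  filter_upwards [h.eventually_le_const (pos_iff_ne_zero.2 hε)] with n hn
  rwa [← lintegral_indicator (hW n)]

/-- For `e > 0` the weight `1 / √(2 (e + s))` decreases in s, so the value at potential 0 dominates
all others. -/
theorem lintegral_comp_kin_le {s : ℝ} (hs : 0 ≤ s) {F : Vel → ENNReal} (hF : Measurable F)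
    (hF0 : ∀ q : Vel, q.1 ≤ 0 → F q = 0) :
    ∫⁻ ξ in posVel, F (kin s ξ) ≤ ∫⁻ ξ in posVel, F (kin 0 ξ) := by
  rw [lintegral_comp_kin s hF, lintegral_comp_kin 0 hF, ← lintegral_indicator
    (measurableSet_energyGT _), ← lintegral_indicator (measurableSet_energyGT _)]
  refine lintegral_mono fun q => ?_
  by_cases hq : 0 < q.1
  · rw [indicator_of_mem (show q ∈ energyGT (-s) from lt_of_le_of_lt (by linarith) hq),
      indicator_of_mem (show q ∈ energyGT (-0) by simpa [energyGT] using hq)]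
    gcongr
  · have h0 := hF0 q (not_lt.1 hq)
    have : (energyGT (-s)).indicator
        (fun q : Vel => ENNReal.ofReal (1 / √(2 * (q.1 + s))) * F q) q = 0 := by
      by_cases hm : q ∈ energyGT (-s)
      · rw [indicator_of_mem hm, h0, mul_zero]
      · rw [indicator_of_notMem hm]
    rw [this]; exact zero_le

/-- Either `H` is below the threshold `v ^ (-1 / (r - 1))`, or `v * H ^ (r - 1) ≥ 1`. The threshold
is integrable at `v = 0` because `r > 2`, and the factor v in the other term is what turns `dv` into
`de`. -/
theorem le_rpow_neg_add_mul_rpow {r : ℝ} (hr : 2 < r) {v : ℝ} (hv : 0 < v) (H : ENNReal) :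
    H ≤ ENNReal.ofReal (v ^ (-(1 / (r - 1)))) + ENNReal.ofReal v * H ^ r := by
  rcases le_total H (ENNReal.ofReal (v ^ (-(1 / (r - 1))))) with h | h
  · exact h.trans le_self_add
  refine le_trans ?_ le_add_self
  have h1 : (ENNReal.ofReal (v ^ (-(1 / (r - 1))))) ^ (r - 1) ≤ H ^ (r - 1) :=
    ENNReal.rpow_le_rpow h (by linarith)
  have h2 : H ^ r = H * H ^ (r - 1) := by
    conv_lhs => rw [show r = 1 + (r - 1) by ring, ENNReal.rpow_add_of_nonneg _ _ zero_le_one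
      (by linarith), ENNReal.rpow_one]
  have h3 : ENNReal.ofReal v * (ENNReal.ofReal (v ^ (-(1 / (r - 1))))) ^ (r - 1) = 1 := by
    rw [ENNReal.ofReal_rpow_of_pos (by positivity), ← Real.rpow_mul hv.le,
      ← ENNReal.ofReal_mul hv.le, neg_mul, one_div_mul_cancel (by linarith), Real.rpow_neg_one,
      mul_inv_cancel₀ hv.ne', ENNReal.ofReal_one]
  calc H = H * (ENNReal.ofReal v * (ENNReal.ofReal (v ^ (-(1 / (r - 1))))) ^ (r - 1)) := by
        rw [h3, mul_one]
    _ ≤ H * (ENNReal.ofReal v * H ^ (r - 1)) := by gcongr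
    _ = ENNReal.ofReal v * H ^ r := by rw [h2]; ring

theorem lintegral_mul_comp_half_sq (s : ℝ) {F : ℝ → ENNReal} (hF : Measurable F) :
    ∫⁻ v in Ioi (0 : ℝ), ENNReal.ofReal v * F (v ^ 2 / 2 - s) = ∫⁻ e in Ioi (-s), F e := by
  rw [← (measurePreserving_half_sq_sub s).lintegral_comp hF,
    lintegral_withDensity_eq_lintegral_mul _ (by fun_prop)
      (show Measurable fun v : ℝ => F (v ^ 2 / 2 - s) from hF.comp (by fun_prop))]
  rfl

/-- Uniformity in s: the threshold term does not involve s, and the other becomes `∫ H ^ r de` over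
an energy interval of length `δ² / 2`, wherever that interval lies. Absolute continuity makes both
small. -/
theorem exists_lintegral_half_sq_le {r : ℝ} (hr : 2 < r) {H : ℝ → ENNReal} (hH : Measurable H)
    (hfin : ∫⁻ e, H e ^ r ≠ ⊤) {ε : ENNReal} (hε : ε ≠ 0) :
    ∃ δ₀ > 0, ∀ δ ∈ Ioc 0 δ₀, ∀ s : ℝ, ∫⁻ v in Ioo 0 δ, H (v ^ 2 / 2 - s) ≤ ε := by
  have hε2 : ε / 2 ≠ 0 := by simpa using hε
  have hθ : -1 < -(1 / (r - 1)) := by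
    rw [neg_lt_neg_iff, div_lt_one (by linarith)]; linarith
  have hfin_int : ∫⁻ v in Ioo (0 : ℝ) 1, ENNReal.ofReal (v ^ (-(1 / (r - 1)))) ≠ ⊤ := by
    have h1 : IntegrableOn (fun v : ℝ => v ^ (-(1 / (r - 1)))) (Ioo 0 1) :=
      (intervalIntegral.integrableOn_Ioo_rpow_iff one_pos).2 hθ
    exact h1.lintegral_lt_top.ne
  obtain ⟨δ₁, hδ₁, h1⟩ := exists_pos_setLIntegral_lt_of_measure_lt hfin_int hε2
  obtain ⟨δ₂, hδ₂, h2⟩ := exists_pos_setLIntegral_lt_of_measure_lt hfin hε2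
  obtain ⟨c, hc0, hc⟩ : ∃ c : ℝ, 0 < c ∧ ENNReal.ofReal c < min δ₁ δ₂ := by
    obtain ⟨c, hc0, hc⟩ := ENNReal.lt_iff_exists_nnreal_btwn.1 (lt_min hδ₁ hδ₂)
    exact ⟨c, by exact_mod_cast hc0, by simpa using hc⟩
  -- With `δ ≤ 1` the interval `(0, δ)` stays inside `(0, 1)`, and `δ² / 2 ≤ c`.
  refine ⟨min c 1, lt_min hc0 one_pos, fun δ hδ s => ?_⟩
  have hδ0 : 0 < δ := hδ.1
  have hδc : δ ≤ c := hδ.2.trans (min_le_left _ _)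
  have hδ1 : δ ≤ 1 := hδ.2.trans (min_le_right _ _)
  have hA : ∫⁻ v in Ioo 0 δ, ENNReal.ofReal (v ^ (-(1 / (r - 1)))) ≤ ε / 2 := by
    have := h1 (Ioo 0 δ) (by
      rw [Measure.restrict_apply measurableSet_Ioo]
      refine lt_of_le_of_lt (measure_mono inter_subset_left) ?_
      rw [Real.volume_Ioo, sub_zero]
      exact lt_of_le_of_lt (ENNReal.ofReal_le_ofReal hδc) (hc.trans_le (min_le_left _ _)))
    rw [Measure.restrict_restrict measurableSet_Ioo,
      inter_eq_left.2 (Ioo_subset_Ioo_right hδ1)] at this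
    exact this.le
  have hB : ∫⁻ v in Ioo 0 δ, ENNReal.ofReal v * H (v ^ 2 / 2 - s) ^ r ≤ ε / 2 := by
    have hm : Measurable ((Ioo (-s) (δ ^ 2 / 2 - s)).indicator fun e => H e ^ r) :=
      (hH.pow_const r).indicator measurableSet_Ioo
    have h3 := lintegral_mul_comp_half_sq s hm
    rw [← lintegral_indicator measurableSet_Ioi] at h3
    calc ∫⁻ v in Ioo 0 δ, ENNReal.ofReal v * H (v ^ 2 / 2 - s) ^ r
        ≤ ∫⁻ v, (Ioi (0 : ℝ)).indicator (fun v => ENNReal.ofReal v *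
          (Ioo (-s) (δ ^ 2 / 2 - s)).indicator (fun e => H e ^ r) (v ^ 2 / 2 - s)) v := by
          rw [← lintegral_indicator measurableSet_Ioo]
          refine lintegral_mono fun v => ?_
          by_cases hv : v ∈ Ioo 0 δ
          · have hv2 : v ^ 2 / 2 - s ∈ Ioo (-s) (δ ^ 2 / 2 - s) := by
              constructor
              · nlinarith [pow_pos hv.1 2]
              · nlinarith [hv.1, hv.2]
            rw [indicator_of_mem hv, indicator_of_mem (show v ∈ Ioi (0 : ℝ) from hv.1),
              indicator_of_mem hv2]
          · rw [indicator_of_notMem hv]; exact zero_le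
      _ = ∫⁻ e in Ioi (-s), (Ioo (-s) (δ ^ 2 / 2 - s)).indicator (fun e => H e ^ r) e := h3
      _ ≤ ∫⁻ e in Ioo (-s) (δ ^ 2 / 2 - s), H e ^ r := by
          rw [← lintegral_indicator measurableSet_Ioo]
          exact setLIntegral_le_lintegral _ _
      _ ≤ ε / 2 := by
          refine (h2 _ ?_).le
          rw [Real.volume_Ioo]
          refine lt_of_le_of_lt (ENNReal.ofReal_le_ofReal ?_) (hc.trans_le (min_le_right _ _))
          nlinarith
  calc ∫⁻ v in Ioo 0 δ, H (v ^ 2 / 2 - s)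
      ≤ ∫⁻ v in Ioo 0 δ, (ENNReal.ofReal (v ^ (-(1 / (r - 1)))) +
        ENNReal.ofReal v * H (v ^ 2 / 2 - s) ^ r) :=
        setLIntegral_mono' measurableSet_Ioo fun v hv => le_rpow_neg_add_mul_rpow hr hv.1 _
    _ = (∫⁻ v in Ioo 0 δ, ENNReal.ofReal (v ^ (-(1 / (r - 1))))) +
        ∫⁻ v in Ioo 0 δ, ENNReal.ofReal v * H (v ^ 2 / 2 - s) ^ r :=
        lintegral_add_left (by fun_prop) _
    _ ≤ ε / 2 + ε / 2 := add_le_add hA hB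
    _ = ε := ENNReal.add_halves ε

/-- Slow and fast particles contribute little, uniformly in bounded `s ≥ 0`. -/
theorem RegularProfile.exists_tail_le {φb r : ℝ} {h : Vel → ℝ} (hh : RegularProfile φb r h)
    (hr : 2 < r) (S : ℝ) {ε : ENNReal} (hε : ε ≠ 0) :
    ∃ δ > 0, ∃ R : ℝ, ∀ s ∈ Icc 0 S,
      ∫⁻ ξ in posVel ∩ {ξ | ξ.1 < δ ∨ R < ξ.1}, ‖h (kin s ξ)‖ₑ ≤ ε := by
  have hm := hh.meas
  have hε2 : ε / 2 ≠ 0 := by simpa using hε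
  -- Nonpositive energies are handled by the L^r bound through `H`; positive ones by comparison with
  -- potential 0.
  set H : ℝ → ENNReal := (Iic (0 : ℝ)).indicator fun e => ∫⁻ η : ℝ × ℝ, ‖h (e, η)‖ₑ with hHdef
  have hHm : Measurable H := by
    refine Measurable.indicator ?_ measurableSet_Iic
    exact Measurable.lintegral_prod_right' (f := fun p : ℝ × (ℝ × ℝ) => ‖h p‖ₑ) hm.enorm
  have hHr : ∫⁻ e, H e ^ r ≠ ⊤ := by
    have : (fun e => H e ^ r) =
        (Iic (0 : ℝ)).indicator fun e => (∫⁻ η : ℝ × ℝ, ‖h (e, η)‖ₑ) ^ r := by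
      funext e
      by_cases he : e ∈ Iic (0 : ℝ)
      · simp only [hHdef, indicator_of_mem he]
      · simp only [hHdef, indicator_of_notMem he]
        exact ENNReal.zero_rpow_of_pos (by linarith)
    rw [this, lintegral_indicator measurableSet_Iic]
    exact hh.int_neg
  obtain ⟨δ₀, hδ₀, hslow⟩ := exists_lintegral_half_sq_le hr hHm hHr hε2
  -- `A n` contains every positive energy that a particle slower than `1 / (n + 1)` or faster than
  -- `n` can have at a potential in `[0, S]`.
  set A : ℕ → Set Vel := fun n =>
    {q | 0 < q.1 ∧ (q.1 < (1 / ((n : ℝ) + 1)) ^ 2 / 2 ∨ (n : ℝ) ^ 2 / 2 - S < q.1)} with hA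
  have hAm : ∀ n, MeasurableSet (A n) := fun n =>
    (measurableSet_lt measurable_const measurable_fst).inter
      ((measurableSet_lt measurable_fst measurable_const).union
        (measurableSet_lt measurable_const measurable_fst))
  have hsmall : ∀ᶠ n in atTop, ∫⁻ ξ in kin 0 ⁻¹' A n, ‖h (kin 0 ξ)‖ₑ ∂(volume.restrict posVel)
      ≤ ε / 2 := by
    refine exists_setLIntegral_le (by fun_prop) hh.int_pos
      (fun n => measurable_kin 0 (hAm n)) (fun ξ => ?_) hε2
    have h1 : Tendsto (fun n : ℕ => (1 / ((n : ℝ) + 1)) ^ 2 / 2) atTop (𝓝 0) := by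
      have := ((tendsto_one_div_add_atTop_nhds_zero_nat (𝕜 := ℝ)).pow 2).div_const 2
      simpa using this
    have h2 : Tendsto (fun n : ℕ => (n : ℝ) ^ 2 / 2 - S) atTop atTop := by
      refine tendsto_atTop_add_const_right _ (-S) ?_
      exact ((tendsto_pow_atTop two_ne_zero).comp tendsto_natCast_atTop_atTop).atTop_div_const
        two_pos
    by_cases h0 : 0 < (kin 0 ξ).1
    · filter_upwards [h1.eventually_le_const h0, h2.eventually_ge_atTop (kin 0 ξ).1] with n a b
      rintro ⟨-, c | c⟩ <;> linarith
    · exact Eventually.of_forall fun n hn => h0 hn.1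
  have hδn : ∀ᶠ n : ℕ in atTop, 1 / ((n : ℝ) + 1) ≤ δ₀ :=
    (tendsto_one_div_add_atTop_nhds_zero_nat (𝕜 := ℝ)).eventually_le_const hδ₀
  -- Ensures that a particle faster than `n` cannot have nonpositive energy.
  have hRn : ∀ᶠ n : ℕ in atTop, S ≤ (n : ℝ) ^ 2 / 2 :=
    (((tendsto_pow_atTop two_ne_zero).comp tendsto_natCast_atTop_atTop).atTop_div_const
        two_pos).eventually_ge_atTop S
  obtain ⟨n, hn1, hn2, hn3⟩ := (hsmall.and (hδn.and hRn)).exists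
  set δ : ℝ := 1 / ((n : ℝ) + 1) with hδdef
  have hδpos : 0 < δ := by positivity
  refine ⟨δ, hδpos, n, fun s hs => ?_⟩
  have hFm : Measurable ((A n).indicator fun q => ‖h q‖ₑ) := hm.enorm.indicator (hAm n)
  set N : Set Vel := {q | q.1 ≤ 0} with hN
  have hNm : MeasurableSet N := measurableSet_le measurable_fst measurable_const
  have hslow' : ∫⁻ ξ in posVel, (Ioo (0 : ℝ) δ).indicator (fun v => N.indicator
      (fun q => ‖h q‖ₑ) (v ^ 2 / 2 - s, ξ.2)) ξ.1 ≤ ε / 2 := by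
    have hmm : Measurable fun ξ : ℝ × (ℝ × ℝ) => (Ioo (0 : ℝ) δ).indicator (fun v => N.indicator
      (fun q => ‖h q‖ₑ) (v ^ 2 / 2 - s, ξ.2)) ξ.1 := by
      have : (fun ξ : ℝ × (ℝ × ℝ) => (Ioo (0 : ℝ) δ).indicator (fun v => N.indicator
        (fun q => ‖h q‖ₑ) (v ^ 2 / 2 - s, ξ.2)) ξ.1) =
        (Prod.fst ⁻¹' Ioo (0 : ℝ) δ).indicator fun ξ : ℝ × (ℝ × ℝ) => N.indicator
        (fun q => ‖h q‖ₑ) (kin s ξ) := by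
        funext ξ; rfl
      rw [this]
      exact ((hm.enorm.indicator hNm).comp (measurable_kin s)).indicator
        (measurable_fst measurableSet_Ioo)
    rw [restrict_posVel, lintegral_prod _ hmm.aemeasurable]
    refine le_trans ?_ (hslow δ ⟨hδpos, hn2⟩ s)
    rw [← lintegral_indicator measurableSet_Ioo]
    refine (setLIntegral_le_lintegral _ _).trans (lintegral_mono fun v => ?_)
    by_cases hv : v ∈ Ioo 0 δ
    · simp only [indicator_of_mem hv, hHdef]
      by_cases he : v ^ 2 / 2 - s ≤ 0
      · rw [indicator_of_mem (show v ^ 2 / 2 - s ∈ Iic (0 : ℝ) from he)]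
        exact lintegral_mono fun η => indicator_le_self _ _ _
      · have : ∀ η : ℝ × ℝ, N.indicator (fun q => ‖h q‖ₑ) (v ^ 2 / 2 - s, η) = 0 := fun η =>
          indicator_of_notMem (by simpa [hN] using he) _
        simp only [this, lintegral_zero, zero_le]
    · simp only [indicator_of_notMem hv, lintegral_zero, le_refl]
  have hpos : ∫⁻ ξ in posVel, (A n).indicator (fun q => ‖h q‖ₑ) (kin s ξ) ≤ ε / 2 := by
    refine (lintegral_comp_kin_le hs.1 hFm fun q hq => ?_).trans ?_
    · exact indicator_of_notMem (fun hc => absurd hc.1 (not_lt.2 hq)) _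
    · refine le_trans (le_of_eq ?_) hn1
      rw [← lintegral_indicator (measurable_kin 0 (hAm n))]
      rfl
  calc ∫⁻ ξ in posVel ∩ {ξ | ξ.1 < δ ∨ (n : ℝ) < ξ.1}, ‖h (kin s ξ)‖ₑ
      ≤ ∫⁻ ξ in posVel, ((Ioo (0 : ℝ) δ).indicator (fun v => N.indicator
          (fun q => ‖h q‖ₑ) (v ^ 2 / 2 - s, ξ.2)) ξ.1 +
          (A n).indicator (fun q => ‖h q‖ₑ) (kin s ξ)) := by
        have hWm : MeasurableSet {ξ : Vel | ξ.1 < δ ∨ (n : ℝ) < ξ.1} :=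
          (measurableSet_lt measurable_fst measurable_const).union
            (measurableSet_lt measurable_const measurable_fst)
        rw [← lintegral_indicator (measurableSet_posVel.inter hWm),
          ← lintegral_indicator measurableSet_posVel]
        refine lintegral_mono fun ξ => ?_
        by_cases hξ : ξ ∈ posVel ∩ {ξ : Vel | ξ.1 < δ ∨ (n : ℝ) < ξ.1}
        · rw [indicator_of_mem hξ, indicator_of_mem hξ.1]
          have hv : 0 < ξ.1 := hξ.1
          by_cases he : (kin s ξ).1 ≤ 0
          · have hv2 : ξ.1 ∈ Ioo 0 δ := by
              rcases hξ.2 with h1 | h1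
              · exact ⟨hv, h1⟩
              · exfalso
                simp only [kin] at he
                have hn0 : (0 : ℝ) ≤ n := Nat.cast_nonneg n
                nlinarith [hs.2]
            rw [indicator_of_mem hv2, indicator_of_mem (show ((ξ.1 ^ 2 / 2 - s, ξ.2) : Vel) ∈ N
              from he)]
            exact le_self_add
          · refine le_trans (le_of_eq ?_) le_add_self
            rw [indicator_of_mem]
            refine ⟨not_le.1 he, ?_⟩
            simp only [kin]
            rcases hξ.2 with h1 | h1
            · left
              nlinarith [hs.1]
            · right
              have hn0 : (0 : ℝ) ≤ n := Nat.cast_nonneg n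
              nlinarith [hs.2]
        · rw [indicator_of_notMem hξ]; exact zero_le
    _ = (∫⁻ ξ in posVel, (Ioo (0 : ℝ) δ).indicator (fun v => N.indicator
          (fun q => ‖h q‖ₑ) (v ^ 2 / 2 - s, ξ.2)) ξ.1) +
          ∫⁻ ξ in posVel, (A n).indicator (fun q => ‖h q‖ₑ) (kin s ξ) :=
        lintegral_add_right _ (hFm.comp (measurable_kin s))
    _ ≤ ε / 2 + ε / 2 := add_le_add hslow' hpos
    _ = ε := ENNReal.add_halves ε

/-- The profile is integrable over energies bounded above. -/
theorem RegularProfile.lintegral_lt_top {φb r : ℝ} {h : Vel → ℝ} (hh : RegularProfile φb r h)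
    (hr : 2 < r) (M : ℝ) : ∫⁻ q, {q : Vel | q.1 < M}.indicator (fun q => ‖h q‖ₑ) q < ⊤ := by
  have hm := hh.meas
  have hMm : MeasurableSet {q : Vel | q.1 < M} := measurableSet_lt measurable_fst measurable_const
  set F := {q : Vel | q.1 < M}.indicator (fun q => ‖h q‖ₑ) with hF
  have hFm : Measurable F := hm.enorm.indicator hMm
  rw [← lintegral_add_compl _ (measurableSet_energyGT (-0))]
  refine ENNReal.add_lt_top.2 ⟨?_, ?_⟩
  · rw [← lintegral_mul_comp_kin 0 hFm]
    refine lt_of_le_of_lt (setLIntegral_mono' (g := fun ξ => ENNReal.ofReal √(2 * M) *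
      ‖h (kin 0 ξ)‖ₑ) measurableSet_posVel fun ξ hξ => ?_) ?_
    · by_cases hc : (kin 0 ξ).1 < M
      · rw [hF, indicator_of_mem (show kin 0 ξ ∈ {q : Vel | q.1 < M} from hc)]
        gcongr
        refine Real.le_sqrt_of_sq_le ?_
        simp only [kin] at hc
        linarith
      · rw [hF, indicator_of_notMem (show kin 0 ξ ∉ {q : Vel | q.1 < M} from hc), mul_zero]
        exact zero_le
    · rw [lintegral_const_mul _ (by fun_prop)]
      exact ENNReal.mul_lt_top ENNReal.ofReal_lt_top hh.int_pos.lt_top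
  · have hset : (energyGT (-0))ᶜ = Iic (0 : ℝ) ×ˢ (univ : Set (ℝ × ℝ)) := by
      ext q; simp [energyGT]
    have h1 : ∫⁻ q in (energyGT (-0))ᶜ, F q ≤
        ∫⁻ e in Iic (0 : ℝ), ∫⁻ η : ℝ × ℝ, ‖h (e, η)‖ₑ := by
      rw [hset, Measure.volume_eq_prod, ← Measure.prod_restrict, Measure.restrict_univ,
        lintegral_prod _ hFm.aemeasurable]
      exact lintegral_mono fun e => lintegral_mono fun η => indicator_le_self _ _ _
    refine lt_of_le_of_lt h1 ?_
    -- On the bounded interval `(-φb, 0]` that carries the profile, `y ≤ 1 + y ^ r` turns the L^r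
    -- bound into an L¹ bound.
    calc ∫⁻ e in Iic (0 : ℝ), ∫⁻ η : ℝ × ℝ, ‖h (e, η)‖ₑ
        ≤ ∫⁻ e in Iic (0 : ℝ), ((Ioi (-φb)).indicator 1 e + (∫⁻ η : ℝ × ℝ, ‖h (e, η)‖ₑ) ^ r) := by
          refine lintegral_mono fun e => ?_
          by_cases he : e ∈ Ioi (-φb)
          · simp only [indicator_of_mem he, Pi.one_apply]
            rcases le_total (∫⁻ η : ℝ × ℝ, ‖h (e, η)‖ₑ) 1 with h1 | h1
            · exact h1.trans le_self_add
            · refine le_trans ?_ le_add_self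
              conv_lhs => rw [← ENNReal.rpow_one (∫⁻ η : ℝ × ℝ, ‖h (e, η)‖ₑ)]
              exact ENNReal.rpow_le_rpow_of_exponent_le h1 (by linarith)
          · have : ∀ η : ℝ × ℝ, h (e, η) = 0 := fun η => hh.zero _ (not_lt.1 he)
            simp [this]
      _ = (∫⁻ e in Iic (0 : ℝ), (Ioi (-φb)).indicator 1 e) +
          ∫⁻ e in Iic (0 : ℝ), (∫⁻ η : ℝ × ℝ, ‖h (e, η)‖ₑ) ^ r :=
          lintegral_add_left (measurable_one.indicator measurableSet_Ioi) _
      _ < ⊤ := by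
          refine ENNReal.add_lt_top.2 ⟨?_, hh.int_neg.lt_top⟩
          rw [lintegral_indicator_one measurableSet_Ioi,
            Measure.restrict_apply measurableSet_Ioi, Ioi_inter_Iic]
          simp

end

/-! ### Translation continuity and continuity in the potential -/

section

/-- Continuity of translations in L¹, read off from the continuity of composition with measure
preserving maps in `Lp`. -/
theorem tendsto_lintegral_translate_sub {g : Vel → ℝ} (hg : Integrable g) :
    Tendsto (fun c : ℝ => ∫⁻ q : Vel, ‖g (q.1 + c, q.2) - g q‖ₑ) (𝓝 0) (𝓝 0) := by
  have hL : MemLp g 1 (volume : Measure Vel) := memLp_one_iff_integrable.2 hg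
  have hmp : ∀ c : ℝ, MeasurePreserving (fun q : Vel => ((q.1 + c, q.2) : Vel)) volume volume :=
    fun c => (measurePreserving_add_right (volume : Measure ℝ) c).prod
      (MeasurePreserving.id (volume : Measure (ℝ × ℝ)))
  let T : ℝ → C(Vel, Vel) := fun c => ⟨fun q => (q.1 + c, q.2), by fun_prop⟩
  have hT : Continuous T :=
    (ContinuousMap.mk (fun a : ℝ × Vel => ((a.2.1 + a.1, a.2.2) : Vel))
      (by fun_prop)).curry.continuous
  have hc : Continuous fun c : ℝ => Lp.compMeasurePreserving (T c) (hmp c) (hL.toLp g) :=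
    continuous_const.compMeasurePreservingLp hT hmp ENNReal.one_ne_top
  have h2 := (hc.tendsto 0).edist (tendsto_const_nhds (x := Lp.compMeasurePreserving (T 0) (hmp 0)
    (hL.toLp g)))
  rw [edist_self] at h2
  refine h2.congr fun c => ?_
  rw [Lp.toLp_compMeasurePreserving hL, Lp.toLp_compMeasurePreserving hL, Lp.edist_toLp_toLp,
    eLpNorm_one_eq_lintegral_enorm]
  refine lintegral_congr fun q => ?_
  simp [T]

variable {φb r : ℝ} {h : Vel → ℝ}

/-- The profile restricted to energies below `M`. -/
def truncProfile (M : ℝ) (h : Vel → ℝ) : Vel → ℝ := {q : Vel | q.1 < M}.indicator h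

theorem RegularProfile.integrable_trunc (hh : RegularProfile φb r h) (hr : 2 < r) (M : ℝ) :
    Integrable (truncProfile M h) := by
  have hMm : MeasurableSet {q : Vel | q.1 < M} := measurableSet_lt measurable_fst measurable_const
  refine ⟨(hh.meas.indicator hMm).aestronglyMeasurable, ?_⟩
  rw [hasFiniteIntegral_iff_enorm]
  refine lt_of_le_of_lt (le_of_eq (lintegral_congr fun q => ?_)) (hh.lintegral_lt_top hr M)
  exact enorm_indicator_eq_indicator_enorm _ _

theorem measurable_truncProfile (M : ℝ) (hm : Measurable h) : Measurable (truncProfile M h) :=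
  hm.indicator (measurableSet_lt measurable_fst measurable_const)

/-- A speed at most `R` means an energy at most `R² / 2`, so the truncation is invisible. It is
needed because only the truncated profile is known to be integrable in energy. -/
theorem truncProfile_kin {R s : ℝ} {ξ : Vel} (hs : 0 ≤ s) (h0 : 0 < ξ.1) (hR : ξ.1 ≤ R) :
    truncProfile (R ^ 2 / 2 + 1) h (kin s ξ) = h (kin s ξ) := by
  refine indicator_of_mem ?_ _
  change ξ.1 ^ 2 / 2 - s < R ^ 2 / 2 + 1
  nlinarith

theorem measurableSet_speed (δ R : ℝ) : MeasurableSet {ξ : Vel | ξ.1 < δ ∨ R < ξ.1} :=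
  (measurableSet_lt measurable_fst measurable_const).union
    (measurableSet_lt measurable_const measurable_fst)

/-- Apart from the small tail, speeds are at least `δ`, so `1 ≤ ξ₁ / δ` bounds the density by a
flux, which is an integral in energy. -/
theorem RegularProfile.lintegral_comp_kin_lt_top (hh : RegularProfile φb r h) (hr : 2 < r)
    {s : ℝ} (hs : 0 ≤ s) : ∫⁻ ξ in posVel, ‖h (kin s ξ)‖ₑ < ⊤ := by
  obtain ⟨δ, hδ, R, hT⟩ := hh.exists_tail_le hr s one_ne_zero
  have hm := hh.meas
  set W := {ξ : Vel | ξ.1 < δ ∨ R < ξ.1} with hW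
  have hWm : MeasurableSet W := measurableSet_speed δ R
  rw [← lintegral_inter_add_sdiff _ posVel hWm]
  refine ENNReal.add_lt_top.2 ⟨lt_of_le_of_lt (hT s ⟨hs, le_rfl⟩) ENNReal.one_lt_top, ?_⟩
  have hM := hh.integrable_trunc hr (R ^ 2 / 2 + 1)
  have hMm := measurable_truncProfile (R ^ 2 / 2 + 1) hm
  calc ∫⁻ ξ in posVel \ W, ‖h (kin s ξ)‖ₑ
      ≤ ∫⁻ ξ in posVel \ W, ENNReal.ofReal (1 / δ) *
          (ENNReal.ofReal ξ.1 * ‖truncProfile (R ^ 2 / 2 + 1) h (kin s ξ)‖ₑ) := by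
        refine setLIntegral_mono' (measurableSet_posVel.diff hWm) fun ξ hξ => ?_
        have h0 : 0 < ξ.1 := hξ.1
        have h1 : δ ≤ ξ.1 ∧ ξ.1 ≤ R := by simpa [hW] using hξ.2
        rw [truncProfile_kin hs h0 h1.2, ← mul_assoc, ← ENNReal.ofReal_mul (by positivity)]
        refine le_mul_of_one_le_left zero_le ?_
        rw [ENNReal.one_le_ofReal, one_div, inv_mul_eq_div, one_le_div hδ]
        exact h1.1
    _ ≤ ∫⁻ ξ in posVel, ENNReal.ofReal (1 / δ) *
          (ENNReal.ofReal ξ.1 * ‖truncProfile (R ^ 2 / 2 + 1) h (kin s ξ)‖ₑ) :=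
        lintegral_mono_set sdiff_subset
    _ = ENNReal.ofReal (1 / δ) * ∫⁻ q in energyGT (-s), ‖truncProfile (R ^ 2 / 2 + 1) h q‖ₑ := by
        rw [lintegral_const_mul _ (by fun_prop), lintegral_mul_comp_kin s hMm.enorm]
    _ < ⊤ := ENNReal.mul_lt_top ENNReal.ofReal_lt_top
        (lt_of_le_of_lt (setLIntegral_le_lintegral _ _) hM.hasFiniteIntegral)

theorem RegularProfile.integrableOn_comp_kin (hh : RegularProfile φb r h) (hr : 2 < r)
    {s : ℝ} (hs : 0 ≤ s) : IntegrableOn (fun ξ => h (kin s ξ)) posVel :=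
  ⟨(hh.meas.comp (measurable_kin s)).aestronglyMeasurable,
    hasFiniteIntegral_iff_enorm.2 (hh.lintegral_comp_kin_lt_top hr hs)⟩

/-- The map `s ↦ h(ξ₁² / 2 - s, ξ')` is continuous into `L¹` of the half space. -/
theorem RegularProfile.tendsto_lintegral_sub (hh : RegularProfile φb r h) (hr : 2 < r)
    {t : ℝ} (ht : 0 ≤ t) :
    Tendsto (fun s => ∫⁻ ξ in posVel, ‖h (kin s ξ) - h (kin t ξ)‖ₑ) (𝓝[Ici 0] t) (𝓝 0) := by
  rw [ENNReal.tendsto_nhds_zero]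
  intro ε hε
  have hε3 : ε / 3 ≠ 0 := (ENNReal.div_pos hε.ne' (by simp)).ne'
  -- The bound `t + 1` lets one pair `δ`, `R` serve for all s near t.
  obtain ⟨δ, hδ, R, hT⟩ := hh.exists_tail_le hr (t + 1) hε3
  have hm := hh.meas
  set W := {ξ : Vel | ξ.1 < δ ∨ R < ξ.1} with hW
  have hWm : MeasurableSet W := measurableSet_speed δ R
  have hM := hh.integrable_trunc hr (R ^ 2 / 2 + 1)
  have hMm := measurable_truncProfile (R ^ 2 / 2 + 1) hm
  set g := truncProfile (R ^ 2 / 2 + 1) h with hg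
  -- Passing from potential t to s translates the energy by `t - s`; on speeds in `[δ, R]` the
  -- difference is at most `1 / δ` times a translation error in L¹.
  have htr : Tendsto (fun s : ℝ => ENNReal.ofReal (1 / δ) *
      ∫⁻ q : Vel, ‖g (q.1 + (t - s), q.2) - g q‖ₑ) (𝓝[Ici 0] t) (𝓝 0) := by
    have h1 : Tendsto (fun s : ℝ => t - s) (𝓝[Ici 0] t) (𝓝 0) := by
      have : Tendsto (fun s : ℝ => t - s) (𝓝 t) (𝓝 (t - t)) :=
        tendsto_const_nhds.sub tendsto_id
      rw [sub_self] at this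
      exact this.mono_left nhdsWithin_le_nhds
    have h2 := ENNReal.Tendsto.const_mul (a := ENNReal.ofReal (1 / δ))
      ((tendsto_lintegral_translate_sub hM).comp h1) (Or.inr ENNReal.ofReal_ne_top)
    rw [mul_zero] at h2
    exact h2
  have hnear : ∀ᶠ s in 𝓝[Ici 0] t, s < t + 1 :=
    nhdsWithin_le_nhds (Iio_mem_nhds (by linarith))
  filter_upwards [htr.eventually_le_const (pos_iff_ne_zero.2 hε3), hnear,
    self_mem_nhdsWithin] with s hs hst hs0
  rw [← lintegral_inter_add_sdiff _ posVel hWm]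
  have hA : ∫⁻ ξ in posVel ∩ W, ‖h (kin s ξ) - h (kin t ξ)‖ₑ ≤ ε / 3 + ε / 3 := by
    calc ∫⁻ ξ in posVel ∩ W, ‖h (kin s ξ) - h (kin t ξ)‖ₑ
        ≤ ∫⁻ ξ in posVel ∩ W, (‖h (kin s ξ)‖ₑ + ‖h (kin t ξ)‖ₑ) :=
          lintegral_mono fun ξ => enorm_sub_le
      _ = (∫⁻ ξ in posVel ∩ W, ‖h (kin s ξ)‖ₑ) + ∫⁻ ξ in posVel ∩ W, ‖h (kin t ξ)‖ₑ :=
          lintegral_add_left (by fun_prop) _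
      _ ≤ ε / 3 + ε / 3 := add_le_add (hT s ⟨hs0, hst.le⟩) (hT t ⟨ht, by linarith⟩)
  have hB : ∫⁻ ξ in posVel \ W, ‖h (kin s ξ) - h (kin t ξ)‖ₑ ≤ ε / 3 := by
    have hFm : Measurable fun q : Vel => ‖g (q.1 + (t - s), q.2) - g q‖ₑ := by fun_prop
    calc ∫⁻ ξ in posVel \ W, ‖h (kin s ξ) - h (kin t ξ)‖ₑ
        ≤ ∫⁻ ξ in posVel \ W, ENNReal.ofReal (1 / δ) * (ENNReal.ofReal ξ.1 *
          ‖g ((kin t ξ).1 + (t - s), (kin t ξ).2) - g (kin t ξ)‖ₑ) := by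
          refine setLIntegral_mono' (measurableSet_posVel.diff hWm) fun ξ hξ => ?_
          have h0 : 0 < ξ.1 := hξ.1
          have h1 : δ ≤ ξ.1 ∧ ξ.1 ≤ R := by simpa [hW] using hξ.2
          have hk : (((kin t ξ).1 + (t - s), (kin t ξ).2) : Vel) = kin s ξ := by
            simp only [kin, Prod.mk.injEq, and_true]; ring
          rw [hk, hg, truncProfile_kin hs0 h0 h1.2, truncProfile_kin ht h0 h1.2, ← mul_assoc,
            ← ENNReal.ofReal_mul (by positivity)]
          refine le_mul_of_one_le_left zero_le ?_
          rw [ENNReal.one_le_ofReal, one_div, inv_mul_eq_div, one_le_div hδ]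
          exact h1.1
      _ ≤ ∫⁻ ξ in posVel, ENNReal.ofReal (1 / δ) * (ENNReal.ofReal ξ.1 *
          ‖g ((kin t ξ).1 + (t - s), (kin t ξ).2) - g (kin t ξ)‖ₑ) :=
          lintegral_mono_set sdiff_subset
      _ = ENNReal.ofReal (1 / δ) * ∫⁻ q in energyGT (-t), ‖g (q.1 + (t - s), q.2) - g q‖ₑ := by
          rw [← lintegral_mul_comp_kin t hFm, lintegral_const_mul]
          fun_prop
      _ ≤ ENNReal.ofReal (1 / δ) * ∫⁻ q : Vel, ‖g (q.1 + (t - s), q.2) - g q‖ₑ := by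
          gcongr
          exact Measure.restrict_le_self
      _ ≤ ε / 3 := hs
  calc _ ≤ (ε / 3 + ε / 3) + ε / 3 := add_le_add hA hB
    _ = ε := ENNReal.add_thirds ε

end

section

/-! ### Energy profiles of the data -/

/-- Borel profiles `hp` (for `ξ₁ > 0`) and `hm` (for `ξ₁ < 0`) of the data `fb`, `finf` as functions
of the energy `e = ξ₁² / 2 - φ` and of `ξ'`. -/
structure IsEnergyProfile (α φb r : ℝ) (fb finf hp hm : Vel → ℝ) : Prop where
  reg_p : RegularProfile φb r hp
  reg_m : RegularProfile φb r hm
  nonneg_p : ∀ q, 0 ≤ hp q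
  nonneg_m : ∀ q, 0 ≤ hm q
  eq_neg : ∀ q : Vel, q.1 ≤ 0 → hp q = hm q
  finf_p : ∀ᵐ ξ ∂(volume.restrict posVel), finf ξ = hp (kin 0 ξ)
  finf_m : ∀ᵐ ξ ∂(volume.restrict posVel), finf (refl ξ) = hm (kin 0 ξ)
  fb_eq : ∀ᵐ ξ ∂(volume.restrict posVel), fb ξ = hp (kin φb ξ) - α * hm (kin φb ξ)

/-- The density with energy profiles `hp`, `hm` at potential `s`. -/
def profileDensity (hp hm : Vel → ℝ) (s : ℝ) (ξ : Vel) : ℝ :=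
  if 0 < ξ.1 then hp (kin s ξ) else hm (kin s ξ)

/-- Substituting the wall speed `v = √(2 (e + φb))` turns `de` into `v dv`. Nonpositive energy means
`v ≤ √(2 φb)`, so this weight is bounded and the assumption on `fb` applies. -/
theorem lintegral_rpow_profile_lt_top {α φb r : ℝ} (hr : 2 < r) {fb g : Vel → ℝ}
    (hα : α < 1) (hfbr : FiniteLrL1 r 0 √(2 * φb) fb) (hg : Measurable g)
    (hgfb : ∀ᵐ ξ ∂(volume.restrict posVel), fb ξ = g ξ) {h : Vel → ℝ}
    (hh : ∀ q : Vel, q.1 ≤ 0 → h q =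
      if -φb < q.1 then g (√(2 * (q.1 + φb)), q.2) / (1 - α) else 0) :
    ∫⁻ e in Iic (0 : ℝ), (∫⁻ η : ℝ × ℝ, ‖h (e, η)‖ₑ) ^ r ≠ ⊤ := by
  have hα' : 0 < 1 - α := by linarith
  set F : ℝ → ENNReal := fun w => ∫⁻ η : ℝ × ℝ, ‖g (w, η) / (1 - α)‖ₑ with hF
  have hFm : Measurable F :=
    Measurable.lintegral_prod_right' (f := fun p : ℝ × (ℝ × ℝ) => ‖g p / (1 - α)‖ₑ) (by fun_prop)
  set Q : ℝ → ENNReal := (Iic (0 : ℝ)).indicator fun e => F (√(2 * (e + φb))) ^ r with hQ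
  have hQm : Measurable Q := Measurable.indicator (by fun_prop) measurableSet_Iic
  have h1 : ∫⁻ e in Iic (0 : ℝ), (∫⁻ η : ℝ × ℝ, ‖h (e, η)‖ₑ) ^ r ≤ ∫⁻ e in Ioi (-φb), Q e := by
    rw [← lintegral_indicator measurableSet_Iic, ← lintegral_indicator measurableSet_Ioi]
    refine lintegral_mono fun e => ?_
    by_cases he : e ∈ Iic (0 : ℝ)
    · rw [indicator_of_mem he]
      by_cases he2 : -φb < e
      · rw [indicator_of_mem (show e ∈ Ioi (-φb) from he2), hQ, indicator_of_mem he]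
        have : ∀ η : ℝ × ℝ, h (e, η) = g (√(2 * (e + φb)), η) / (1 - α) := fun η => by
          rw [hh (e, η) he, if_pos he2]
        simp only [this, hF, le_refl]
      · have : ∀ η : ℝ × ℝ, h (e, η) = 0 := fun η => by
          rw [hh (e, η) he, if_neg he2]
        simp only [this, enorm_zero, lintegral_zero]
        rw [ENNReal.zero_rpow_of_pos (by linarith)]
        exact zero_le
    · rw [indicator_of_notMem he]; exact zero_le
  refine (lt_of_le_of_lt h1 ?_).ne
  rw [← lintegral_mul_comp_half_sq φb hQm]
  have hae : ∀ᵐ w ∂(volume.restrict (Ioi (0 : ℝ))),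
      F w = ENNReal.ofReal (1 / (1 - α)) * ∫⁻ η : ℝ × ℝ, ‖fb (w, η)‖ₑ := by
    rw [restrict_posVel] at hgfb
    filter_upwards [Measure.ae_ae_of_ae_prod hgfb] with w hw
    rw [← lintegral_const_mul' _ _ ENNReal.ofReal_ne_top]
    refine lintegral_congr_ae ?_
    filter_upwards [hw] with η hη
    rw [hη, div_eq_mul_inv, enorm_mul, mul_comm, one_div, ← Real.enorm_of_nonneg (by positivity)]
  have hle : ∫⁻ v in Ioi (0 : ℝ), ENNReal.ofReal v * Q (v ^ 2 / 2 - φb) ≤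
      ∫⁻ v in Ioi (0 : ℝ), (Ioc 0 √(2 * φb)).indicator (fun v =>
        ENNReal.ofReal √(2 * φb) * (ENNReal.ofReal (1 / (1 - α)) ^ r *
          (∫⁻ η : ℝ × ℝ, ‖fb (v, η)‖ₑ) ^ r)) v := by
    refine lintegral_mono_ae ?_
    filter_upwards [hae, ae_restrict_mem measurableSet_Ioi] with v hv hv0
    have hv0' : 0 < v := hv0
    by_cases hc : v ^ 2 / 2 - φb ≤ 0
    · have hvle : v ≤ √(2 * φb) := Real.le_sqrt_of_sq_le (by linarith)
      rw [hQ, indicator_of_mem (show v ^ 2 / 2 - φb ∈ Iic (0 : ℝ) from hc),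
        indicator_of_mem (show v ∈ Ioc 0 √(2 * φb) from ⟨hv0', hvle⟩),
        show 2 * (v ^ 2 / 2 - φb + φb) = v ^ 2 by ring, Real.sqrt_sq hv0'.le, hv,
        ENNReal.mul_rpow_of_nonneg _ _ (by linarith)]
      gcongr
    · rw [hQ, indicator_of_notMem (show v ^ 2 / 2 - φb ∉ Iic (0 : ℝ) from hc), mul_zero]
      exact zero_le
  refine lt_of_le_of_lt hle ?_
  rw [lintegral_indicator measurableSet_Ioc, Measure.restrict_restrict measurableSet_Ioc,
    inter_eq_left.2 Ioc_subset_Ioi_self, lintegral_const_mul' _ _ ENNReal.ofReal_ne_top,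
    lintegral_const_mul' _ _ (ENNReal.rpow_ne_top_of_nonneg (by linarith) ENNReal.ofReal_ne_top),
    ← restrict_Ioo_eq_restrict_Ioc]
  exact ENNReal.mul_lt_top ENNReal.ofReal_lt_top (ENNReal.mul_lt_top
    (ENNReal.rpow_lt_top_of_nonneg (by linarith) ENNReal.ofReal_ne_top) hfbr)

theorem exists_measurable_nonneg_rep {μ : Measure Vel} {f : Vel → ℝ}
    (hf : AEStronglyMeasurable f μ) (h0 : ∀ᵐ ξ ∂μ, 0 ≤ f ξ) :
    ∃ g : Vel → ℝ, Measurable g ∧ (∀ ξ, 0 ≤ g ξ) ∧ ∀ᵐ ξ ∂μ, f ξ = g ξ := by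
  refine ⟨fun ξ => |hf.mk f ξ|, hf.stronglyMeasurable_mk.measurable.abs, fun ξ => abs_nonneg _, ?_⟩
  filter_upwards [hf.ae_eq_mk, h0] with ξ h1 h2
  rw [← h1, abs_of_nonneg h2]

/-- For `e > 0`, `hm` is read off from `finf` on incoming velocities and `hp` is what the wall sends
back, `fb + α hm`; compatibility says that this is `finf` on outgoing velocities. For `-φb < e ≤ 0`
the two profiles agree, and the wall condition forces `fb / (1 - α)`. -/
theorem exists_energyProfile {α φb r : ℝ} (hα0 : 0 ≤ α) (hα : α < 1) (hφb : 0 < φb) (hr : 2 < r)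
    {fb finf : Vel → ℝ}
    (hfb : IntegrableOn fb posVel volume) (hfbr : FiniteLrL1 r 0 √(2 * φb) fb)
    (hfinf : Integrable finf volume)
    (hfb0 : ∀ᵐ ξ ∂(volume.restrict posVel), 0 ≤ fb ξ)
    (hfinf0 : ∀ᵐ ξ : Vel, 0 ≤ finf ξ)
    (hcompat : ∀ᵐ ξ ∂(volume.restrict posVel),
      finf ξ = fb (√(ξ.1 ^ 2 + 2 * φb), ξ.2) + α * finf (-ξ.1, ξ.2)) :
    ∃ hp hm, IsEnergyProfile α φb r fb finf hp hm := by
  have hα' : 0 < 1 - α := by linarith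
  obtain ⟨g, hgm, hg0, hg⟩ := exists_measurable_nonneg_rep hfb.aestronglyMeasurable hfb0
  obtain ⟨k, hkm, hk0, hk⟩ := exists_measurable_nonneg_rep hfinf.aestronglyMeasurable hfinf0
  set low : Vel → ℝ := fun q =>
    if -φb < q.1 then g (√(2 * (q.1 + φb)), q.2) / (1 - α) else 0 with hlow
  set hm : Vel → ℝ := fun q => if 0 < q.1 then k (-√(2 * q.1), q.2) else low q with hhm
  set hp : Vel → ℝ := fun q => if 0 < q.1 then
    g (√(2 * (q.1 + φb)), q.2) + α * k (-√(2 * q.1), q.2) else low q with hhp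
  have hlm : Measurable low := Measurable.ite
    (measurableSet_lt measurable_const measurable_fst) (by fun_prop) measurable_const
  have hl0 : ∀ q, 0 ≤ low q := fun q => by
    simp only [hlow]; split_ifs
    · exact div_nonneg (hg0 _) hα'.le
    · exact le_rfl
  have hmm : Measurable hm := Measurable.ite
    (measurableSet_lt measurable_const measurable_fst) (by fun_prop) hlm
  have hpm : Measurable hp := Measurable.ite
    (measurableSet_lt measurable_const measurable_fst) (by fun_prop) hlm
  have hmneg : ∀ q : Vel, q.1 ≤ 0 → hm q = low q := fun q hq => if_neg (not_lt.2 hq)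
  have hpneg : ∀ q : Vel, q.1 ≤ 0 → hp q = low q := fun q hq => if_neg (not_lt.2 hq)
  have hkae := ae_posVel_of_ae hk
  have hfinf_m : ∀ᵐ ξ ∂(volume.restrict posVel), finf (refl ξ) = hm (kin 0 ξ) := by
    filter_upwards [hkae, ae_restrict_mem measurableSet_posVel] with ξ h1 h2
    have h2' : 0 < ξ.1 := h2
    have h3 := sqrt_kin (s := 0) h2
    rw [add_zero] at h3
    have h4 : 0 < (kin 0 ξ).1 := by simpa [energyGT] using kin_mem (s := 0) ‹ξ ∈ posVel›
    rw [hhm]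
    simp only [if_pos h4]
    rw [h3, h1.2]
    rfl
  -- An almost everywhere identity at the wall is moved to energies above `-φb`, restricted to
  -- positive ones, and pulled back to velocities at potential 0.
  have hfbq := ae_comp_kin 0 (ae_restrict_of_ae_restrict_of_subset
    (show energyGT (-0) ⊆ energyGT (-φb) from fun q hq => lt_trans (by linarith)
      (show -0 < q.1 from hq)) (ae_of_ae_posVel φb hg))
  have hfinf_p : ∀ᵐ ξ ∂(volume.restrict posVel), finf ξ = hp (kin 0 ξ) := by
    filter_upwards [hfinf_m, hfbq, hcompat, ae_restrict_mem measurableSet_posVel] with ξ h1 h2 h3 h4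
    have h2' : 0 < ξ.1 := h4
    have h5 : 0 < (kin 0 ξ).1 := by simpa [energyGT] using kin_mem (s := 0) ‹ξ ∈ posVel›
    have h6 : 2 * ((kin 0 ξ).1 + φb) = ξ.1 ^ 2 + 2 * φb := by simp only [kin]; ring
    simp only [hhm, if_pos h5] at h1
    rw [hhp]
    simp only [if_pos h5]
    rw [← h1, ← h2, h6, h3]
    rfl
  have hpos : ∀ {F : Vel → ℝ} {H : Vel → ℝ}, Integrable F → (∀ᵐ ξ ∂(volume.restrict posVel),
      F ξ = H (kin 0 ξ)) → ∫⁻ ξ in posVel, ‖H (kin 0 ξ)‖ₑ ≠ ⊤ := by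
    intro F H hF hFH
    rw [← lintegral_congr_ae (show (fun ξ => ‖F ξ‖ₑ) =ᵐ[volume.restrict posVel]
      fun ξ => ‖H (kin 0 ξ)‖ₑ by filter_upwards [hFH] with ξ hξ; rw [hξ])]
    exact hF.integrableOn.hasFiniteIntegral.ne
  refine ⟨hp, hm, ⟨hpm, fun q hq => ?_, ?_, ?_⟩, ⟨hmm, fun q hq => ?_, ?_, ?_⟩,
    fun q => ?_, fun q => ?_, fun q hq => ?_, hfinf_p, hfinf_m, ?_⟩
  · rw [hpneg q (by linarith)]; exact if_neg (not_lt.2 hq)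
  · exact hpos hfinf hfinf_p
  · exact lintegral_rpow_profile_lt_top hr hα hfbr hgm hg hpneg
  · rw [hmneg q (by linarith)]; exact if_neg (not_lt.2 hq)
  · exact hpos (F := fun ξ => finf (refl ξ))
      (measurePreserving_refl.integrable_comp_of_integrable hfinf) hfinf_m
  · exact lintegral_rpow_profile_lt_top hr hα hfbr hgm hg hmneg
  · simp only [hhp]; split_ifs
    · exact add_nonneg (hg0 _) (mul_nonneg hα0 (hk0 _))
    · exact hl0 q
  · simp only [hhm]; split_ifs
    · exact hk0 _
    · exact hl0 q
  · rw [hpneg q hq, hmneg q hq]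
  · filter_upwards [hg, ae_restrict_mem measurableSet_posVel] with ξ h1 h2
    have h3 : √(2 * ((kin φb ξ).1 + φb)) = ξ.1 := sqrt_kin h2
    have h4 : -φb < (kin φb ξ).1 := kin_mem h2
    have h5 : g (√(2 * ((kin φb ξ).1 + φb)), (kin φb ξ).2) = fb ξ := by rw [h3, h1]; rfl
    simp only [hhp, hhm, hlow]
    rw [h5]
    split_ifs
    · ring
    · field_simp

variable {α φb r : ℝ} {fb finf hp hm : Vel → ℝ}

theorem kin_zero_sqrt {q : Vel} (hq : 0 ≤ q.1) : kin 0 (√(2 * (q.1 + 0)), q.2) = q := by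
  rw [kin, Real.sq_sqrt (by linarith)]
  ext <;> simp

theorem kin_sqrt {s : ℝ} {q : Vel} (hq : -s ≤ q.1) : kin s (√(2 * (q.1 + s)), q.2) = q := by
  rw [kin, Real.sq_sqrt (by linarith)]
  ext <;> simp

theorem profileDensity_pos {s : ℝ} {ξ : Vel} (hξ : ξ ∈ posVel) :
    profileDensity hp hm s ξ = hp (kin s ξ) := if_pos hξ

theorem profileDensity_refl {s : ℝ} {ξ : Vel} (hξ : ξ ∈ posVel) :
    profileDensity hp hm s (refl ξ) = hm (kin s ξ) := by
  have h0 : 0 < ξ.1 := hξ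
  have : ¬ 0 < (refl ξ).1 := by simp only [refl]; linarith
  rw [profileDensity, if_neg this, kin_refl]

theorem IsEnergyProfile.finf_ae_eq (hprof : IsEnergyProfile α φb r fb finf hp hm) :
    finf =ᵐ[volume] profileDensity hp hm 0 := by
  refine ae_of_posVel ?_ ?_
  · filter_upwards [hprof.finf_p, ae_restrict_mem measurableSet_posVel] with ξ h1 h2
    rw [h1, profileDensity_pos h2]
  · filter_upwards [hprof.finf_m, ae_restrict_mem measurableSet_posVel] with ξ h1 h2
    rw [h1, profileDensity_refl h2]

theorem integrable_of_posVel {F : Vel → ℝ} (h1 : IntegrableOn F posVel)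
    (h2 : IntegrableOn (fun ξ => F (refl ξ)) posVel) : Integrable F := by
  rw [← integrableOn_univ, ← union_compl_self posVel]
  refine h1.union ?_
  rw [IntegrableOn, restrict_compl_posVel]
  have := (measurePreserving_refl_neg.integrable_comp_emb measurableEmbedding_refl).2 h2
  simpa [Function.comp_def] using this

theorem IsEnergyProfile.integrable (hprof : IsEnergyProfile α φb r fb finf hp hm) (hr : 2 < r)
    {s : ℝ} (hs : 0 ≤ s) : Integrable (profileDensity hp hm s) := by
  refine integrable_of_posVel ?_ ?_
  · exact (hprof.reg_p.integrableOn_comp_kin hr hs).congr_fun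
      (fun ξ hξ => (profileDensity_pos hξ).symm) measurableSet_posVel
  · exact (hprof.reg_m.integrableOn_comp_kin hr hs).congr_fun
      (fun ξ hξ => (profileDensity_refl hξ).symm) measurableSet_posVel

theorem RegularProfile.integral_abs_sub_eq {h : Vel → ℝ} (hh : RegularProfile φb r h) (hr : 2 < r)
    {s t : ℝ} (hs : 0 ≤ s) (ht : 0 ≤ t) :
    ∫ ξ in posVel, |h (kin s ξ) - h (kin t ξ)| =
      (∫⁻ ξ in posVel, ‖h (kin s ξ) - h (kin t ξ)‖ₑ).toReal := by
  rw [← integral_norm_eq_lintegral_enorm]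
  · rfl
  · exact ((hh.integrableOn_comp_kin hr hs).sub
      (hh.integrableOn_comp_kin hr ht)).aestronglyMeasurable

/-- The density of fixed energy profile is `L¹`-continuous in the potential. -/
theorem IsEnergyProfile.tendsto_distL1 (hprof : IsEnergyProfile α φb r fb finf hp hm) (hr : 2 < r)
    {t : ℝ} (ht : 0 ≤ t) :
    Tendsto (fun s => distL1 (profileDensity hp hm s) (profileDensity hp hm t))
      (𝓝[Ici 0] t) (𝓝 0) := by
  have h1 := (ENNReal.tendsto_toReal ENNReal.zero_ne_top).comp
    (hprof.reg_p.tendsto_lintegral_sub hr ht)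
  have h2 := (ENNReal.tendsto_toReal ENNReal.zero_ne_top).comp
    (hprof.reg_m.tendsto_lintegral_sub hr ht)
  have h3 := h1.add h2
  simp only [ENNReal.toReal_zero, add_zero] at h3
  refine h3.congr' ?_
  filter_upwards [self_mem_nhdsWithin] with s hs
  have hs' : 0 ≤ s := hs
  rw [distL1, integral_eq_add_refl (F := fun ξ => |profileDensity hp hm s ξ -
    profileDensity hp hm t ξ|) ((hprof.integrable hr hs').sub (hprof.integrable hr ht)).abs]
  simp only [Function.comp]
  rw [← hprof.reg_p.integral_abs_sub_eq hr hs' ht, ← hprof.reg_m.integral_abs_sub_eq hr hs' ht]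
  congr 1
  · exact setIntegral_congr_fun measurableSet_posVel fun ξ hξ => by
      simp only [profileDensity_pos hξ]
  · exact setIntegral_congr_fun measurableSet_posVel fun ξ hξ => by
      simp only [profileDensity_refl hξ]

theorem chi_pos {s : ℝ} (hs : 0 < s) : chi s = 1 := if_pos hs

theorem chi_nonpos {s : ℝ} (hs : s ≤ 0) : chi s = 0 := if_neg (not_lt.2 hs)

theorem ae_energy_ne_zero (s : ℝ) : ∀ᵐ ξ ∂(volume.restrict posVel), (kin s ξ).1 ≠ 0 :=
  ae_comp_kin s (P := fun q : Vel => q.1 ≠ 0) (ae_restrict_of_ae (ae_fst_ne 0))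

/-- The explicit distribution function has the energy profiles of the data. -/
theorem IsEnergyProfile.explicitF_ae_eq (hprof : IsEnergyProfile α φb r fb finf hp hm)
    (hα : α < 1) (φ : ℝ → ℝ) (x : ℝ) (h2 : φ x ≤ φb) :
    explicitF α φb fb finf φ x =ᵐ[volume] profileDensity hp hm (φ x) := by
  have hα' : 1 - α ≠ 0 := by linarith
  set s := φ x with hs
  have hF : ∀ᵐ q ∂(volume.restrict (energyGT (-s))), 0 < q.1 →
      finf (√(2 * q.1), q.2) = hp q ∧ finf (-√(2 * q.1), q.2) = hm q := by
    have a1 := ae_of_ae_posVel 0 (hprof.finf_p.and hprof.finf_m)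
    rw [ae_restrict_iff' (measurableSet_energyGT _)] at a1
    refine ae_restrict_of_ae ?_
    filter_upwards [a1] with q hq h0
    have := hq (by simpa [energyGT] using h0)
    rw [kin_zero_sqrt h0.le] at this
    simpa [refl] using this
  -- For negative energies `hp = hm`, so `fb = hp - α hm` reads `(1 - α) hp`; `s ≤ φb` ensures that
  -- these energies occur at the wall.
  have hB : ∀ᵐ q ∂(volume.restrict (energyGT (-s))), q.1 < 0 →
      fb (√(2 * (q.1 + φb)), q.2) = (1 - α) * hp q := by
    have a1 := ae_restrict_of_ae_restrict_of_subset (show energyGT (-s) ⊆ energyGT (-φb) from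
      fun q hq => lt_of_le_of_lt (by linarith) (show -s < q.1 from hq))
      (ae_of_ae_posVel φb hprof.fb_eq)
    filter_upwards [a1, ae_restrict_mem (measurableSet_energyGT _)] with q hq hq' h0
    have hq'' : -s < q.1 := hq'
    rw [kin_sqrt (by linarith)] at hq
    rw [hq, hprof.eq_neg q h0.le]; ring
  have hFk := ae_comp_kin s hF
  have hBk := ae_comp_kin s hB
  refine ae_of_posVel ?_ ?_
  · filter_upwards [hFk, hBk, ae_energy_ne_zero s, ae_restrict_mem measurableSet_posVel]
      with ξ a b c d
    have d' : 0 < ξ.1 := d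
    have e1 : ξ.1 ^ 2 - 2 * s = 2 * (kin s ξ).1 := by simp only [kin]; ring
    have e2 : ξ.1 ^ 2 - 2 * s + 2 * φb = 2 * ((kin s ξ).1 + φb) := by simp only [kin]; ring
    have e3 : -ξ.1 ^ 2 + 2 * s = -(2 * (kin s ξ).1) := by simp only [kin]; ring
    rw [profileDensity_pos d, explicitF, ← hs, e2, e1, e3, chi_pos d',
      chi_nonpos (show -ξ.1 ≤ 0 by linarith)]
    rcases lt_or_gt_of_ne c with h | h
    · rw [chi_nonpos (show 2 * (kin s ξ).1 ≤ 0 by linarith),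
        chi_pos (show 0 < -(2 * (kin s ξ).1) by linarith), show ξ.2 = (kin s ξ).2 from rfl, b h]
      field_simp
      ring
    · rw [chi_pos (show 0 < 2 * (kin s ξ).1 by linarith),
        chi_nonpos (show -(2 * (kin s ξ).1) ≤ 0 by linarith), show ξ.2 = (kin s ξ).2 from rfl,
        (a h).1]
      ring
  · filter_upwards [hFk, hBk, ae_energy_ne_zero s, ae_restrict_mem measurableSet_posVel]
      with ξ a b c d
    have d' : 0 < ξ.1 := d
    have e1 : (refl ξ).1 ^ 2 - 2 * s = 2 * (kin s ξ).1 := by simp only [kin, refl]; ring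
    have e2 : (refl ξ).1 ^ 2 - 2 * s + 2 * φb = 2 * ((kin s ξ).1 + φb) := by
      simp only [kin, refl]; ring
    have e3 : -(refl ξ).1 ^ 2 + 2 * s = -(2 * (kin s ξ).1) := by simp only [kin, refl]; ring
    rw [profileDensity_refl d, explicitF, ← hs, e2, e1, e3,
      chi_nonpos (show (refl ξ).1 ≤ 0 by simp only [refl]; linarith),
      chi_pos (show 0 < -(refl ξ).1 by simp only [refl]; linarith)]
    rcases lt_or_gt_of_ne c with h | h
    · rw [chi_nonpos (show 2 * (kin s ξ).1 ≤ 0 by linarith),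
        chi_pos (show 0 < -(2 * (kin s ξ).1) by linarith),
        show (refl ξ).2 = (kin s ξ).2 from rfl, b h, hprof.eq_neg _ h.le]
      field_simp
      ring
    · rw [chi_pos (show 0 < 2 * (kin s ξ).1 by linarith),
        chi_nonpos (show -(2 * (kin s ξ).1) ≤ 0 by linarith),
        show (refl ξ).2 = (kin s ξ).2 from rfl, (a h).2]
      ring

theorem RegularProfile.integrableOn_div_sqrt {h : Vel → ℝ} (hh : RegularProfile φb r h)
    (hr : 2 < r) {s : ℝ} (hs : 0 ≤ s) :
    IntegrableOn (fun q : Vel => 1 / √(2 * (q.1 + s)) * h q) (energyGT (-s)) := by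
  have hm := hh.meas
  refine ⟨by fun_prop, ?_⟩
  rw [hasFiniteIntegral_iff_enorm]
  have h1 := hh.lintegral_comp_kin_lt_top hr hs
  rw [lintegral_comp_kin s hm.enorm] at h1
  refine lt_of_le_of_lt (le_of_eq (lintegral_congr fun q => ?_)) h1
  rw [enorm_mul, Real.enorm_of_nonneg (by positivity)]

/-- The ion density is the mass of the density with the energy profiles of the data. -/
theorem IsEnergyProfile.rhoPlus_eq (hprof : IsEnergyProfile α φb r fb finf hp hm)
    (hα : α < 1) (hr : 2 < r) (hfinf : Integrable finf) {s : ℝ} (hs : 0 ≤ s) :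
    rhoPlus α φb fb finf s = ∫ ξ, profileDensity hp hm s ξ := by
  have hα' : 1 - α ≠ 0 := by linarith
  have hpm := hprof.reg_p.meas
  have hmm := hprof.reg_m.meas
  set K : (Vel → ℝ) → Vel → ℝ := fun h q => 1 / √(2 * (q.1 + s)) * h q with hK
  have hKm : ∀ {h : Vel → ℝ}, Measurable h → Measurable (K h) := fun hh => by
    simp only [hK]; fun_prop
  have hR : ∫ ξ, profileDensity hp hm s ξ =
      (∫ q in energyGT (-s), K hp q) + ∫ q in energyGT (-s), K hm q := by
    rw [integral_eq_add_refl (hprof.integrable hr hs), ← integral_comp_kin s hpm,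
      ← integral_comp_kin s hmm]
    congr 1
    · exact setIntegral_congr_fun measurableSet_posVel fun ξ hξ => profileDensity_pos hξ
    · exact setIntegral_congr_fun measurableSet_posVel fun ξ hξ => profileDensity_refl hξ
  have hfin_int : Integrable fun ξ : Vel => finf ξ * (|ξ.1| / √(ξ.1 ^ 2 + 2 * s)) := by
    refine Integrable.mono hfinf (hfinf.aestronglyMeasurable.mul
      (Measurable.aestronglyMeasurable (by fun_prop)))
      (Eventually.of_forall fun ξ => ?_)
    rw [norm_mul]
    refine mul_le_of_le_one_right (norm_nonneg _) ?_
    rw [Real.norm_of_nonneg (by positivity)]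
    refine div_le_one_of_le₀ ?_ (Real.sqrt_nonneg _)
    exact Real.le_sqrt_of_sq_le (by rw [sq_abs]; linarith)
  have hpk : ∀ {ξ : Vel}, ξ ∈ posVel → ξ.1 ^ 2 + 2 * s = 2 * ((kin 0 ξ).1 + s) := fun _ => by
    simp only [kin]; ring
  -- In the first term of `rhoPlus` the factor `|ξ₁|` absorbs the Jacobian at potential 0, leaving
  -- the inverse speed at potential s over positive energies.
  have h1 : ∫ ξ : Vel, finf ξ * (|ξ.1| / √(ξ.1 ^ 2 + 2 * s)) =
      (∫ q in energyGT 0, K hp q) + ∫ q in energyGT 0, K hm q := by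
    rw [integral_eq_add_refl hfin_int]
    have e0 : energyGT (0 : ℝ) = energyGT (-0) := by rw [neg_zero]
    rw [e0, ← integral_mul_comp_kin 0 (hKm hpm), ← integral_mul_comp_kin 0 (hKm hmm)]
    congr 1
    · refine setIntegral_congr_ae measurableSet_posVel ?_
      have := (ae_restrict_iff' measurableSet_posVel).1 hprof.finf_p
      filter_upwards [this] with ξ h1 h2
      have h3 : 0 < ξ.1 := h2
      rw [h1 h2, hpk h2, abs_of_pos h3, hK]
      ring
    · refine setIntegral_congr_ae measurableSet_posVel ?_
      have := (ae_restrict_iff' measurableSet_posVel).1 hprof.finf_m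
      filter_upwards [this] with ξ h1 h2
      have h3 : 0 < ξ.1 := h2
      have h4 : (refl ξ).1 ^ 2 + 2 * s = 2 * ((kin 0 ξ).1 + s) := by simp only [kin, refl]; ring
      have h5 : |(refl ξ).1| = ξ.1 := by simp only [refl, abs_neg, abs_of_pos h3]
      rw [h1 h2, h4, h5, hK]
      ring
  -- Energies of particles present at potential s that cannot reach potential 0. Both directions
  -- contribute equally there, which accounts for the 2 in `2 / (1 - α)`.
  set D : Set Vel := {q | -s < q.1 ∧ q.1 < 0} with hD
  have hDm : MeasurableSet D := (measurableSet_lt measurable_const measurable_fst).inter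
    (measurableSet_lt measurable_fst measurable_const)
  have h2 : ∫ ξ in (Ioo √(2 * (φb - s) * chi (φb - s)) √(2 * φb) ×ˢ univ : Set Vel),
      fb ξ * (ξ.1 / √(ξ.1 ^ 2 + 2 * (s - φb))) = (1 - α) * ∫ q in D, K hp q := by
    have hsetm : MeasurableSet (Ioo √(2 * (φb - s) * chi (φb - s)) √(2 * φb) ×ˢ univ : Set Vel) :=
      measurableSet_Ioo.prod MeasurableSet.univ
    have hset : ∀ ξ : Vel, ξ ∈ posVel →
        (ξ ∈ (Ioo √(2 * (φb - s) * chi (φb - s)) √(2 * φb) ×ˢ univ : Set Vel) ↔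
          kin φb ξ ∈ D) := by
      intro ξ hξ
      have h0 : 0 < ξ.1 := hξ
      have ha : √(2 * (φb - s) * chi (φb - s)) < ξ.1 ↔ -s < (kin φb ξ).1 := by
        rw [Real.sqrt_lt' h0]
        simp only [kin]
        by_cases hc : 0 < φb - s
        · rw [chi_pos hc]; constructor <;> intro h <;> linarith
        · rw [chi_nonpos (not_lt.1 hc)]
          have := pow_pos h0 2
          constructor
          · intro; linarith
          · intro; linarith
      have hb : ξ.1 < √(2 * φb) ↔ (kin φb ξ).1 < 0 := by
        rw [Real.lt_sqrt h0.le]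
        simp only [kin]
        constructor <;> intro h <;> linarith
      rw [mem_prod, mem_Ioo, ha, hb, hD]
      simp
    have hsub : (Ioo √(2 * (φb - s) * chi (φb - s)) √(2 * φb) ×ˢ univ : Set Vel) ⊆ posVel :=
      fun ξ hξ => lt_of_le_of_lt (Real.sqrt_nonneg _) (mem_prod.1 hξ).1.1
    have e1 : ∫ ξ in (Ioo √(2 * (φb - s) * chi (φb - s)) √(2 * φb) ×ˢ univ : Set Vel),
        fb ξ * (ξ.1 / √(ξ.1 ^ 2 + 2 * (s - φb))) =
        ∫ ξ in posVel, ξ.1 * (D.indicator (fun q => (1 - α) * K hp q)) (kin φb ξ) := by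
      rw [← integral_indicator hsetm, ← integral_indicator measurableSet_posVel]
      refine integral_congr_ae ?_
      have := (ae_restrict_iff' measurableSet_posVel).1 hprof.fb_eq
      filter_upwards [this] with ξ hξ
      by_cases h0 : ξ ∈ posVel
      · rw [indicator_of_mem h0]
        by_cases h3 : kin φb ξ ∈ D
        · rw [indicator_of_mem ((hset ξ h0).2 h3), indicator_of_mem h3, hξ h0,
            ← hprof.eq_neg _ h3.2.le, hK,
            show ξ.1 ^ 2 + 2 * (s - φb) = 2 * ((kin φb ξ).1 + s) by simp only [kin]; ring]
          ring
        · rw [indicator_of_notMem (fun hc => h3 ((hset ξ h0).1 hc)), indicator_of_notMem h3,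
            mul_zero]
      · rw [indicator_of_notMem h0, indicator_of_notMem fun hc => h0 (hsub hc)]
    rw [e1, integral_mul_comp_kin φb (((hKm hpm).const_mul _).indicator hDm),
      ← integral_const_mul, ← integral_indicator hDm, ← integral_indicator
      (measurableSet_energyGT _)]
    refine integral_congr_ae (Eventually.of_forall fun q => ?_)
    by_cases hq : q ∈ D
    · by_cases hq2 : q ∈ energyGT (-φb)
      · simp only [indicator_of_mem hq2]
      -- This case occurs only for `s > φb`, when `D` extends below the least energy emitted at the
      -- wall.
      · have : hp q = 0 := hprof.reg_p.zero q (not_lt.1 hq2)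
        simp [indicator_of_notMem hq2, indicator_of_mem hq, hK, this]
    · by_cases hq2 : q ∈ energyGT (-φb)
      · simp only [indicator_of_mem hq2]
      · simp only [indicator_of_notMem hq2, indicator_of_notMem hq]
  have hsplit : ∀ {h : Vel → ℝ}, RegularProfile φb r h → ∫ q in energyGT (-s), K h q =
      (∫ q in D, K h q) + ∫ q in energyGT 0, K h q := by
    intro h hh
    have hi : IntegrableOn (K h) (energyGT (-s)) := hh.integrableOn_div_sqrt hr hs
    have hae : (energyGT (-s) : Set Vel) =ᵐ[volume] (D ∪ energyGT 0 : Set Vel) := by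
      filter_upwards [ae_fst_ne 0] with q hq
      refine propext ⟨fun h => ?_, fun h => ?_⟩
      · rcases lt_or_gt_of_ne hq with h' | h'
        · exact Or.inl ⟨h, h'⟩
        · exact Or.inr h'
      · rcases h with h | h
        · exact h.1
        · exact lt_of_le_of_lt (by linarith) (show 0 < q.1 from h)
    rw [setIntegral_congr_set hae, setIntegral_union _ (measurableSet_energyGT 0)]
    · exact hi.mono_set fun q hq => hq.1
    · exact hi.mono_set fun q hq => lt_of_le_of_lt (by linarith) (show 0 < q.1 from hq)
    · exact disjoint_left.2 fun q h1 h2 => absurd h1.2 (not_lt.2 (le_of_lt h2))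
  have hDeq : ∫ q in D, K hm q = ∫ q in D, K hp q :=
    setIntegral_congr_fun hDm fun q hq => by simp only [hK, hprof.eq_neg q hq.2.le]
  rw [rhoPlus, h1, h2, hR, hsplit hprof.reg_p, hsplit hprof.reg_m, hDeq]
  field_simp
  ring

theorem abs_integral_sub_le_distL1 {f g : Vel → ℝ} (hf : Integrable f) (hg : Integrable g) :
    |(∫ ξ, f ξ) - ∫ ξ, g ξ| ≤ distL1 f g := by
  rw [← integral_sub hf hg]
  exact abs_integral_le_integral_abs

theorem IsEnergyProfile.continuousOn_rhoPlus (hprof : IsEnergyProfile α φb r fb finf hp hm)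
    (hα : α < 1) (hr : 2 < r) (hfinf : Integrable finf) :
    ContinuousOn (rhoPlus α φb fb finf) (Ici 0) := by
  intro t ht
  rw [ContinuousWithinAt, tendsto_iff_dist_tendsto_zero]
  refine squeeze_zero' (Eventually.of_forall fun _ => dist_nonneg) ?_ (hprof.tendsto_distL1 hr ht)
  filter_upwards [self_mem_nhdsWithin] with s hs
  rw [Real.dist_eq, hprof.rhoPlus_eq hα hr hfinf hs, hprof.rhoPlus_eq hα hr hfinf ht]
  exact abs_integral_sub_le_distL1 (hprof.integrable hr hs) (hprof.integrable hr ht)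

theorem IsEnergyProfile.rhoPlus_zero (hprof : IsEnergyProfile α φb r fb finf hp hm)
    (hα : α < 1) (hr : 2 < r) (hfinf : Integrable finf) (hmass : ∫ ξ, finf ξ = 1) :
    rhoPlus α φb fb finf 0 = 1 := by
  rw [hprof.rhoPlus_eq hα hr hfinf le_rfl, ← hmass]
  exact integral_congr_ae hprof.finf_ae_eq.symm

end

section

/-! ### Preliminaries on potentials and test functions -/

theorem dx_one (φ : ℝ → ℝ) (x : ℝ) : dx 1 φ x = derivWithin φ (Ici 0) x := by
  rw [dx, iteratedDerivWithin_one]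

theorem hasDerivWithinAt_dx {φ : ℝ → ℝ} (h : ContDiffOn ℝ 1 φ (Ici 0)) {x : ℝ} (hx : 0 ≤ x) :
    HasDerivWithinAt φ (dx 1 φ x) (Ici 0) x := by
  rw [dx_one]
  exact (h.differentiableOn one_ne_zero x hx).hasDerivWithinAt

theorem hasDerivAt_dx {φ : ℝ → ℝ} (h : ContDiffOn ℝ 1 φ (Ici 0)) {x : ℝ} (hx : 0 < x) :
    HasDerivAt φ (dx 1 φ x) x :=
  (hasDerivWithinAt_dx h hx.le).hasDerivAt (Ici_mem_nhds hx)

theorem continuousOn_dx {φ : ℝ → ℝ} (h : ContDiffOn ℝ 1 φ (Ici 0)) :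
    ContinuousOn (dx 1 φ) (Ici 0) := by
  have : dx 1 φ = derivWithin φ (Ici 0) := funext (dx_one φ)
  rw [this]
  exact h.continuousOn_derivWithin (uniqueDiffOn_Ici 0) le_rfl

/-- A `C¹` function on the closed half line extends to a `C¹` function on the line. -/
theorem exists_contDiff_extension {φ : ℝ → ℝ} (h : ContDiffOn ℝ 1 φ (Ici 0)) :
    ∃ Φ : ℝ → ℝ, ContDiff ℝ 1 Φ ∧ (∀ x, 0 ≤ x → Φ x = φ x) ∧
      ∀ x, 0 ≤ x → HasDerivAt Φ (dx 1 φ x) x := by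
  set D : ℝ → ℝ := fun t => dx 1 φ (max t 0) with hD
  have hDc : Continuous D :=
    (continuousOn_dx h).comp_continuous (by fun_prop) fun t => le_max_right t 0
  have hder : ∀ x, HasDerivAt (fun x => φ 0 + ∫ t in (0 : ℝ)..x, D t) (D x) x := fun x =>
    (hDc.integral_hasStrictDerivAt 0 x).hasDerivAt.const_add _
  have hDpos : ∀ x, 0 ≤ x → D x = dx 1 φ x := fun x hx => by rw [hD]; simp [max_eq_left hx]
  refine ⟨fun x => φ 0 + ∫ t in (0 : ℝ)..x, D t, ?_, fun x hx => ?_, fun x hx => ?_⟩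
  · rw [contDiff_one_iff_deriv]
    refine ⟨fun x => (hder x).differentiableAt, ?_⟩
    rw [show deriv (fun x => φ 0 + ∫ t in (0 : ℝ)..x, D t) = D from funext fun x => (hder x).deriv]
    exact hDc
  · have := intervalIntegral.integral_eq_sub_of_hasDeriv_right_of_le hx
      (h.continuousOn.mono Icc_subset_Ici_self)
      (fun t ht => (by rw [hDpos t ht.1.le]
                       exact (hasDerivAt_dx h ht.1).hasDerivWithinAt :
        HasDerivWithinAt φ (D t) (Ioi t) t)) (hDc.intervalIntegrable 0 x)
    simp only [this]; ring
  · rw [← hDpos x hx]; exact hder x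

theorem hasDerivAt_fst_of_differentiableAt {ψ : ℝ × Vel → ℝ} {p : ℝ × Vel}
    (h : DifferentiableAt ℝ ψ p) :
    HasDerivAt (fun y => ψ (y, p.2)) (fderiv ℝ ψ p (1, 0)) p.1 :=
  HasFDerivAt.comp_hasDerivAt p.1 (f := fun y : ℝ => ((y, p.2) : ℝ × Vel)) (f' := (1, 0))
    h.hasFDerivAt ((hasDerivAt_id p.1).prodMk (hasDerivAt_const p.1 p.2))

theorem hasDerivAt_vel_of_differentiableAt {ψ : ℝ × Vel → ℝ} {p : ℝ × Vel}
    (h : DifferentiableAt ℝ ψ p) :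
    HasDerivAt (fun w => ψ (p.1, (w, p.2.2))) (fderiv ℝ ψ p (0, (1, 0))) p.2.1 :=
  HasFDerivAt.comp_hasDerivAt p.2.1 (f := fun w : ℝ => ((p.1, (w, p.2.2)) : ℝ × Vel))
    (f' := (0, (1, 0))) h.hasFDerivAt
    ((hasDerivAt_const p.2.1 p.1).prodMk ((hasDerivAt_id p.2.1).prodMk
      (hasDerivAt_const p.2.1 p.2.2)))

theorem hasDerivAt_energy_of_differentiableAt {b : Vel → ℝ} {q : Vel}
    (h : DifferentiableAt ℝ b q) :
    HasDerivAt (fun e => b (e, q.2)) (fderiv ℝ b q (1, 0)) q.1 :=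
  HasFDerivAt.comp_hasDerivAt q.1 (f := fun e : ℝ => ((e, q.2) : Vel)) (f' := (1, 0))
    h.hasFDerivAt ((hasDerivAt_id q.1).prodMk (hasDerivAt_const q.1 q.2))

/-- A continuous function orthogonal to all derivatives of test functions is constant. -/
theorem eq_of_integral_deriv_mul_eq_zero {G : ℝ → ℝ} {X : ℝ} (hX : 0 < X)
    (hG : ContinuousOn G (Icc 0 X))
    (h : ∀ a : ℝ → ℝ, ContDiff ℝ 1 a → (∃ l u, 0 < l ∧ u < X ∧ ∀ x, x ∉ Icc l u → a x = 0) →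
      ∫ x in Ioi 0, deriv a x * G x = 0) :
    ∀ x ∈ Icc 0 X, G x = G 0 := by
  let B : ContDiffBump (X / 2) := ⟨X / 8, X / 4, by positivity, by linarith⟩
  set ω₀ : ℝ → ℝ := B.normed volume with hω₀
  have hω₀s : ContDiff ℝ (⊤ : ℕ∞) ω₀ := B.contDiff_normed
  have hω₀c : HasCompactSupport ω₀ := B.hasCompactSupport_normed
  have hω₀1 : ∫ x, ω₀ x = 1 := B.integral_normed
  have hω₀t : tsupport ω₀ ⊆ Ioo 0 X := by
    rw [hω₀, B.tsupport_normed_eq, Real.closedBall_eq_Icc]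
    intro x hx
    have h1 : X / 2 - X / 4 ≤ x := hx.1
    have h2 : x ≤ X / 2 + X / 4 := hx.2
    constructor <;> linarith
  have hmulint : ∀ g : ℝ → ℝ, Continuous g → HasCompactSupport g → tsupport g ⊆ Ioo 0 X →
      Integrable (fun x => g x * G x) := by
    intro g hgc hgs hgt
    have h1 : IntegrableOn (fun x => g x * G x) (Icc 0 X) :=
      (hgc.continuousOn.mul hG).integrableOn_Icc
    refine h1.integrable_of_forall_notMem_eq_zero fun x hx => ?_
    have : x ∉ tsupport g := fun hc => hx (Ioo_subset_Icc_self (hgt hc))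
    rw [image_eq_zero_of_notMem_tsupport this, zero_mul]
  have hset : ∀ g : ℝ → ℝ, tsupport g ⊆ Ioo 0 X →
      ∫ x in Ioi 0, g x * G x = ∫ x, g x * G x := by
    intro g hgt
    refine setIntegral_eq_integral_of_forall_compl_eq_zero fun x hx => ?_
    have : x ∉ tsupport g := fun hc => hx (hgt hc).1
    rw [image_eq_zero_of_notMem_tsupport this, zero_mul]
  set c : ℝ := ∫ x, ω₀ x * G x with hc
  have key : ∀ g : ℝ → ℝ, ContDiff ℝ (⊤ : ℕ∞) g → HasCompactSupport g → tsupport g ⊆ Ioo 0 X →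
      ∫ x, g x • (G x - c) = 0 := by
    intro g hgs hgc hgt
    -- The argument of du Bois-Reymond: subtracting a multiple of a fixed bump of mass 1 gives mean
    -- zero, so the primitive is compactly supported and is an admissible test function.
    set ω : ℝ → ℝ := fun x => g x - (∫ y, g y) * ω₀ x with hω
    have hωc : Continuous ω := hgs.continuous.sub (continuous_const.mul hω₀s.continuous)
    have hgi : Integrable g := hgs.continuous.integrable_of_hasCompactSupport hgc
    have hω₀i : Integrable ω₀ := hω₀s.continuous.integrable_of_hasCompactSupport hω₀c
    have hω0 : ∫ x, ω x = 0 := by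
      rw [hω, integral_sub hgi (hω₀i.const_mul _), integral_const_mul, hω₀1]; ring
    set K : Set ℝ := (tsupport g ∪ tsupport ω₀) ∪ {X / 2} with hK
    have hKc : IsCompact K := (hgc.isCompact.union hω₀c.isCompact).union isCompact_singleton
    have hKX : K ⊆ Ioo 0 X := union_subset (union_subset hgt hω₀t)
      (singleton_subset_iff.2 ⟨by linarith, by linarith⟩)
    have hKn : K.Nonempty := ⟨X / 2, Or.inr rfl⟩
    obtain ⟨l, hl, hl'⟩ := hKc.exists_isLeast hKn
    obtain ⟨u, hu, hu'⟩ := hKc.exists_isGreatest hKn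
    have hωK : ∀ x, x ∉ Icc l u → ω x = 0 := by
      intro x hx
      have h1 : x ∉ K := fun hxK => hx ⟨hl' hxK, hu' hxK⟩
      have h2 : x ∉ tsupport g := fun hc => h1 (Or.inl (Or.inl hc))
      have h3 : x ∉ tsupport ω₀ := fun hc => h1 (Or.inl (Or.inr hc))
      simp [hω, image_eq_zero_of_notMem_tsupport h2, image_eq_zero_of_notMem_tsupport h3]
    have hlu : l ≤ u := hl' hu
    set a : ℝ → ℝ := fun x => ∫ t in l..x, ω t with ha
    have hader : ∀ x, HasDerivAt a (ω x) x := fun x =>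
      (hωc.integral_hasStrictDerivAt l x).hasDerivAt
    have ha' : deriv a = ω := funext fun x => (hader x).deriv
    have haC : ContDiff ℝ 1 a := by
      rw [contDiff_one_iff_deriv]
      exact ⟨fun x => (hader x).differentiableAt, ha' ▸ hωc⟩
    have hall : ∫ t in l..u, ω t = 0 := by
      rw [intervalIntegral.integral_of_le hlu, ← integral_Icc_eq_integral_Ioc, ← hω0]
      exact setIntegral_eq_integral_of_forall_compl_eq_zero hωK
    have ha0 : ∀ x, x ∉ Icc l u → a x = 0 := by
      intro x hx
      rcases lt_or_ge x l with hxl | hxl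
      · have : ∀ t ∈ uIoc l x, ω t = 0 := by
          intro t ht
          rw [uIoc_of_ge hxl.le] at ht
          rcases eq_or_lt_of_le ht.2 with h1 | h1
          -- The endpoint `l` lies in the integration range but not in the complement of `Icc l u`,
          -- so the value there comes from continuity.
          · have hcl : Tendsto ω (𝓝[<] l) (𝓝 (ω l)) := hωc.continuousAt.continuousWithinAt
            have h0 : Tendsto ω (𝓝[<] l) (𝓝 0) := by
              refine tendsto_const_nhds.congr' ?_
              filter_upwards [self_mem_nhdsWithin] with y hy
              exact (hωK y fun h => absurd h.1 (not_le.2 hy)).symm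
            rw [h1]; exact tendsto_nhds_unique hcl h0
          · exact hωK t fun h => absurd h.1 (not_le.2 h1)
        rw [ha]
        simp only
        rw [intervalIntegral.integral_congr_ae (g := fun _ => (0 : ℝ))
          (Eventually.of_forall this)]
        simp
      · have hxu : u < x := by
          by_contra hcon
          exact hx ⟨hxl, not_lt.1 hcon⟩
        rw [ha]
        simp only
        rw [← intervalIntegral.integral_add_adjacent_intervals (hωc.intervalIntegrable l u)
          (hωc.intervalIntegrable u x), hall, zero_add,
          intervalIntegral.integral_congr_ae (g := fun _ => (0 : ℝ))]
        · simp
        · refine Eventually.of_forall fun t ht => ?_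
          rw [uIoc_of_le hxu.le] at ht
          exact hωK t fun h => absurd h.2 (not_le.2 ht.1)
    have h0 := h a haC ⟨l, u, (hKX hl).1, (hKX hu).2, ha0⟩
    rw [ha'] at h0
    have hωt : tsupport ω ⊆ Ioo 0 X := by
      refine (closure_minimal (s := Function.support ω) (t := Icc l u) ?_ isClosed_Icc).trans ?_
      · intro x hx
        by_contra hcon
        exact hx (hωK x hcon)
      · exact fun x hx => ⟨lt_of_lt_of_le (hKX hl).1 hx.1, lt_of_le_of_lt hx.2 (hKX hu).2⟩
    rw [hset ω hωt] at h0
    have h1 : ∫ x, ω x * G x = (∫ x, g x * G x) - (∫ y, g y) * c := by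
      rw [hc, ← integral_const_mul, ← integral_sub (hmulint g hgs.continuous hgc hgt)
        ((hmulint ω₀ hω₀s.continuous hω₀c hω₀t).const_mul _)]
      refine integral_congr_ae (Eventually.of_forall fun x => ?_)
      simp only [hω]; ring
    have h2 : ∫ x, g x • (G x - c) = (∫ x, g x * G x) - (∫ y, g y) * c := by
      rw [← integral_mul_const, ← integral_sub (hmulint g hgs.continuous hgc hgt)
        (hgi.mul_const c)]
      refine integral_congr_ae (Eventually.of_forall fun x => ?_)
      simp only [smul_eq_mul]; ring
    rw [h2, ← h1, h0]
  have hloc : LocallyIntegrableOn (fun x => G x - c) (Ioo 0 X) :=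
    ((hG.mono Ioo_subset_Icc_self).sub continuousOn_const).locallyIntegrableOn measurableSet_Ioo
  have hae := isOpen_Ioo.ae_eq_zero_of_integral_contDiff_smul_eq_zero hloc key
  have hae2 : G =ᵐ[volume.restrict (Icc 0 X)] fun _ => c := by
    rw [← restrict_Ioo_eq_restrict_Icc]
    refine (ae_restrict_iff' measurableSet_Ioo).2 ?_
    filter_upwards [hae] with x hx hx'
    exact sub_eq_zero.1 (hx hx')
  have heq := Measure.eqOn_Icc_of_ae_eq volume hX.ne hae2 hG continuousOn_const
  intro x hx
  rw [heq hx, heq (left_mem_Icc.2 hX.le)]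

/-- Products of `L¹`-convergent functions with bounded pointwise convergent ones. -/
theorem tendsto_integral_mul_of_distL1 {l : Filter ℝ} [l.IsCountablyGenerated]
    {F m : ℝ → Vel → ℝ} {F₀ m₀ : Vel → ℝ} {C : ℝ}
    (hF : ∀ᶠ x in l, Integrable (F x)) (hF₀ : Integrable F₀)
    (hdist : Tendsto (fun x => distL1 (F x) F₀) l (𝓝 0))
    (hm : ∀ᶠ x in l, Measurable (m x)) (hC : ∀ᶠ x in l, ∀ ξ, |m x ξ| ≤ C)
    (hlim : ∀ ξ, Tendsto (fun x => m x ξ) l (𝓝 (m₀ ξ))) :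
    Tendsto (fun x => ∫ ξ, F x ξ * m x ξ) l (𝓝 (∫ ξ, F₀ ξ * m₀ ξ)) := by
  have h1 : Tendsto (fun x => ∫ ξ, F₀ ξ * m x ξ) l (𝓝 (∫ ξ, F₀ ξ * m₀ ξ)) := by
    refine tendsto_integral_filter_of_dominated_convergence (fun ξ => |F₀ ξ| * C) ?_ ?_
      (hF₀.abs.mul_const C) (Eventually.of_forall fun ξ => (hlim ξ).const_mul _)
    · filter_upwards [hm] with x hx
      exact hF₀.aestronglyMeasurable.mul hx.aestronglyMeasurable
    · filter_upwards [hC] with x hx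
      refine Eventually.of_forall fun ξ => ?_
      rw [norm_mul]
      exact mul_le_mul_of_nonneg_left (hx ξ) (norm_nonneg _)
  have h2 : Tendsto (fun x => (∫ ξ, F x ξ * m x ξ) - ∫ ξ, F₀ ξ * m x ξ) l (𝓝 0) := by
    rw [tendsto_zero_iff_norm_tendsto_zero]
    have h3 : Tendsto (fun x => distL1 (F x) F₀ * C) l (𝓝 0) := by
      simpa using hdist.mul_const C
    refine squeeze_zero' (Eventually.of_forall fun _ => norm_nonneg _) ?_ h3
    filter_upwards [hF, hm, hC] with x a b c
    have i1 : Integrable fun ξ => F x ξ * m x ξ :=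
      a.mul_bdd (c := C) b.aestronglyMeasurable (Eventually.of_forall c)
    have i2 : Integrable fun ξ => F₀ ξ * m x ξ :=
      hF₀.mul_bdd (c := C) b.aestronglyMeasurable (Eventually.of_forall c)
    rw [← integral_sub i1 i2, distL1, ← integral_mul_const]
    refine (norm_integral_le_integral_norm _).trans ?_
    refine integral_mono (i1.sub i2).norm ((a.sub hF₀).abs.mul_const C) fun ξ => ?_
    simp only [Real.norm_eq_abs]
    rw [← sub_mul, abs_mul]
    exact mul_le_mul_of_nonneg_left (c ξ) (abs_nonneg _)
  have := h2.add h1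
  simpa using this

theorem integrableOn_mul_of_hasCompactSupport {f k : ℝ × Vel → ℝ} {S : Set (ℝ × Vel)}
    (hS : IsClosed S) (hf : LocallyIntegrableOn f S volume) (hk : Continuous k)
    (hkc : HasCompactSupport k) : IntegrableOn (fun p => f p * k p) S := by
  have hK : IsCompact (S ∩ tsupport k) := hkc.isCompact.inter_left hS
  have h1 : IntegrableOn f (S ∩ tsupport k) :=
    hf.integrableOn_compact_subset inter_subset_left hK
  have h2 : IntegrableOn (fun p => f p * k p) (S ∩ tsupport k) :=
    h1.mul_continuousOn hk.continuousOn hK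
  refine h2.of_forall_sdiff_eq_zero hS.measurableSet fun p hp => ?_
  have : p ∉ tsupport k := fun hc => hp.2 ⟨hp.1, hc⟩
  rw [image_eq_zero_of_notMem_tsupport this, mul_zero]

end

section

/-! ### Fluxes of solutions through energy levels -/

variable {ne : ℝ → ℝ} {α φb : ℝ} {fb finf : Vel → ℝ} {f : ℝ → Vel → ℝ} {φ : ℝ → ℝ}

/-- An increasing potential would stay above `φb > 0` and could not tend to 0. -/
theorem IsSolution.dx_neg (sol : IsSolution ne α φb fb finf f φ) (hφb : 0 < φb) :
    ∀ x, 0 ≤ x → dx 1 φ x < 0 := by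
  refine sol.monotone.resolve_left fun hpos => ?_
  have hmono : MonotoneOn φ (Ici 0) := by
    refine monotoneOn_of_deriv_nonneg (convex_Ici 0) sol.phi_C1.continuousOn ?_ ?_
    · rw [interior_Ici]
      exact fun x hx => (hasDerivAt_dx sol.phi_C1 hx).differentiableAt.differentiableWithinAt
    · rw [interior_Ici]
      intro x hx
      rw [(hasDerivAt_dx sol.phi_C1 hx).deriv]
      exact (hpos x (le_of_lt hx)).le
  have h1 : φb ≤ 0 := by
    refine ge_of_tendsto sol.phi_infty ?_
    filter_upwards [eventually_ge_atTop 0] with x hx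
    rw [← sol.phi_zero]
    exact hmono self_mem_Ici hx hx
  linarith

theorem IsSolution.strictAntiOn (sol : IsSolution ne α φb fb finf f φ) (hφb : 0 < φb) :
    StrictAntiOn φ (Ici 0) := by
  refine strictAntiOn_of_deriv_neg (convex_Ici 0) sol.phi_C1.continuousOn ?_
  rw [interior_Ici]
  intro x hx
  rw [(hasDerivAt_dx sol.phi_C1 hx).deriv]
  exact sol.dx_neg hφb x (le_of_lt hx)

theorem IsSolution.pos (sol : IsSolution ne α φb fb finf f φ) (hφb : 0 < φb) {x : ℝ}
    (hx : 0 ≤ x) : 0 < φ x := by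
  have hanti := sol.strictAntiOn hφb
  have h1 : φ (x + 1) < φ x :=
    hanti hx (show (0 : ℝ) ≤ x + 1 by linarith) (by linarith)
  have h2 : 0 ≤ φ (x + 1) := by
    refine le_of_tendsto sol.phi_infty ?_
    filter_upwards [eventually_ge_atTop (x + 1)] with y hy
    exact hanti.antitoneOn (show (0 : ℝ) ≤ x + 1 by linarith)
      (show (0 : ℝ) ≤ y by linarith) hy
  linarith

theorem IsSolution.le (sol : IsSolution ne α φb fb finf f φ) (hφb : 0 < φb) {x : ℝ}
    (hx : 0 ≤ x) : φ x ≤ φb := by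
  rw [← sol.phi_zero]
  exact (sol.strictAntiOn hφb).antitoneOn self_mem_Ici hx hx

/-! ### Test functions of the energy and flux identities -/

/-- The smoothed indicator of `{v > 0}`, exact outside `(0, ε)`. -/
def softStep (ε v : ℝ) : ℝ := Real.smoothTransition (v / ε)

theorem contDiff_softStep (ε : ℝ) : ContDiff ℝ 1 (softStep ε) :=
  Real.smoothTransition.contDiff.comp (contDiff_id.div_const ε)

theorem softStep_of_nonpos {ε v : ℝ} (hε : 0 < ε) (hv : v ≤ 0) : softStep ε v = 0 :=
  Real.smoothTransition.zero_of_nonpos (div_nonpos_of_nonpos_of_nonneg hv hε.le)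

theorem softStep_of_ge {ε v : ℝ} (hε : 0 < ε) (hv : ε ≤ v) : softStep ε v = 1 :=
  Real.smoothTransition.one_of_one_le ((one_le_div hε).2 hv)

theorem abs_softStep_le (ε v : ℝ) : |softStep ε v| ≤ 1 := by
  rw [softStep, abs_of_nonneg (Real.smoothTransition.nonneg _)]
  exact Real.smoothTransition.le_one _

theorem hasDerivAt_softStep_zero {ε v : ℝ} (hε : 0 < ε) (hv : v < 0 ∨ ε < v) :
    HasDerivAt (softStep ε) 0 v := by
  rcases hv with hv | hv
  · refine (hasDerivAt_const v (0 : ℝ)).congr_of_eventuallyEq ?_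
    filter_upwards [Iio_mem_nhds hv] with w hw using softStep_of_nonpos hε (le_of_lt hw)
  · refine (hasDerivAt_const v (1 : ℝ)).congr_of_eventuallyEq ?_
    filter_upwards [Ioi_mem_nhds hv] with w hw using softStep_of_ge hε (le_of_lt hw)

/-- Test functions travelling with the characteristics. -/
def charTest (Φ : ℝ → ℝ) (b : Vel → ℝ) (a d : ℝ → ℝ) (ε : ℝ) (p : ℝ × Vel) : ℝ :=
  b (kin (Φ p.1) p.2) * (a p.1 + d p.1 * softStep ε p.2.1)

theorem exists_abs_le_of_hasCompactSupport {E : Type*} [SeminormedAddCommGroup E] {b : E → ℝ}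
    (hb : HasCompactSupport b) : ∃ B, 0 ≤ B ∧ ∀ q, B < ‖q‖ → b q = 0 := by
  obtain ⟨B, hB⟩ := hb.isCompact.isBounded.exists_norm_le
  refine ⟨max B 0, le_max_right _ _, fun q hq => ?_⟩
  by_contra hne
  have := hB q (subset_tsupport b hne)
  exact absurd (lt_of_le_of_lt (le_max_left B 0) hq) (not_lt.2 this)

/-- Functions of position and energy localized in both have compact support. -/
theorem hasCompactSupport_of_kin {Φ : ℝ → ℝ} (hΦ : Continuous Φ) {b : Vel → ℝ}
    (hb : HasCompactSupport b) {ψ : ℝ × Vel → ℝ} {A : ℝ}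
    (h1 : ∀ p : ℝ × Vel, A < |p.1| → ψ p = 0)
    (h2 : ∀ p : ℝ × Vel, b (kin (Φ p.1) p.2) = 0 → ψ p = 0) : HasCompactSupport ψ := by
  obtain ⟨B, hB0, hB⟩ := exists_abs_le_of_hasCompactSupport hb
  obtain ⟨C, hC⟩ := (isCompact_Icc (a := -A) (b := A)).exists_bound_of_continuousOn
    hΦ.continuousOn
  set R := 2 * (B + |C|) + 1 with hR
  refine HasCompactSupport.intro (K := Icc (-A) A ×ˢ (Icc (-R) R ×ˢ Metric.closedBall 0 B))
    (isCompact_Icc.prod (isCompact_Icc.prod (isCompact_closedBall _ _))) fun p hp => ?_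
  by_contra hne
  have hA : |p.1| ≤ A := not_lt.1 fun hc => hne (h1 p hc)
  have hq : ‖kin (Φ p.1) p.2‖ ≤ B := not_lt.1 fun hc => hne (h2 p (hB _ hc))
  have hp1 : p.1 ∈ Icc (-A) A := abs_le.1 hA
  have hc := hC p.1 hp1
  rw [Prod.norm_def, sup_le_iff] at hq
  have hq1 : |p.2.1 ^ 2 / 2 - Φ p.1| ≤ B := hq.1
  have hc' : |Φ p.1| ≤ |C| := (show |Φ p.1| ≤ C from hc).trans (le_abs_self C)
  have hv2 : p.2.1 ^ 2 ≤ 2 * (B + |C|) := by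
    have := abs_le.1 hq1
    have := abs_le.1 hc'
    linarith
  have hv : |p.2.1| ≤ R := by
    have hs := sq_abs p.2.1
    nlinarith [abs_nonneg p.2.1, abs_nonneg C]
  exact hp ⟨hp1, abs_le.1 hv, mem_closedBall_zero_iff.2 hq.2⟩

theorem contDiff_charTest {Φ : ℝ → ℝ} (hΦ : ContDiff ℝ 1 Φ) {b : Vel → ℝ} (hb : ContDiff ℝ 1 b)
    {a d : ℝ → ℝ} (ha : ContDiff ℝ 1 a) (hd : ContDiff ℝ 1 d) (ε : ℝ) :
    ContDiff ℝ 1 (charTest Φ b a d ε) := by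
  have h1 : ContDiff ℝ 1 fun p : ℝ × Vel => kin (Φ p.1) p.2 :=
    ((contDiff_snd.fst.pow 2).div_const 2 |>.sub (hΦ.comp contDiff_fst)).prodMk contDiff_snd.snd
  exact (hb.comp h1).mul ((ha.comp contDiff_fst).add ((hd.comp contDiff_fst).mul
    ((contDiff_softStep ε).comp contDiff_snd.fst)))

/-- The energy factor is constant along characteristics, so the derivatives of `b` cancel. The
acceleration acting on the soft step is the only unwanted term, and `hz` removes it. -/
theorem charTest_transport {Φ : ℝ → ℝ} (hΦ : ContDiff ℝ 1 Φ) {b : Vel → ℝ} (hb : ContDiff ℝ 1 b)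
    {a d : ℝ → ℝ} (ha : ContDiff ℝ 1 a) (hd : ContDiff ℝ 1 d) {ε : ℝ} {p : ℝ × Vel}
    {D : ℝ} (hD : HasDerivAt Φ D p.1)
    (hz : b (kin (Φ p.1) p.2) * (d p.1 * deriv (softStep ε) p.2.1) = 0) :
    p.2.1 * fderiv ℝ (charTest Φ b a d ε) p (1, 0) +
      D * fderiv ℝ (charTest Φ b a d ε) p (0, (1, 0)) =
      p.2.1 * b (kin (Φ p.1) p.2) * (deriv a p.1 + deriv d p.1 * softStep ε p.2.1) := by
  have hψ : DifferentiableAt ℝ (charTest Φ b a d ε) p :=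
    (contDiff_charTest hΦ hb ha hd ε).differentiable one_ne_zero p
  have hbd := hasDerivAt_energy_of_differentiableAt (hb.differentiable one_ne_zero
    (kin (Φ p.1) p.2))
  set β := fderiv ℝ b (kin (Φ p.1) p.2) (1, 0) with hβ
  have ha' := (ha.differentiable one_ne_zero p.1).hasDerivAt
  have hd' := (hd.differentiable one_ne_zero p.1).hasDerivAt
  have hS' := ((contDiff_softStep ε).differentiable one_ne_zero p.2.1).hasDerivAt
  have e1 : HasDerivAt (fun y => charTest Φ b a d ε (y, p.2))
      (β * (-D) * (a p.1 + d p.1 * softStep ε p.2.1) + b (kin (Φ p.1) p.2) *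
        (deriv a p.1 + deriv d p.1 * softStep ε p.2.1)) p.1 := by
    have h1 : HasDerivAt (fun y => b (kin (Φ y) p.2)) (β * (-D)) p.1 :=
      HasDerivAt.comp p.1 (h₂ := fun e => b (e, p.2.2)) (h := fun y => p.2.1 ^ 2 / 2 - Φ y)
        hbd (hD.const_sub _)
    exact h1.mul (ha'.add (hd'.mul_const (softStep ε p.2.1)))
  have e2 : HasDerivAt (fun w => charTest Φ b a d ε (p.1, (w, p.2.2)))
      (β * p.2.1 * (a p.1 + d p.1 * softStep ε p.2.1) + b (kin (Φ p.1) p.2) *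
        (d p.1 * deriv (softStep ε) p.2.1)) p.2.1 := by
    have h1 : HasDerivAt (fun w => b (kin (Φ p.1) (w, p.2.2))) (β * p.2.1) p.2.1 :=
      HasDerivAt.comp p.2.1 (h₂ := fun e => b (e, p.2.2)) (h := fun w => w ^ 2 / 2 - Φ p.1)
        hbd (hasDerivAt_half_sq_sub _ _)
    exact h1.mul ((hS'.const_mul (d p.1)).const_add (a p.1))
  rw [(hasDerivAt_fst_of_differentiableAt hψ).unique e1,
    (hasDerivAt_vel_of_differentiableAt hψ).unique e2, hz]
  ring

/-- The flux of `f` weighted by the energy observable `b` and by `m(ξ₁)`. -/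
def flux (f : ℝ → Vel → ℝ) (φ : ℝ → ℝ) (b : Vel → ℝ) (m : ℝ → ℝ) (x : ℝ) : ℝ :=
  ∫ ξ, f x ξ * (ξ.1 * b (kin (φ x) ξ) * m ξ.1)

/-- At potentials at least `c`, speeds in `[0, ε]` have energy at most `ε² / 2 - c`: the weight `b`
vanishes on the ramp of the soft step. -/
theorem eq_zero_of_lt_eps {b : Vel → ℝ} {ε s c : ℝ} (hb0 : ∀ q : Vel, q.1 ≤ ε ^ 2 / 2 - c → b q = 0)
    (hs : c ≤ s) {ξ : Vel} (h0 : 0 ≤ ξ.1) (h1 : ξ.1 ≤ ε) : b (kin s ξ) = 0 := by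
  refine hb0 _ ?_
  simp only [kin]
  nlinarith

/-- On the support of `b` the energy is bounded; with s in a bounded range the speed is bounded too.
-/
theorem exists_bound_flux_weight {b : Vel → ℝ} (hb : Continuous b) (hbc : HasCompactSupport b)
    (S : ℝ) : ∃ C, ∀ s ∈ Icc 0 S, ∀ ξ : Vel, |ξ.1 * b (kin s ξ)| ≤ C := by
  obtain ⟨B, hB0, hB⟩ := exists_abs_le_of_hasCompactSupport hbc
  obtain ⟨M, hM⟩ := hbc.exists_bound_of_continuous hb
  have hM0 : 0 ≤ M := (norm_nonneg _).trans (hM 0)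
  refine ⟨(2 * (B + |S|) + 1) * M, fun s hs ξ => ?_⟩
  by_cases hq : B < ‖kin s ξ‖
  · rw [hB _ hq, mul_zero, abs_zero]; positivity
  · rw [not_lt, Prod.norm_def, sup_le_iff] at hq
    have hq1 : |ξ.1 ^ 2 / 2 - s| ≤ B := hq.1
    have hv2 : ξ.1 ^ 2 ≤ 2 * (B + |S|) := by
      have := abs_le.1 hq1
      have := hs.2.trans (le_abs_self S)
      linarith
    rw [abs_mul]
    refine mul_le_mul ?_ (hM _) (abs_nonneg _) (by positivity)
    have h := sq_abs ξ.1
    nlinarith [abs_nonneg ξ.1, abs_nonneg S]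

theorem tendsto_flux {l : Filter ℝ} [l.IsCountablyGenerated] {b : Vel → ℝ} (hb : Continuous b)
    (hbc : HasCompactSupport b) {m : ℝ → ℝ} (hm : Continuous m) (hm1 : ∀ v, |m v| ≤ 1)
    {S : ℝ} {F₀ : Vel → ℝ} {s₀ : ℝ}
    (hF : ∀ᶠ x in l, Integrable (f x)) (hF₀ : Integrable F₀)
    (hdist : Tendsto (fun x => distL1 (f x) F₀) l (𝓝 0))
    (hφS : ∀ᶠ x in l, φ x ∈ Icc 0 S) (hφ : Tendsto φ l (𝓝 s₀)) :
    Tendsto (flux f φ b m) l (𝓝 (∫ ξ, F₀ ξ * (ξ.1 * b (kin s₀ ξ) * m ξ.1))) := by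
  obtain ⟨C, hC⟩ := exists_bound_flux_weight hb hbc S
  refine tendsto_integral_mul_of_distL1 (C := C) hF hF₀ hdist ?_ ?_ ?_
  · refine Eventually.of_forall fun x => Continuous.measurable ?_
    have : Continuous fun ξ : Vel => kin (φ x) ξ := by unfold kin; fun_prop
    fun_prop
  · filter_upwards [hφS] with x hx ξ
    rw [abs_mul]
    exact (mul_le_of_le_one_right (abs_nonneg _) (hm1 _)).trans (hC _ hx ξ)
  · intro ξ
    have h1 : Tendsto (fun x => kin (φ x) ξ) l (𝓝 (kin s₀ ξ)) :=
      (hφ.const_sub _).prodMk_nhds tendsto_const_nhds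
    exact (((hb.tendsto _).comp h1).const_mul _).mul_const _

theorem IsSolution.continuousOn_flux (sol : IsSolution ne α φb fb finf f φ) (hφb : 0 < φb)
    {b : Vel → ℝ} (hb : Continuous b)
    (hbc : HasCompactSupport b) {m : ℝ → ℝ} (hm : Continuous m) (hm1 : ∀ v, |m v| ≤ 1) :
    ContinuousOn (flux f φ b m) (Ici 0) := by
  intro x hx
  refine tendsto_flux (S := φb) hb hbc hm hm1 ?_ (sol.integrable x hx) (sol.continuous x hx) ?_
    (sol.phi_C1.continuousOn x hx)
  · filter_upwards [self_mem_nhdsWithin] with y hy using sol.integrable y hy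
  · filter_upwards [self_mem_nhdsWithin] with y hy using ⟨(sol.pos hφb hy).le, sol.le hφb hy⟩

theorem IsSolution.tendsto_flux_atTop (sol : IsSolution ne α φb fb finf f φ) (hφb : 0 < φb)
    (hfinf : Integrable finf) {b : Vel → ℝ} (hb : Continuous b)
    (hbc : HasCompactSupport b) {m : ℝ → ℝ} (hm : Continuous m) (hm1 : ∀ v, |m v| ≤ 1) :
    Tendsto (flux f φ b m) atTop (𝓝 (∫ ξ, finf ξ * (ξ.1 * b (kin 0 ξ) * m ξ.1))) := by
  refine tendsto_flux (S := φb) hb hbc hm hm1 ?_ hfinf sol.farField ?_ sol.phi_infty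
  · filter_upwards [eventually_ge_atTop 0] with y hy using sol.integrable y hy
  · filter_upwards [eventually_ge_atTop 0] with y hy using ⟨(sol.pos hφb hy).le, sol.le hφb hy⟩

/-- The weak formulation tested with functions travelling with the characteristics. -/
theorem IsSolution.weak_flux (sol : IsSolution ne α φb fb finf f φ) (hφb : 0 < φb)
    {b : Vel → ℝ} (hb : ContDiff ℝ 1 b) (hbc : HasCompactSupport b)
    {a d : ℝ → ℝ} (ha : ContDiff ℝ 1 a) (hac : HasCompactSupport a) (hd : ContDiff ℝ 1 d)
    (hdc : HasCompactSupport d) {ε x₀ : ℝ} (hε : 0 < ε) (hx₀ : 0 ≤ x₀)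
    (hd0 : ∀ x, x₀ ≤ x → d x = 0) (hb0 : ∀ q : Vel, q.1 ≤ ε ^ 2 / 2 - φ x₀ → b q = 0)
    (hbd : a 0 = α * (a 0 + d 0)) :
    (∫ x in Ioi 0, (deriv a x * flux f φ b (fun _ => 1) x +
      deriv d x * flux f φ b (softStep ε) x)) +
      (a 0 + d 0) * ∫ ξ in posVel, fb ξ * (ξ.1 * b (kin φb ξ)) = 0 := by
  obtain ⟨Φ, hΦ, hΦeq, hΦd⟩ := exists_contDiff_extension sol.phi_C1
  have hΦ0 : Φ 0 = φb := by rw [hΦeq 0 le_rfl, sol.phi_zero]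
  have hx₀b : φ x₀ ≤ φb := sol.le hφb hx₀
  obtain ⟨A₁, hA₁0, hA₁⟩ := exists_abs_le_of_hasCompactSupport hac
  obtain ⟨A₂, hA₂0, hA₂⟩ := exists_abs_le_of_hasCompactSupport hdc
  have hcut : ∀ {p : ℝ × Vel}, b (kin φb p.2) ≠ 0 → p.2 ∈ posVel → ε ≤ p.2.1 := by
    intro p hp hp2
    by_contra hcon
    exact hp (eq_zero_of_lt_eps hb0 hx₀b (le_of_lt hp2) (not_le.1 hcon).le)
  have htest : IsTest α (charTest Φ b a d ε) := by
    refine ⟨contDiff_charTest hΦ hb ha hd ε, ?_, fun ξ hξ => ?_⟩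
    · refine hasCompactSupport_of_kin (A := max A₁ A₂) hΦ.continuous hbc (fun p hp => ?_)
        (fun p hp => ?_)
      · rw [charTest, hA₁ p.1 (lt_of_le_of_lt (le_max_left _ _) hp),
          hA₂ p.1 (lt_of_le_of_lt (le_max_right _ _) hp)]
        ring
      · rw [charTest, hp, zero_mul]
    · have hξ' : 0 < ξ.1 := hξ
      have hr : kin φb (-ξ.1, ξ.2) = kin φb ξ := kin_refl φb ξ
      simp only [charTest, hΦ0]
      -- The test function is `b` times `a 0` on incoming velocities and, where `b` is nonzero, `b`
      -- times `a 0 + d 0` on outgoing ones; `hbd` is then exactly the reflection condition.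
      rw [hr, softStep_of_nonpos hε (by linarith : -ξ.1 ≤ 0)]
      by_cases hbz : b (kin φb ξ) = 0
      · rw [hbz]; ring
      · rw [softStep_of_ge hε (hcut (p := (0, ξ)) hbz hξ), mul_one, mul_zero, add_zero]
        conv_rhs => rw [hbd]
        ring
  have hw := sol.vlasov _ htest
  set k : ℝ × Vel → ℝ := fun p => p.2.1 * b (kin (Φ p.1) p.2) *
    (deriv a p.1 + deriv d p.1 * softStep ε p.2.1) with hk
  have hkc : Continuous k := by
    have h1 : Continuous fun p : ℝ × Vel => kin (Φ p.1) p.2 := by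
      have := hΦ.continuous
      unfold kin; fun_prop
    have h2 := hb.continuous
    have h3 := ha.continuous_deriv_one
    have h4 := hd.continuous_deriv_one
    have h5 := (contDiff_softStep ε).continuous
    rw [hk]
    fun_prop
  have hks : HasCompactSupport k := by
    obtain ⟨A₃, _, hA₃⟩ := exists_abs_le_of_hasCompactSupport hac.deriv
    obtain ⟨A₄, _, hA₄⟩ := exists_abs_le_of_hasCompactSupport hdc.deriv
    refine hasCompactSupport_of_kin (A := max A₃ A₄) hΦ.continuous hbc (fun p hp => ?_)
        (fun p hp => ?_)
    · simp only [hk]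
      rw [hA₃ p.1 (lt_of_le_of_lt (le_max_left _ _) hp),
          hA₄ p.1 (lt_of_le_of_lt (le_max_right _ _) hp)]
      ring
    · simp only [hk]; rw [hp]; ring
  have hfin_int : IntegrableOn (fun p : ℝ × Vel => f p.1 p.2 * k p) (Ioi 0 ×ˢ univ) :=
    (integrableOn_mul_of_hasCompactSupport (isClosed_Ici.prod isClosed_univ) sol.locInt hkc
      hks).mono_set (prod_mono_left Ioi_subset_Ici_self)
  have hfirst : ∫ p in (Ioi 0 ×ˢ univ : Set (ℝ × Vel)), f p.1 p.2 *
      (p.2.1 * fderiv ℝ (charTest Φ b a d ε) p (1, 0) +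
        dx 1 φ p.1 * fderiv ℝ (charTest Φ b a d ε) p (0, (1, 0))) =
      ∫ p in (Ioi 0 ×ˢ univ : Set (ℝ × Vel)), f p.1 p.2 * k p := by
    refine setIntegral_congr_fun (measurableSet_Ioi.prod MeasurableSet.univ) fun p hp => ?_
    have hp0 : 0 < p.1 := (mem_prod.1 hp).1
    -- Where `d` is nonzero one has `x < x₀`, hence `φ x ≥ φ x₀`, and there `b` vanishes on the
    -- ramp.
    have hz : b (kin (Φ p.1) p.2) * (d p.1 * deriv (softStep ε) p.2.1) = 0 := by
      by_cases hdz : d p.1 = 0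
      · rw [hdz]; ring
      have hlt : p.1 < x₀ := not_le.1 fun hc => hdz (hd0 _ hc)
      by_cases hv : p.2.1 < 0 ∨ ε < p.2.1
      · rw [(hasDerivAt_softStep_zero hε hv).deriv]; ring
      · rw [not_or, not_lt, not_lt] at hv
        rw [hΦeq _ hp0.le, eq_zero_of_lt_eps hb0
          ((sol.strictAntiOn hφb).antitoneOn hp0.le hx₀ hlt.le) hv.1 hv.2]
        ring
    rw [charTest_transport hΦ hb ha hd (hΦd _ hp0.le) hz]
  rw [hfirst] at hw
  have hvol : (volume.restrict (Ioi 0 ×ˢ univ) : Measure (ℝ × Vel)) =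
      (volume.restrict (Ioi 0)).prod volume := by
    rw [Measure.volume_eq_prod, ← Measure.prod_restrict, Measure.restrict_univ]
  rw [IntegrableOn, hvol] at hfin_int
  rw [hvol, integral_prod _ hfin_int] at hw
  have hinner : ∫ x in Ioi (0 : ℝ), ∫ ξ, f x ξ * k (x, ξ) =
      ∫ x in Ioi 0, (deriv a x * flux f φ b (fun _ => 1) x +
      deriv d x * flux f φ b (softStep ε) x) := by
    refine setIntegral_congr_fun measurableSet_Ioi fun x hx => ?_
    have hx0 : 0 ≤ x := le_of_lt hx
    obtain ⟨C, hC⟩ := exists_bound_flux_weight hb.continuous hbc φb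
    have hxs : φ x ∈ Icc 0 φb := ⟨(sol.pos hφb hx0).le, sol.le hφb hx0⟩
    have hkin : Continuous fun ξ : Vel => kin (φ x) ξ := by unfold kin; fun_prop
    have hbcont := hb.continuous
    have hScont := (contDiff_softStep ε).continuous
    have hi : ∀ m : ℝ → ℝ, Continuous m → (∀ v, |m v| ≤ 1) →
        Integrable fun ξ : Vel => f x ξ * (ξ.1 * b (kin (φ x) ξ) * m ξ.1) := by
      intro m hm hm1
      refine (sol.integrable x hx0).mul_bdd (c := C) (by fun_prop) (Eventually.of_forall fun ξ => ?_)
      rw [norm_mul]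
      exact (mul_le_of_le_one_right (norm_nonneg _) (hm1 _)).trans (hC _ hxs ξ)
    simp only [flux]
    rw [← integral_const_mul, ← integral_const_mul, ← integral_add
      ((hi (fun _ => 1) continuous_const (by simp)).const_mul _)
      ((hi (softStep ε) hScont (abs_softStep_le ε)).const_mul _)]
    refine integral_congr_ae (Eventually.of_forall fun ξ => ?_)
    simp only [hk, hΦeq x hx0]
    ring
  rw [hinner] at hw
  refine Eq.trans ?_ hw
  rw [← integral_const_mul]
  congr 1
  refine setIntegral_congr_fun measurableSet_posVel fun ξ hξ => ?_
  simp only [charTest, hΦ0]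
  by_cases hbz : b (kin φb ξ) = 0
  · rw [hbz]; ring
  · rw [softStep_of_ge hε (hcut (p := (0, ξ)) hbz hξ)]; ring

end

section

/-! ### Solutions of the Vlasov equation have the energy profiles of the data -/

variable {ne : ℝ → ℝ} {α φb r : ℝ} {fb finf hp hm : Vel → ℝ} {f : ℝ → Vel → ℝ} {φ : ℝ → ℝ}

theorem hasCompactSupport_of_Icc {a : ℝ → ℝ} {l u : ℝ} (h : ∀ x, x ∉ Icc l u → a x = 0) :
    HasCompactSupport a :=
  HasCompactSupport.intro isCompact_Icc h

/-- With `d = 0` and `a` supported away from the wall, the weak formulation says that the net flux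
has zero distributional derivative; continuity makes it constant. -/
theorem IsSolution.flux_one_eq (sol : IsSolution ne α φb fb finf f φ) (hφb : 0 < φb)
    {b : Vel → ℝ} (hb : ContDiff ℝ 1 b) (hbc : HasCompactSupport b) {ε x₀ : ℝ} (hε : 0 < ε)
    (hx₀ : 0 ≤ x₀) (hb0 : ∀ q : Vel, q.1 ≤ ε ^ 2 / 2 - φ x₀ → b q = 0) {x : ℝ} (hx : 0 ≤ x) :
    flux f φ b (fun _ => 1) x = flux f φ b (fun _ => 1) 0 := by
  refine eq_of_integral_deriv_mul_eq_zero (X := x + 1) (by linarith)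
    ((sol.continuousOn_flux hφb hb.continuous hbc continuous_const (by simp)).mono
      Icc_subset_Ici_self) (fun a ha hlu => ?_) x ⟨hx, by linarith⟩
  obtain ⟨l, u, hl, hu, h0⟩ := hlu
  have ha0 : a 0 = 0 := h0 0 fun h => absurd h.1 (not_le.2 hl)
  have := sol.weak_flux hφb hb hbc ha (hasCompactSupport_of_Icc h0) (d := fun _ => 0)
    contDiff_const HasCompactSupport.zero hε hx₀ (fun _ _ => rfl) hb0 (by rw [ha0]; ring)
  simpa [ha0] using this

/-- The right-moving flux is conserved only as long as no particle in the energy window turns back;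
`hb0` puts all turning points beyond `x₀`. -/
theorem IsSolution.flux_softStep_eq (sol : IsSolution ne α φb fb finf f φ) (hφb : 0 < φb)
    {b : Vel → ℝ} (hb : ContDiff ℝ 1 b) (hbc : HasCompactSupport b) {ε x₀ : ℝ} (hε : 0 < ε)
    (hx₀ : 0 < x₀) (hb0 : ∀ q : Vel, q.1 ≤ ε ^ 2 / 2 - φ x₀ → b q = 0) {x : ℝ}
    (hx : x ∈ Icc 0 x₀) :
    flux f φ b (softStep ε) x = flux f φ b (softStep ε) 0 := by
  refine eq_of_integral_deriv_mul_eq_zero hx₀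
    ((sol.continuousOn_flux hφb hb.continuous hbc (contDiff_softStep ε).continuous
      (abs_softStep_le ε)).mono Icc_subset_Ici_self) (fun d hd hlu => ?_) x hx
  obtain ⟨l, u, hl, hu, h0⟩ := hlu
  have hd0 : d 0 = 0 := h0 0 fun h => absurd h.1 (not_le.2 hl)
  have := sol.weak_flux hφb hb hbc (a := fun _ => 0) contDiff_const HasCompactSupport.zero hd
    (hasCompactSupport_of_Icc h0) hε hx₀.le (fun y hy => h0 y fun h => absurd h.2 (by linarith))
    hb0 (by rw [hd0]; ring)
  simpa [hd0] using this

/-- The flux emitted at the wall when the net flux vanishes. -/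
theorem IsSolution.flux_softStep_zero (sol : IsSolution ne α φb fb finf f φ) (hφb : 0 < φb)
    {b : Vel → ℝ} (hb : ContDiff ℝ 1 b) (hbc : HasCompactSupport b) {ε x₀ : ℝ} (hε : 0 < ε)
    (hx₀ : 0 < x₀) (hb0 : ∀ q : Vel, q.1 ≤ ε ^ 2 / 2 - φ x₀ → b q = 0)
    (hnet : ∀ x, 0 ≤ x → flux f φ b (fun _ => 1) x = 0) :
    (1 - α) * flux f φ b (softStep ε) 0 = ∫ ξ in posVel, fb ξ * (ξ.1 * b (kin φb ξ)) := by
  let B : ContDiffBump (0 : ℝ) := ⟨x₀ / 4, x₀ / 2, by positivity, by linarith⟩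
  have hB : ContDiff ℝ 1 B := B.contDiff
  have hBc : HasCompactSupport B := B.hasCompactSupport
  have hB1 : B 0 = 1 := B.one_of_mem_closedBall (Metric.mem_closedBall_self (by positivity))
  have hB0 : ∀ x, x₀ / 2 ≤ x → B x = 0 := fun x hx => by
    refine B.zero_of_le_dist ?_
    rw [Real.dist_eq, sub_zero]
    exact hx.trans (le_abs_self x)
  have hBd0 : ∀ x, x₀ ≤ x → deriv B x = 0 := fun x hx => by
    have : B =ᶠ[𝓝 x] fun _ => (0 : ℝ) := by
      filter_upwards [Ioi_mem_nhds (show x₀ / 2 < x by linarith)] with y hy using hB0 y (le_of_lt hy)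
    rw [this.deriv_eq, deriv_const]
  -- This choice gives `a 0 = α` and `a 0 + d 0 = 1`, as the reflection condition requires. The net
  -- flux drops out, and the right-moving flux, constant on the support of `d`, is multiplied by `∫
  -- B' = -1`.
  have hw := sol.weak_flux hφb hb hbc (a := fun x => α * B x) (d := fun x => (1 - α) * B x)
    (contDiff_const.mul hB) (hBc.mul_left) (contDiff_const.mul hB) (hBc.mul_left) hε hx₀.le
    (fun x hx => by rw [hB0 x (by linarith), mul_zero]) hb0 (by rw [hB1]; ring)
  have hderiv : ∫ x in Ioi (0 : ℝ), deriv B x = -1 := by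
    rw [hBc.integral_Ioi_deriv_eq hB 0, hB1]
  have hI : ∫ x in Ioi (0 : ℝ), (deriv (fun x => α * B x) x * flux f φ b (fun _ => 1) x +
      deriv (fun x => (1 - α) * B x) x * flux f φ b (softStep ε) x) =
      -((1 - α) * flux f φ b (softStep ε) 0) := by
    have : ∀ x ∈ Ioi (0 : ℝ), deriv (fun x => α * B x) x * flux f φ b (fun _ => 1) x +
      deriv (fun x => (1 - α) * B x) x * flux f φ b (softStep ε) x =
      (1 - α) * flux f φ b (softStep ε) 0 * deriv B x := by
      intro x hx
      have hx0 : 0 < x := hx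
      rw [hnet x hx0.le, deriv_const_mul _ (hB.differentiable one_ne_zero x),
        deriv_const_mul _ (hB.differentiable one_ne_zero x)]
      rcases le_total x₀ x with h | h
      · rw [hBd0 x h]; ring
      · rw [sol.flux_softStep_eq hφb hb hbc hε hx₀ hb0 ⟨hx0.le, h⟩]; ring
    rw [setIntegral_congr_fun measurableSet_Ioi this, integral_const_mul, hderiv]
    ring
  rw [hI, hB1] at hw
  linarith

theorem integrable_mul_weight {F b : Vel → ℝ} (hF : Integrable F) (hb : Continuous b)
    (hbc : HasCompactSupport b) {s : ℝ} (hs : 0 ≤ s) {m : ℝ → ℝ} (hm : Continuous m)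
    (hm1 : ∀ v, |m v| ≤ 1) : Integrable fun ξ : Vel => F ξ * (ξ.1 * b (kin s ξ) * m ξ.1) := by
  obtain ⟨C, hC⟩ := exists_bound_flux_weight hb hbc s
  have hkin : Continuous fun ξ : Vel => kin s ξ := by unfold kin; fun_prop
  refine hF.mul_bdd (c := C) (by fun_prop) (Eventually.of_forall fun ξ => ?_)
  rw [norm_mul]
  exact (mul_le_of_le_one_right (norm_nonneg _) (hm1 _)).trans (hC _ ⟨hs, le_rfl⟩ ξ)

/-- Since `b` vanishes on slow particles, the soft step acts as the sharp indicator of `ξ₁ > 0`. -/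
theorem integral_mul_weight_softStep {F b : Vel → ℝ} (hF : Integrable F) (hb : Continuous b)
    (hbc : HasCompactSupport b) {s ε : ℝ} (hs : 0 ≤ s) (hε : 0 < ε)
    (hb0 : ∀ q : Vel, q.1 ≤ ε ^ 2 / 2 - s → b q = 0) :
    ∫ ξ : Vel, F ξ * (ξ.1 * b (kin s ξ) * softStep ε ξ.1) =
      ∫ ξ in posVel, F ξ * (ξ.1 * b (kin s ξ)) := by
  rw [integral_eq_add_refl (integrable_mul_weight hF hb hbc hs (contDiff_softStep ε).continuous
    (abs_softStep_le ε))]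
  have h2 : ∫ ξ in posVel, F (refl ξ) * ((refl ξ).1 * b (kin s (refl ξ)) *
      softStep ε (refl ξ).1) = 0 := by
    refine setIntegral_eq_zero_of_forall_eq_zero fun ξ hξ => ?_
    have h0 : 0 < ξ.1 := hξ
    rw [softStep_of_nonpos hε (show (refl ξ).1 ≤ 0 by simp only [refl]; linarith)]
    ring
  rw [h2, add_zero]
  refine setIntegral_congr_fun measurableSet_posVel fun ξ hξ => ?_
  have h0 : 0 < ξ.1 := hξ
  rcases le_total ε ξ.1 with h | h
  · simp only [softStep_of_ge hε h, mul_one]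
  · simp only [eq_zero_of_lt_eps hb0 le_rfl h0.le h]
    ring

theorem integral_mul_weight_one {F b : Vel → ℝ} (hF : Integrable F) (hb : Continuous b)
    (hbc : HasCompactSupport b) {s : ℝ} (hs : 0 ≤ s) :
    ∫ ξ : Vel, F ξ * (ξ.1 * b (kin s ξ) * (fun _ : ℝ => (1 : ℝ)) ξ.1) =
      (∫ ξ in posVel, F ξ * (ξ.1 * b (kin s ξ))) -
        ∫ ξ in posVel, F (refl ξ) * (ξ.1 * b (kin s ξ)) := by
  rw [integral_eq_add_refl (integrable_mul_weight hF hb hbc hs (m := fun _ => 1) continuous_const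
    (by simp)), sub_eq_add_neg, ← integral_neg]
  congr 1
  · exact setIntegral_congr_fun measurableSet_posVel fun ξ _ => by simp
  · refine setIntegral_congr_fun measurableSet_posVel fun ξ _ => ?_
    simp only [kin_refl, mul_one]
    simp only [refl]
    ring

/-- In energy variables s survives only in the domain of integration, so fluxes at different
potentials can be compared. -/
theorem integral_profile_mul {h b : Vel → ℝ} (hh : Measurable h) (hb : Measurable b) (s : ℝ) :
    ∫ ξ in posVel, h (kin s ξ) * (ξ.1 * b (kin s ξ)) = ∫ q in energyGT (-s), h q * b q := by
  rw [← integral_mul_comp_kin s (F := fun q => h q * b q) (hh.mul hb)]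
  refine setIntegral_congr_fun measurableSet_posVel fun ξ _ => ?_
  ring

theorem setIntegral_energyGT_congr {g : Vel → ℝ} {c c' : ℝ} (hcc : c ≤ c')
    (hg : ∀ q : Vel, q.1 ≤ c' → g q = 0) :
    ∫ q in energyGT c, g q = ∫ q in energyGT c', g q := by
  refine setIntegral_eq_of_subset_of_forall_sdiff_eq_zero (measurableSet_energyGT _)
    (fun q hq => lt_of_le_of_lt hcc (show c' < q.1 from hq)) fun q hq => ?_
  exact hg q (not_lt.1 hq.2)

/-- Particles of positive energy carry the far-field profile. -/
theorem IsSolution.integral_weight_pos (sol : IsSolution ne α φb fb finf f φ) (hφb : 0 < φb)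
    (hprof : IsEnergyProfile α φb r fb finf hp hm) (hfinf : Integrable finf)
    {b : Vel → ℝ} (hb : ContDiff ℝ 1 b) (hbc : HasCompactSupport b)
    {η : ℝ} (hη : 0 < η) (hb0 : ∀ q : Vel, q.1 ≤ η → b q = 0) {x : ℝ} (hx : 0 ≤ x) :
    ∫ ξ in posVel, f x ξ * (ξ.1 * b (kin (φ x) ξ)) =
        ∫ ξ in posVel, hp (kin (φ x) ξ) * (ξ.1 * b (kin (φ x) ξ)) ∧
      ∫ ξ in posVel, f x (refl ξ) * (ξ.1 * b (kin (φ x) ξ)) =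
        ∫ ξ in posVel, hm (kin (φ x) ξ) * (ξ.1 * b (kin (φ x) ξ)) := by
  -- Then `ε² / 2 = η`: at every potential `s ≥ 0`, particles of speed at most `ε` fall in the zero
  -- set of `b`, so `x₀` may be taken arbitrarily large.
  set ε := √(2 * η) with hεdef
  have hε : 0 < ε := Real.sqrt_pos.2 (by linarith)
  have hε2 : ε ^ 2 / 2 = η := by rw [hεdef, Real.sq_sqrt (by linarith)]; ring
  have hb0' : ∀ s, 0 ≤ s → ∀ q : Vel, q.1 ≤ ε ^ 2 / 2 - s → b q = 0 := fun s hs q hq =>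
    hb0 q (by linarith)
  have hbc' := hb.continuous
  have hlim : ∀ m : ℝ → ℝ, Continuous m → (∀ v, |m v| ≤ 1) →
      (∀ y, 0 ≤ y → flux f φ b m y = flux f φ b m 0) →
      flux f φ b m x = ∫ ξ, finf ξ * (ξ.1 * b (kin 0 ξ) * m ξ.1) := by
    intro m hm hm1 hconst
    refine tendsto_nhds_unique ?_ (sol.tendsto_flux_atTop hφb hfinf hbc' hbc hm hm1)
    refine tendsto_const_nhds.congr' ?_
    filter_upwards [eventually_ge_atTop 0] with y hy
    rw [hconst y hy, hconst x hx]
  have hS := hlim (softStep ε) (contDiff_softStep ε).continuous (abs_softStep_le ε) fun y hy =>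
    sol.flux_softStep_eq hφb hb hbc hε (x₀ := y + 1) (by linarith)
      (hb0' _ (sol.pos hφb (by linarith)).le) ⟨hy, by linarith⟩
  have h1 := hlim (fun _ => 1) continuous_const (by simp) fun y hy =>
    sol.flux_one_eq hφb hb hbc hε le_rfl (hb0' _ (sol.pos hφb le_rfl).le) hy
  have hs : 0 ≤ φ x := (sol.pos hφb hx).le
  rw [flux, integral_mul_weight_softStep (sol.integrable x hx) hbc' hbc hs hε (hb0' _ hs),
    integral_mul_weight_softStep hfinf hbc' hbc le_rfl hε (hb0' _ le_rfl)] at hS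
  rw [flux, integral_mul_weight_one (sol.integrable x hx) hbc' hbc hs,
    integral_mul_weight_one hfinf hbc' hbc le_rfl] at h1
  have hz : ∀ {h : Vel → ℝ}, Measurable h →
      ∫ ξ in posVel, h (kin 0 ξ) * (ξ.1 * b (kin 0 ξ)) =
        ∫ ξ in posVel, h (kin (φ x) ξ) * (ξ.1 * b (kin (φ x) ξ)) := by
    intro h hh
    rw [integral_profile_mul hh hbc'.measurable, integral_profile_mul hh hbc'.measurable]
    refine (setIntegral_energyGT_congr (by linarith) fun q hq => ?_).symm
    rw [hb0 q (by linarith), mul_zero]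
  have hP : ∫ ξ in posVel, finf ξ * (ξ.1 * b (kin 0 ξ)) =
      ∫ ξ in posVel, hp (kin 0 ξ) * (ξ.1 * b (kin 0 ξ)) := by
    refine integral_congr_ae ?_
    filter_upwards [hprof.finf_p] with ξ hξ
    rw [hξ]
  have hM : ∫ ξ in posVel, finf (refl ξ) * (ξ.1 * b (kin 0 ξ)) =
      ∫ ξ in posVel, hm (kin 0 ξ) * (ξ.1 * b (kin 0 ξ)) := by
    refine integral_congr_ae ?_
    filter_upwards [hprof.finf_m] with ξ hξ
    rw [hξ]
  rw [hP, hz hprof.reg_p.meas] at hS h1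
  rw [hM, hz hprof.reg_m.meas] at h1
  exact ⟨hS, by linarith⟩

/-- Particles of negative energy carry the profile emitted at the wall. -/
theorem IsSolution.integral_weight_neg (sol : IsSolution ne α φb fb finf f φ) (hφb : 0 < φb)
    (hα : α < 1) (hprof : IsEnergyProfile α φb r fb finf hp hm) (hfinf : Integrable finf)
    {b : Vel → ℝ} (hb : ContDiff ℝ 1 b) (hbc : HasCompactSupport b) {x : ℝ} (hx : 0 ≤ x)
    {η : ℝ} (hη : 0 < η) (hb0 : ∀ q : Vel, q.1 ≤ -φ x + η → b q = 0)
    (hb1 : ∀ q : Vel, 0 ≤ q.1 → b q = 0) :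
    ∫ ξ in posVel, f x ξ * (ξ.1 * b (kin (φ x) ξ)) =
        ∫ ξ in posVel, hp (kin (φ x) ξ) * (ξ.1 * b (kin (φ x) ξ)) ∧
      ∫ ξ in posVel, f x (refl ξ) * (ξ.1 * b (kin (φ x) ξ)) =
        ∫ ξ in posVel, hm (kin (φ x) ξ) * (ξ.1 * b (kin (φ x) ξ)) := by
  have hα' : 1 - α ≠ 0 := by linarith
  -- Half of the gap `η` pays for the ramp, `ε² / 2 = η / 2`; the other half pays for the drop of φ
  -- between `x` and `x₀`.
  set ε := √η with hεdef
  have hε : 0 < ε := Real.sqrt_pos.2 hη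
  have hε2 : ε ^ 2 / 2 = η / 2 := by rw [hεdef, Real.sq_sqrt hη.le]
  have hbc' := hb.continuous
  have hs : 0 ≤ φ x := (sol.pos hφb hx).le
  have hsb : φ x ≤ φb := sol.le hφb hx
  obtain ⟨x₀, hxx₀, hx₀⟩ : ∃ x₀, x < x₀ ∧ φ x - η / 2 ≤ φ x₀ := by
    have hc : ContinuousWithinAt φ (Ioi x) x :=
      (sol.phi_C1.continuousOn x hx).mono fun y hy => hx.trans (le_of_lt hy)
    obtain ⟨y, h1, h2⟩ := ((hc.eventually_const_le
      (show φ x - η / 2 < φ x by linarith)).and self_mem_nhdsWithin).exists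
    exact ⟨y, h2, h1⟩
  have hx₀0 : 0 < x₀ := lt_of_le_of_lt hx hxx₀
  have hb0' : ∀ q : Vel, q.1 ≤ ε ^ 2 / 2 - φ x₀ → b q = 0 := fun q hq => hb0 q (by linarith)
  -- The net flux is constant and tends to its far-field value, which is 0 because no negative
  -- energy exists at potential 0.
  have hnet : ∀ y, 0 ≤ y → flux f φ b (fun _ => 1) y = 0 := by
    intro y hy
    have h0 : ∫ ξ, finf ξ * (ξ.1 * b (kin 0 ξ) * (fun _ : ℝ => (1 : ℝ)) ξ.1) = 0 := by
      refine integral_eq_zero_of_ae (Eventually.of_forall fun ξ => ?_)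
      simp only [hb1 (kin 0 ξ) (by simp only [kin, sub_zero]; positivity)]
      simp
    rw [← h0]
    refine tendsto_nhds_unique ?_ (sol.tendsto_flux_atTop hφb hfinf hbc' hbc
      (m := fun _ => 1) continuous_const (by simp))
    refine tendsto_const_nhds.congr' ?_
    filter_upwards [eventually_ge_atTop 0] with z hz
    rw [sol.flux_one_eq hφb hb hbc hε hx₀0.le hb0' hz, sol.flux_one_eq hφb hb hbc hε hx₀0.le hb0' hy]
  have hwall := sol.flux_softStep_zero hφb hb hbc hε hx₀0 hb0' hnet
  have hS := sol.flux_softStep_eq hφb hb hbc hε hx₀0 hb0' ⟨hx, hxx₀.le⟩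
  have h1 := hnet x hx
  rw [flux, integral_mul_weight_softStep (sol.integrable x hx) hbc' hbc hs hε
    (fun q hq => hb0 q (by linarith))] at hS
  rw [flux, integral_mul_weight_one (sol.integrable x hx) hbc' hbc hs] at h1
  have hpb : ∫ ξ in posVel, fb ξ * (ξ.1 * b (kin φb ξ)) =
      (1 - α) * ∫ ξ in posVel, hp (kin (φ x) ξ) * (ξ.1 * b (kin (φ x) ξ)) := by
    rw [integral_profile_mul hprof.reg_p.meas hbc'.measurable,
      ← setIntegral_energyGT_congr (c := -φb) (by linarith) (fun q hq => by
        rw [hb0 q (by linarith), mul_zero]),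
      ← integral_profile_mul hprof.reg_p.meas hbc'.measurable, ← integral_const_mul]
    refine integral_congr_ae ?_
    filter_upwards [hprof.fb_eq] with ξ hξ
    rcases le_total 0 (kin φb ξ).1 with h | h
    · rw [hb1 _ h]; ring
    · rw [hξ, hprof.eq_neg _ h]; ring
  have hmb : ∫ ξ in posVel, hm (kin (φ x) ξ) * (ξ.1 * b (kin (φ x) ξ)) =
      ∫ ξ in posVel, hp (kin (φ x) ξ) * (ξ.1 * b (kin (φ x) ξ)) := by
    refine setIntegral_congr_fun measurableSet_posVel fun ξ _ => ?_
    rcases le_total 0 (kin (φ x) ξ).1 with h | h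
    · simp only [hb1 _ h]; ring
    · simp only [hprof.eq_neg _ h]
  rw [hpb] at hwall
  have hflux := mul_left_cancel₀ hα' hwall
  rw [hmb]
  exact ⟨hS.trans hflux, by linarith [hS.trans hflux]⟩

theorem exists_gap {K : Set Vel} (hK : IsCompact K) {c : ℝ} (h : ∀ q ∈ K, c < q.1) :
    ∃ η > 0, ∀ q ∈ K, c + η < q.1 := by
  rcases K.eq_empty_or_nonempty with rfl | hne
  · exact ⟨1, one_pos, by simp⟩
  obtain ⟨q, hq, hmin⟩ := hK.exists_isMinOn hne continuous_fst.continuousOn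
  refine ⟨(q.1 - c) / 2, by linarith [h q hq], fun p hp => ?_⟩
  have : q.1 ≤ p.1 := hmin hp
  linarith [h q hq]

/-- Fluxes through energy levels determine a function of the velocity. -/
theorem ae_eq_of_integral_weight {F h : Vel → ℝ} {s : ℝ} (hF : IntegrableOn F posVel)
    (hh : IntegrableOn (fun ξ => h (kin s ξ)) posVel) {J : Set ℝ} (hJ : IsOpen J)
    (heq : ∀ b : Vel → ℝ, ContDiff ℝ 1 b → HasCompactSupport b → tsupport b ⊆ Prod.fst ⁻¹' J →
      tsupport b ⊆ energyGT (-s) →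
      ∫ ξ in posVel, F ξ * (ξ.1 * b (kin s ξ)) =
        ∫ ξ in posVel, h (kin s ξ) * (ξ.1 * b (kin s ξ))) :
    ∀ᵐ ξ ∂(volume.restrict posVel), (kin s ξ).1 ∈ J → F ξ = h (kin s ξ) := by
  have hkin : Continuous (kin s) := by unfold kin; fun_prop
  set U : Set Vel := posVel ∩ kin s ⁻¹' (Prod.fst ⁻¹' J) with hU
  have hpo : IsOpen posVel := isOpen_lt continuous_const continuous_fst
  have hUo : IsOpen U := hpo.inter ((hJ.preimage continuous_fst).preimage hkin)
  have hloc : LocallyIntegrableOn (fun ξ => F ξ - h (kin s ξ)) U :=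
    ((hF.sub hh).mono_set inter_subset_left).locallyIntegrableOn
  have key := hUo.ae_eq_zero_of_integral_contDiff_smul_eq_zero hloc fun θ hθ hθc hθU => by
    obtain ⟨ρ, hρ, hgap⟩ := exists_gap hθc.isCompact (c := 0) fun q hq => (hθU hq).1
    have hθ0 : ∀ ξ : Vel, ξ.1 ≤ ρ → θ ξ = 0 := fun ξ hξ => by
      by_contra hne
      linarith [hgap ξ (subset_tsupport θ hne)]
    -- Chosen so that `ξ₁ * b (kin s ξ) = θ ξ` for `ξ₁ > 0`. As `θ` vanishes for speeds up to `ρ`,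
    -- the square root in the denominator does no harm.
    set b : Vel → ℝ := fun q =>
      θ (√(2 * (q.1 + s)), q.2) / √(2 * (q.1 + s)) with hb
    have hbC : ContDiff ℝ 1 b := by
      rw [contDiff_iff_contDiffAt]
      intro q
      by_cases hq : -s < q.1
      · have hpos : 2 * (q.1 + s) ≠ 0 := by linarith
        have h1 : ContDiffAt ℝ 1 (fun q : Vel => √(2 * (q.1 + s))) q :=
          ContDiffAt.sqrt (contDiffAt_const.mul (contDiffAt_fst.add contDiffAt_const)) hpos
        have h2 : ContDiffAt ℝ 1 (fun q : Vel => θ (√(2 * (q.1 + s)), q.2)) q :=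
          ((hθ.of_le (by exact_mod_cast le_top)).contDiffAt).comp q (h1.prodMk contDiffAt_snd)
        exact h2.div h1 (Real.sqrt_ne_zero'.2 (by linarith))
      · have : b =ᶠ[𝓝 q] fun _ => 0 := by
          have hn : {p : Vel | p.1 < -s + ρ ^ 2 / 2} ∈ 𝓝 q :=
            (isOpen_lt continuous_fst continuous_const).mem_nhds
              (show q.1 < -s + ρ ^ 2 / 2 by nlinarith [not_lt.1 hq, pow_pos hρ 2])
          filter_upwards [hn] with p hp
          have hp' : p.1 < -s + ρ ^ 2 / 2 := hp
          have : √(2 * (p.1 + s)) ≤ ρ := Real.sqrt_le_iff.2 ⟨hρ.le, by linarith⟩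
          simp only [hb]
          rw [hθ0 _ this, zero_div]
        exact contDiffAt_const.congr_of_eventuallyEq this
    have hbsupp : tsupport b ⊆ kin s '' tsupport θ := by
      refine closure_minimal ?_ (hθc.isCompact.image hkin).isClosed
      intro q hq
      have hne : θ (√(2 * (q.1 + s)), q.2) ≠ 0 := fun h0 => hq (by simp only [hb]; rw [h0, zero_div])
      have hs : -s ≤ q.1 := by
        by_contra hcon
        refine hne (hθ0 _ ?_)
        simp only
        rw [Real.sqrt_eq_zero_of_nonpos (by linarith)]
        exact hρ.le
      exact ⟨_, subset_tsupport θ hne, kin_sqrt hs⟩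
    have hbc : HasCompactSupport b :=
      (hθc.isCompact.image hkin).of_isClosed_subset (isClosed_tsupport b) hbsupp
    have hbJ : tsupport b ⊆ Prod.fst ⁻¹' J := fun q hq => by
      obtain ⟨ξ, hξ, rfl⟩ := hbsupp hq
      exact (hθU hξ).2
    have hbs : tsupport b ⊆ energyGT (-s) := fun q hq => by
      obtain ⟨ξ, hξ, rfl⟩ := hbsupp hq
      exact kin_mem (hθU hξ).1
    have hbθ : ∀ ξ ∈ posVel, ξ.1 * b (kin s ξ) = θ ξ := by
      intro ξ hξ
      have h0 : 0 < ξ.1 := hξ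
      simp only [hb]
      rw [sqrt_kin hξ]
      have : ((ξ.1, (kin s ξ).2) : Vel) = ξ := rfl
      rw [this]
      field_simp
    have hsub : ∫ ξ, θ ξ • (F ξ - h (kin s ξ)) = ∫ ξ in posVel, θ ξ • (F ξ - h (kin s ξ)) := by
      symm
      refine setIntegral_eq_integral_of_forall_compl_eq_zero fun ξ hξ => ?_
      rw [hθ0 ξ ((not_lt.1 (show ¬ 0 < ξ.1 from hξ)).trans hρ.le), zero_smul]
    obtain ⟨C, hC⟩ := hθc.exists_bound_of_continuous hθ.continuous
    have hi : ∀ {G : Vel → ℝ}, IntegrableOn G posVel →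
        IntegrableOn (fun ξ => θ ξ * G ξ) posVel := fun hG =>
      hG.bdd_mul hθ.continuous.aestronglyMeasurable (Eventually.of_forall hC)
    have e := heq b hbC hbc hbJ hbs
    have e1 : ∀ G : Vel → ℝ, ∫ ξ in posVel, G ξ * (ξ.1 * b (kin s ξ)) =
        ∫ ξ in posVel, θ ξ * G ξ := fun G =>
      setIntegral_congr_fun measurableSet_posVel fun ξ hξ => by
        simp only [hbθ ξ hξ]; ring
    rw [e1 F, e1 fun ξ => h (kin s ξ)] at e
    rw [hsub]
    simp only [smul_eq_mul, mul_sub]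
    rw [integral_sub (hi hF) (hi hh), e, sub_self]
  refine (ae_restrict_iff' measurableSet_posVel).2 ?_
  filter_upwards [key] with ξ hξ h1 h2
  exact sub_eq_zero.1 (hξ ⟨h1, h2⟩)

/-- The distribution function of a solution is determined by its potential. -/
theorem IsSolution.ae_eq_profileDensity (sol : IsSolution ne α φb fb finf f φ) (hφb : 0 < φb)
    (hα : α < 1) (hr : 2 < r) (hprof : IsEnergyProfile α φb r fb finf hp hm)
    (hfinf : Integrable finf) {x : ℝ} (hx : 0 ≤ x) :
    f x =ᵐ[volume] profileDensity hp hm (φ x) := by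
  have hs : 0 ≤ φ x := (sol.pos hφb hx).le
  have hP := hprof.reg_p.integrableOn_comp_kin hr hs
  have hM := hprof.reg_m.integrableOn_comp_kin hr hs
  have hF : IntegrableOn (f x) posVel := (sol.integrable x hx).integrableOn
  have hF' : IntegrableOn (fun ξ => f x (refl ξ)) posVel :=
    (measurePreserving_refl.integrable_comp_of_integrable (sol.integrable x hx)).integrableOn
  have hpos : ∀ b : Vel → ℝ, ContDiff ℝ 1 b → HasCompactSupport b →
      tsupport b ⊆ Prod.fst ⁻¹' Ioi (0 : ℝ) →
      (∫ ξ in posVel, f x ξ * (ξ.1 * b (kin (φ x) ξ)) =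
        ∫ ξ in posVel, hp (kin (φ x) ξ) * (ξ.1 * b (kin (φ x) ξ))) ∧
      ∫ ξ in posVel, f x (refl ξ) * (ξ.1 * b (kin (φ x) ξ)) =
        ∫ ξ in posVel, hm (kin (φ x) ξ) * (ξ.1 * b (kin (φ x) ξ)) :=
    fun b hb hbc hbt => by
    obtain ⟨η, hη, hgap⟩ := exists_gap hbc.isCompact (c := 0) fun q hq => hbt hq
    exact sol.integral_weight_pos hφb hprof hfinf hb hbc hη (fun q hq => by
      by_contra hne
      linarith [hgap q (subset_tsupport b hne)]) hx
  have hneg : ∀ b : Vel → ℝ, ContDiff ℝ 1 b → HasCompactSupport b →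
      tsupport b ⊆ Prod.fst ⁻¹' Iio (0 : ℝ) → tsupport b ⊆ energyGT (-φ x) →
      (∫ ξ in posVel, f x ξ * (ξ.1 * b (kin (φ x) ξ)) =
        ∫ ξ in posVel, hp (kin (φ x) ξ) * (ξ.1 * b (kin (φ x) ξ))) ∧
      ∫ ξ in posVel, f x (refl ξ) * (ξ.1 * b (kin (φ x) ξ)) =
        ∫ ξ in posVel, hm (kin (φ x) ξ) * (ξ.1 * b (kin (φ x) ξ)) :=
    fun b hb hbc hbt hbs => by
    obtain ⟨η, hη, hgap⟩ := exists_gap hbc.isCompact (c := -φ x) fun q hq => hbs hq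
    exact sol.integral_weight_neg hφb hα hprof hfinf hb hbc hx hη (fun q hq => by
      by_contra hne
      linarith [hgap q (subset_tsupport b hne)]) (fun q hq => by
      by_contra hne
      exact absurd (hbt (subset_tsupport b hne)) (not_lt.2 hq))
  refine ae_of_posVel ?_ ?_
  · filter_upwards [ae_eq_of_integral_weight hF hP isOpen_Ioi fun b h1 h2 h3 _ =>
        (hpos b h1 h2 h3).1, ae_eq_of_integral_weight hF hP isOpen_Iio fun b h1 h2 h3 h4 =>
        (hneg b h1 h2 h3 h4).1, ae_energy_ne_zero (φ x),
        ae_restrict_mem measurableSet_posVel] with ξ a b c d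
    rw [profileDensity_pos d]
    rcases lt_or_gt_of_ne c with h | h
    · exact b h
    · exact a h
  · filter_upwards [ae_eq_of_integral_weight hF' hM isOpen_Ioi fun b h1 h2 h3 _ =>
        (hpos b h1 h2 h3).2, ae_eq_of_integral_weight hF' hM isOpen_Iio fun b h1 h2 h3 h4 =>
        (hneg b h1 h2 h3 h4).2, ae_energy_ne_zero (φ x),
        ae_restrict_mem measurableSet_posVel] with ξ a b c d
    rw [profileDensity_refl d]
    rcases lt_or_gt_of_ne c with h | h
    · exact b h
    · exact a h

end

section

/-! ### The potential well -/

/-- The primitive of `g` vanishing at `0`. -/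
def primitive (g : ℝ → ℝ) (s : ℝ) : ℝ := ∫ t in (0 : ℝ)..s, g t

section Primitive

variable {g : ℝ → ℝ}

theorem primitive_zero : primitive g 0 = 0 := intervalIntegral.integral_same

theorem primitive_eq_max {s : ℝ} (hs : 0 ≤ s) :
    primitive g s = ∫ t in (0 : ℝ)..s, g (max t 0) := by
  refine intervalIntegral.integral_congr fun t ht => ?_
  rw [uIcc_of_le hs] at ht
  simp only [max_eq_left ht.1]

theorem hasDerivWithinAt_primitive (hg : ContinuousOn g (Ici 0)) {s : ℝ} (hs : 0 ≤ s) :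
    HasDerivWithinAt (primitive g) (g s) (Ici 0) s := by
  have hc : Continuous fun t => g (max t 0) :=
    hg.comp_continuous (by fun_prop) fun t => le_max_right t 0
  have h := (hc.integral_hasStrictDerivAt 0 s).hasDerivAt.hasDerivWithinAt (s := Ici 0)
  simp only [max_eq_left hs] at h
  exact h.congr (fun t ht => primitive_eq_max ht) (primitive_eq_max hs)

theorem hasDerivAt_primitive (hg : ContinuousOn g (Ici 0)) {s : ℝ} (hs : 0 < s) :
    HasDerivAt (primitive g) (g s) s :=
  (hasDerivWithinAt_primitive hg hs.le).hasDerivAt (Ici_mem_nhds hs)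

theorem continuousOn_primitive (hg : ContinuousOn g (Ici 0)) :
    ContinuousOn (primitive g) (Ici 0) := fun _ hs =>
  (hasDerivWithinAt_primitive hg hs).continuousWithinAt

theorem hasDerivWithinAt_primitive_Icc (hg : ContinuousOn g (Ici 0)) {b s : ℝ}
    (hs : s ∈ Icc 0 b) : HasDerivWithinAt (primitive g) (g s) (Icc 0 b) s :=
  (hasDerivWithinAt_primitive hg hs.1).mono Icc_subset_Ici_self

theorem derivWithin_primitive (hg : ContinuousOn g (Ici 0)) {b : ℝ} (hb : 0 < b) {s : ℝ}
    (hs : s ∈ Icc 0 b) : derivWithin (primitive g) (Icc 0 b) s = g s :=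
  (hasDerivWithinAt_primitive_Icc hg hs).derivWithin (uniqueDiffOn_Icc hb s hs)

theorem contDiffOn_of_primitive (hg : ContinuousOn g (Ici 0)) {b : ℝ} (hb : 0 < b)
    (hV : ContDiffOn ℝ 2 (primitive g) (Icc 0 b)) : ContDiffOn ℝ 1 g (Icc 0 b) :=
  (hV.derivWithin (uniqueDiffOn_Icc hb) (m := 1) (by norm_num)).congr fun _ hs =>
    (derivWithin_primitive hg hb hs).symm

/-- The second derivative of the primitive at 0 is the one-sided derivative of g, the form in which
its sign is used. -/
theorem hasDerivWithinAt_zero_of_primitive (hg : ContinuousOn g (Ici 0)) {b : ℝ} (hb : 0 < b)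
    (hV : ContDiffOn ℝ 2 (primitive g) (Icc 0 b)) :
    HasDerivWithinAt g (iteratedDerivWithin 2 (primitive g) (Icc 0 b) 0) (Icc 0 b) 0 := by
  have h0 : (0 : ℝ) ∈ Icc 0 b := left_mem_Icc.2 hb.le
  have h1 : iteratedDerivWithin 2 (primitive g) (Icc 0 b) 0 = derivWithin g (Icc 0 b) 0 := by
    rw [iteratedDerivWithin_succ]
    exact derivWithin_congr
      (fun s hs => by rw [iteratedDerivWithin_one, derivWithin_primitive hg hb hs])
      (by rw [iteratedDerivWithin_one, derivWithin_primitive hg hb h0])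
  rw [h1]
  exact ((contDiffOn_of_primitive hg hb hV).differentiableOn one_ne_zero 0 h0).hasDerivWithinAt

/-- Linear bound on `g` and quadratic bound on its primitive. -/
theorem exists_linear_bound (hg : ContinuousOn g (Ici 0)) (hg0 : g 0 = 0) {b : ℝ} (hb : 0 < b)
    (hV : ContDiffOn ℝ 2 (primitive g) (Icc 0 b)) :
    ∃ C > 0, ∀ s ∈ Icc 0 b, |g s| ≤ C * s ∧ |primitive g s| ≤ C * s ^ 2 := by
  have hC1 := contDiffOn_of_primitive hg hb hV
  obtain ⟨C, hC⟩ := isCompact_Icc.exists_bound_of_continuousOn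
    (hC1.continuousOn_derivWithin (uniqueDiffOn_Icc hb) le_rfl)
  have hlin : ∀ s ∈ Icc 0 b, |g s| ≤ (|C| + 1) * s := by
    intro s hs
    have h := (convex_Icc (0 : ℝ) b).norm_image_sub_le_of_norm_derivWithin_le
      (hC1.differentiableOn one_ne_zero) (fun t ht => (hC t ht).trans (le_abs_self C))
      (left_mem_Icc.2 hb.le) hs
    rw [hg0, sub_zero, sub_zero, Real.norm_eq_abs, Real.norm_of_nonneg hs.1] at h
    nlinarith [hs.1]
  refine ⟨|C| + 1, by positivity, fun s hs => ⟨hlin s hs, ?_⟩⟩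
  have h := intervalIntegral.norm_integral_le_of_norm_le_const (a := 0) (b := s)
    (C := (|C| + 1) * s) (f := g) fun t ht => by
      rw [uIoc_of_le hs.1] at ht
      refine (hlin t ⟨ht.1.le, ht.2.trans hs.2⟩).trans ?_
      exact mul_le_mul_of_nonneg_left ht.2 (by positivity)
  rw [sub_zero, abs_of_nonneg hs.1, Real.norm_eq_abs] at h
  rw [primitive]
  nlinarith

/-- Near 0 the slope of g exceeds `κ / 2`, and integrating `κ / 2 * t` gives the constant `κ / 4`.
-/
theorem exists_quadratic_lower (hg : ContinuousOn g (Ici 0)) (hg0 : g 0 = 0) {b κ : ℝ}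
    (hb : 0 < b) (hκ : 0 < κ) (hd : HasDerivWithinAt g κ (Icc 0 b) 0) :
    ∃ δ ∈ Ioc 0 b, ∀ s ∈ Ioc 0 δ, κ / 4 * s ^ 2 ≤ primitive g s := by
  have hslope := hasDerivWithinAt_iff_tendsto_slope.1 hd
  have hev := hslope.eventually_const_lt (show κ / 2 < κ by linarith)
  rw [eventually_nhdsWithin_iff] at hev
  obtain ⟨δ, hδ, hball⟩ := Metric.eventually_nhds_iff.1 hev
  refine ⟨min (δ / 2) b, ⟨lt_min (by linarith) hb, min_le_right _ _⟩, fun s hs => ?_⟩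
  have hsd : s ≤ δ / 2 := hs.2.trans (min_le_left _ _)
  have hsb : s ≤ b := hs.2.trans (min_le_right _ _)
  have hlow : ∀ t ∈ Icc 0 s, κ / 2 * t ≤ g t := by
    intro t ht
    rcases eq_or_lt_of_le ht.1 with h0 | h0
    · rw [← h0, hg0]; simp
    · have h1 := hball (y := t) (by rw [Real.dist_eq, sub_zero, abs_of_pos h0]; linarith [ht.2])
        ⟨⟨ht.1, ht.2.trans hsb⟩, by simpa using h0.ne'⟩
      rw [slope_def_field, hg0, sub_zero, sub_zero, lt_div_iff₀ h0] at h1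
      exact h1.le
  have h1 : ∫ t in (0 : ℝ)..s, κ / 2 * t ≤ ∫ t in (0 : ℝ)..s, g t := by
    refine intervalIntegral.integral_mono_on hs.1.le ?_ ?_ hlow
    · exact (continuous_const.mul continuous_id).intervalIntegrable _ _
    · refine (hg.mono ?_).intervalIntegrable
      rw [uIcc_of_le hs.1.le]
      exact Icc_subset_Ici_self
  rw [intervalIntegral.integral_const_mul, integral_id] at h1
  rw [primitive]
  linarith

theorem exists_primitive_neg (hg : ContinuousOn g (Ici 0)) (hg0 : g 0 = 0) {b κ : ℝ}
    (hb : 0 < b) (hκ : κ < 0) (hd : HasDerivWithinAt g κ (Icc 0 b) 0) :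
    ∃ s ∈ Ioc 0 b, primitive g s < 0 := by
  obtain ⟨δ, hδ, h⟩ := exists_quadratic_lower (g := fun s => -g s) hg.neg (by rw [hg0, neg_zero])
    hb (show 0 < -κ by linarith) hd.neg
  refine ⟨δ, hδ, ?_⟩
  have h1 := h δ (right_mem_Ioc.2 hδ.1)
  rw [primitive, intervalIntegral.integral_neg] at h1
  rw [primitive]
  nlinarith [pow_pos hδ.1 2]

/-! ### First integrals -/

theorem eq_of_hasDerivAt_zero {E : ℝ → ℝ} (hc : ContinuousOn E (Ici 0))
    (hd : ∀ x, 0 < x → HasDerivAt E 0 x) {x : ℝ} (hx : 0 ≤ x) : E x = E 0 := by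
  have hdiff : DifferentiableOn ℝ E (interior (Ici 0)) := by
    rw [interior_Ici]
    exact fun y hy => (hd y hy).differentiableAt.differentiableWithinAt
  refine le_antisymm ?_ ?_
  · refine antitoneOn_of_deriv_nonpos (convex_Ici 0) hc hdiff (fun y hy => ?_) self_mem_Ici hx hx
    rw [interior_Ici] at hy
    exact (hd y hy).deriv.le
  · refine monotoneOn_of_deriv_nonneg (convex_Ici 0) hc hdiff (fun y hy => ?_) self_mem_Ici hx hx
    rw [interior_Ici] at hy
    exact (hd y hy).deriv.ge

/-- Decreasing solutions of `φ'' = g(φ)` vanishing at infinity satisfy `φ' = -√(2 V(φ))`. -/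
theorem energy_identity (hg : ContinuousOn g (Ici 0)) {φ φ' : ℝ → ℝ}
    (hφc : ContinuousOn φ (Ici 0)) (hφ'c : ContinuousOn φ' (Ici 0))
    (hφ : ∀ x, 0 < x → HasDerivAt φ (φ' x) x) (hφ' : ∀ x, 0 < x → HasDerivAt φ' (g (φ x)) x)
    (hpos : ∀ x, 0 ≤ x → 0 < φ x) (hneg : ∀ x, 0 ≤ x → φ' x < 0) (hlim : Tendsto φ atTop (𝓝 0))
    {x : ℝ} (hx : 0 ≤ x) : 0 < primitive g (φ x) ∧ φ' x = -√(2 * primitive g (φ x)) := by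
  -- The mechanical energy of `φ'' = g(φ)`.
  set E : ℝ → ℝ := fun x => φ' x ^ 2 / 2 - primitive g (φ x) with hE
  have hEc : ContinuousOn E (Ici 0) := by
    refine ((hφ'c.pow 2).div_const 2).sub ?_
    exact (continuousOn_primitive hg).comp hφc fun y hy => (hpos y hy).le
  have hEd : ∀ y, 0 < y → HasDerivAt E 0 y := by
    intro y hy
    have h1 := ((hφ' y hy).pow 2).div_const 2
    have h2 := (hasDerivAt_primitive hg (hpos y hy.le)).comp y (hφ y hy)
    refine (h1.sub h2).congr_deriv ?_
    push_cast
    ring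
  have hEconst : ∀ y, 0 ≤ y → φ' y ^ 2 / 2 = E 0 + primitive g (φ y) := fun y hy => by
    have := eq_of_hasDerivAt_zero hEc hEd hy
    rw [← this, hE]; ring
  have hVlim : Tendsto (fun y => primitive g (φ y)) atTop (𝓝 0) := by
    have h0 := continuousOn_primitive hg 0 self_mem_Ici
    rw [ContinuousWithinAt, primitive_zero] at h0
    refine h0.comp (tendsto_nhdsWithin_iff.2 ⟨hlim, ?_⟩)
    filter_upwards [eventually_ge_atTop 0] with y hy using (hpos y hy).le
  have hkin : Tendsto (fun y => φ' y ^ 2 / 2) atTop (𝓝 (E 0)) := by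
    have h1 := hVlim.const_add (E 0)
    rw [add_zero] at h1
    refine h1.congr' ?_
    filter_upwards [eventually_ge_atTop 0] with y hy using (hEconst y hy).symm
  -- `E 0` is the limit of `φ'² / 2`. Were it positive, φ would eventually decrease at speed at
  -- least `k = √(E 0)` and be nonpositive by the time `x₁ + φ x₁ / k`.
  have hE0 : E 0 = 0 := by
    refine le_antisymm (not_lt.1 fun hc => ?_)
      (ge_of_tendsto hkin (Eventually.of_forall fun y => by positivity))
    obtain ⟨x₁, h1⟩ := eventually_atTop.1 ((hkin.eventually_const_lt
      (show E 0 / 2 < E 0 by linarith)).and (eventually_ge_atTop 0))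
    set k := √(E 0) with hk
    have hk0 : 0 < k := Real.sqrt_pos.2 hc
    have hle : ∀ y, x₁ ≤ y → φ' y ≤ -k := by
      intro y hy
      have h2 := (h1 y hy).1
      have h3 := hneg y (h1 y hy).2
      have h4 : k ^ 2 = E 0 := Real.sq_sqrt hc.le
      nlinarith
    have hx₁ : 0 ≤ x₁ := (h1 x₁ le_rfl).2
    set y := x₁ + φ x₁ / k with hy
    have hxy : x₁ ≤ y := by
      have := hpos x₁ hx₁
      have : 0 < φ x₁ / k := by positivity
      linarith
    have hdec := (convex_Ici x₁).image_sub_le_mul_sub_of_deriv_le (f := φ) (C := -k)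
      (hφc.mono (Ici_subset_Ici.2 hx₁)) (by
        rw [interior_Ici]
        exact fun z hz => (hφ z (lt_of_le_of_lt hx₁ hz)).differentiableAt.differentiableWithinAt)
      (fun z hz => by
        rw [interior_Ici] at hz
        rw [(hφ z (lt_of_le_of_lt hx₁ hz)).deriv]
        exact hle z (le_of_lt hz)) x₁ self_mem_Ici y hxy hxy
    have h5 : -k * (y - x₁) = -φ x₁ := by rw [hy]; field_simp; ring
    rw [h5] at hdec
    linarith [hpos y (hx₁.trans hxy)]
  have h1 := hEconst x hx
  rw [hE0, zero_add] at h1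
  have h2 := hneg x hx
  constructor
  · rw [← h1]
    have : φ' x ≠ 0 := h2.ne
    positivity
  · rw [← h1, show 2 * (φ' x ^ 2 / 2) = φ' x ^ 2 by ring, Real.sqrt_sq_eq_abs, abs_of_neg h2,
      neg_neg]

/-! ### The profile of the potential -/

/-- The derivative of the travel time in the variable `u = log (φb / s)`. -/
def timeDensity (g : ℝ → ℝ) (φb u : ℝ) : ℝ :=
  φb * Real.exp (-max u 0) / √(2 * primitive g (φb * Real.exp (-max u 0)))

/-- The position at which the potential reaches `φb * exp (-u)`. -/
def travelTime (g : ℝ → ℝ) (φb u : ℝ) : ℝ := ∫ t in (0 : ℝ)..u, timeDensity g φb t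

variable {φb : ℝ}

theorem mul_exp_neg_max_mem (hφb : 0 < φb) (u : ℝ) : φb * Real.exp (-max u 0) ∈ Ioc 0 φb := by
  refine ⟨by positivity, mul_le_of_le_one_right hφb.le ?_⟩
  rw [Real.exp_le_one_iff]
  linarith [le_max_right u 0]

/-- The cap `max u 0` freezes the density for `u < 0`, so it is continuous and positive on the whole
line while the primitive is sampled only on `(0, φb]`. -/
theorem continuous_timeDensity (hg : ContinuousOn g (Ici 0)) (hφb : 0 < φb)
    (hV : ∀ s ∈ Ioc 0 φb, 0 < primitive g s) : Continuous (timeDensity g φb) := by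
  have h1 : Continuous fun u : ℝ => φb * Real.exp (-max u 0) := by fun_prop
  have h2 : Continuous fun u : ℝ => primitive g (φb * Real.exp (-max u 0)) :=
    (continuousOn_primitive hg).comp_continuous h1 fun u => (mul_exp_neg_max_mem hφb u).1.le
  refine h1.div (by fun_prop) fun u => ?_
  have := hV _ (mul_exp_neg_max_mem hφb u)
  exact (Real.sqrt_pos.2 (by linarith)).ne'

theorem timeDensity_pos (hφb : 0 < φb) (hV : ∀ s ∈ Ioc 0 φb, 0 < primitive g s) (u : ℝ) :
    0 < timeDensity g φb u := by
  have := hV _ (mul_exp_neg_max_mem hφb u)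
  exact div_pos (by positivity) (Real.sqrt_pos.2 (by linarith))

theorem hasDerivAt_travelTime (hg : ContinuousOn g (Ici 0)) (hφb : 0 < φb)
    (hV : ∀ s ∈ Ioc 0 φb, 0 < primitive g s) (u : ℝ) :
    HasDerivAt (travelTime g φb) (timeDensity g φb u) u :=
  ((continuous_timeDensity hg hφb hV).integral_hasStrictDerivAt 0 u).hasDerivAt

theorem strictMono_travelTime (hg : ContinuousOn g (Ici 0)) (hφb : 0 < φb)
    (hV : ∀ s ∈ Ioc 0 φb, 0 < primitive g s) : StrictMono (travelTime g φb) :=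
  strictMono_of_deriv_pos fun u => by
    rw [(hasDerivAt_travelTime hg hφb hV u).deriv]
    exact timeDensity_pos hφb hV u

theorem timeDensity_log {s : ℝ} (hs : s ∈ Ioc 0 φb) :
    timeDensity g φb (Real.log φb - Real.log s) = s / √(2 * primitive g s) := by
  have hφb : 0 < φb := hs.1.trans_le hs.2
  have h1 : 0 ≤ Real.log φb - Real.log s := sub_nonneg.2 (Real.log_le_log hs.1 hs.2)
  have h2 : φb * Real.exp (-max (Real.log φb - Real.log s) 0) = s := by
    rw [max_eq_left h1, neg_sub, Real.exp_sub, Real.exp_log hs.1, Real.exp_log hφb]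
    field_simp
  rw [timeDensity, h2]

/-- The equation `φ' = -√(2 V(φ))` determines the position as a function of the potential. -/
theorem travelTime_log (hg : ContinuousOn g (Ici 0)) (hφb : 0 < φb)
    (hV : ∀ s ∈ Ioc 0 φb, 0 < primitive g s) {φ : ℝ → ℝ} (hφc : ContinuousOn φ (Ici 0))
    (hφ : ∀ x, 0 < x → HasDerivAt φ (-√(2 * primitive g (φ x))) x)
    (hmem : ∀ x, 0 ≤ x → φ x ∈ Ioc 0 φb) (h0 : φ 0 = φb) {x : ℝ} (hx : 0 ≤ x) :
    travelTime g φb (Real.log φb - Real.log (φ x)) = x := by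
  have hc : Continuous (travelTime g φb) := continuous_iff_continuousAt.2 fun u =>
    (hasDerivAt_travelTime hg hφb hV u).continuousAt
  have h := eq_of_hasDerivAt_zero
    (E := fun y => travelTime g φb (Real.log φb - Real.log (φ y)) - y) ?_ ?_ hx
  · simp only [h0, sub_self, travelTime, intervalIntegral.integral_same] at h
    exact sub_eq_zero.1 h
  · refine ContinuousOn.sub (hc.comp_continuousOn ?_) continuousOn_id
    exact continuousOn_const.sub (hφc.log fun y hy => (hmem y hy).1.ne')
  · intro y hy
    have hy' := hmem y hy.le
    have hVy := hV _ hy'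
    have h1 := (hasDerivAt_travelTime hg hφb hV (Real.log φb - Real.log (φ y))).comp y
      (((hφ y hy).log hy'.1.ne').const_sub (Real.log φb))
    refine (h1.sub (hasDerivAt_id y)).congr_deriv ?_
    rw [timeDensity_log hy']
    have h3 : √(2 * primitive g (φ y)) ≠ 0 := (Real.sqrt_pos.2 (by linarith)).ne'
    have h4 := hy'.1.ne'
    field_simp
    ring

/-- The quadratic bound keeps the time density `s / √(2 V(s))` at or above `1 / √(2 C)`: reaching
potential 0 takes infinitely long. -/
theorem surjective_travelTime (hg : ContinuousOn g (Ici 0)) (hφb : 0 < φb)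
    (hV : ∀ s ∈ Ioc 0 φb, 0 < primitive g s) {C : ℝ} (hC : 0 < C)
    (hVC : ∀ s ∈ Icc 0 φb, |primitive g s| ≤ C * s ^ 2) :
    Function.Surjective (travelTime g φb) := by
  set c := 1 / √(2 * C) with hc
  have hc0 : 0 < c := by positivity
  have hlow : ∀ u, c ≤ timeDensity g φb u := by
    intro u
    have hm := mul_exp_neg_max_mem hφb u
    set s := φb * Real.exp (-max u 0) with hs
    have hVs := hV s hm
    have h1 : √(2 * primitive g s) ≤ √(2 * C) * s := by
      rw [Real.sqrt_le_iff]
      refine ⟨by have := hm.1; positivity, ?_⟩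
      rw [mul_pow, Real.sq_sqrt (by positivity)]
      have := (le_abs_self _).trans (hVC s ⟨hm.1.le, hm.2⟩)
      linarith
    rw [timeDensity, ← hs, hc, div_le_div_iff₀ (by positivity) (Real.sqrt_pos.2 (by linarith)),
      one_mul]
    linarith
  have hcont : Continuous (travelTime g φb) := continuous_iff_continuousAt.2 fun u =>
    (hasDerivAt_travelTime hg hφb hV u).continuousAt
  have hmono : Monotone fun u => travelTime g φb u - c * u := by
    refine monotone_of_deriv_nonneg ?_ fun u => ?_
    · exact fun u => ((hasDerivAt_travelTime hg hφb hV u).sub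
        ((hasDerivAt_id u).const_mul c)).differentiableAt
    · have h1 : HasDerivAt (fun u => travelTime g φb u - c * u) (timeDensity g φb u - c * 1) u :=
        (hasDerivAt_travelTime hg hφb hV u).sub ((hasDerivAt_id u).const_mul c)
      rw [h1.deriv]
      linarith [hlow u]
  have h00 : travelTime g φb 0 = 0 := intervalIntegral.integral_same
  refine hcont.surjective ?_ ?_
  · refine tendsto_atTop_mono' _ ?_ (tendsto_id.const_mul_atTop hc0)
    filter_upwards [eventually_ge_atTop 0] with u hu
    have := hmono hu
    simp only [h00] at this
    simp only [id]
    linarith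
  · refine tendsto_atBot_mono' _ ?_ (tendsto_id.const_mul_atBot hc0)
    filter_upwards [eventually_le_atBot 0] with u hu
    have := hmono hu
    simp only [h00] at this
    simp only [id]
    linarith

/-- A decreasing bijection of the line onto `(0, ∞)` solving `φ' = -√(2 V(φ))` on the half line. -/
structure IsPotential (g : ℝ → ℝ) (φb : ℝ) (φ X : ℝ → ℝ) : Prop where
  contDiff : ContDiff ℝ 1 φ
  pos : ∀ x, 0 < φ x
  zero : φ 0 = φb
  deriv_neg : ∀ x, deriv φ x < 0
  deriv_eq : ∀ x, 0 ≤ x → deriv φ x = -√(2 * primitive g (φ x))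
  tendsto : Tendsto φ atTop (𝓝 0)
  inv_contDiff : ∀ s, 0 < s → ContDiffAt ℝ 1 X s
  left_inv : ∀ x, X (φ x) = x
  right_inv : ∀ s, 0 < s → φ (X s) = s

/-- With `s = φb * exp (-u)` the travel time is an increasing C¹ bijection of the line with positive
derivative. Its inverse gives u as a function of x, hence φ, without any Lipschitz theory for `√V`
at 0. -/
theorem exists_isPotential (hg : ContinuousOn g (Ici 0)) (hφb : 0 < φb)
    (hV : ∀ s ∈ Ioc 0 φb, 0 < primitive g s) {C : ℝ} (hC : 0 < C)
    (hVC : ∀ s ∈ Icc 0 φb, |primitive g s| ≤ C * s ^ 2) :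
    ∃ φ X, IsPotential g φb φ X := by
  have hK := strictMono_travelTime hg hφb hV
  have hsurj := surjective_travelTime hg hφb hV hC hVC
  set e := hK.orderIsoOfSurjective _ hsurj with he
  have heK : ∀ u, e u = travelTime g φb u := fun u => rfl
  have hYc : Continuous e.symm := e.symm.continuous
  have hKY : ∀ x, travelTime g φb (e.symm x) = x := fun x => by rw [← heK, e.apply_symm_apply]
  have hYK : ∀ u, e.symm (travelTime g φb u) = u := fun u => by rw [← heK, e.symm_apply_apply]
  have hYd : ∀ x, HasDerivAt e.symm (timeDensity g φb (e.symm x))⁻¹ x := fun x =>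
    HasDerivAt.of_local_left_inverse hYc.continuousAt (hasDerivAt_travelTime hg hφb hV _)
      (timeDensity_pos hφb hV _).ne' (Eventually.of_forall hKY)
  have hkc := continuous_timeDensity hg hφb hV
  have hφd : ∀ x, HasDerivAt (fun x => φb * Real.exp (-e.symm x))
      (φb * (Real.exp (-e.symm x) * -(timeDensity g φb (e.symm x))⁻¹)) x := fun x =>
    ((hYd x).neg.exp).const_mul φb
  have h00 : e.symm 0 = 0 := by
    have := hYK 0
    rwa [show travelTime g φb 0 = 0 from intervalIntegral.integral_same] at this
  have hneg : ∀ x, φb * (Real.exp (-e.symm x) * -(timeDensity g φb (e.symm x))⁻¹) < 0 := fun x => by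
    have h1 := timeDensity_pos hφb hV (e.symm x)
    have h2 : 0 < φb * (Real.exp (-e.symm x) * (timeDensity g φb (e.symm x))⁻¹) := by positivity
    linarith
  refine ⟨fun x => φb * Real.exp (-e.symm x),
    fun s => travelTime g φb (Real.log φb - Real.log s), ?_, fun x => by positivity, ?_,
    fun x => ?_, fun x hx => ?_, ?_, fun s hs => ?_, fun x => ?_, fun s hs => ?_⟩
  · rw [contDiff_one_iff_deriv]
    refine ⟨fun x => (hφd x).differentiableAt, ?_⟩
    rw [funext fun x => (hφd x).deriv]
    have h1 : Continuous fun x => (timeDensity g φb (e.symm x))⁻¹ :=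
      (hkc.comp hYc).inv₀ fun x => (timeDensity_pos hφb hV _).ne'
    fun_prop
  · rw [h00]; simp
  · rw [(hφd x).deriv]; exact hneg x
  · rw [(hφd x).deriv]
    have hY0 : 0 ≤ e.symm x := by
      rw [← h00]; exact e.symm.monotone hx
    have hm := mul_exp_neg_max_mem hφb (e.symm x)
    have hVs := hV _ hm
    rw [timeDensity, max_eq_left hY0] at *
    have h1 : √(2 * primitive g (φb * Real.exp (-e.symm x))) ≠ 0 :=
      (Real.sqrt_pos.2 (by linarith)).ne'
    field_simp
  · have h1 : Tendsto (fun x => Real.exp (-e.symm x)) atTop (𝓝 0) :=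
      Real.tendsto_exp_neg_atTop_nhds_zero.comp e.symm.tendsto_atTop
    simpa using h1.const_mul φb
  · have h1 : ContDiff ℝ 1 (travelTime g φb) := by
      rw [contDiff_one_iff_deriv]
      refine ⟨fun u => (hasDerivAt_travelTime hg hφb hV u).differentiableAt, ?_⟩
      rw [funext fun u => (hasDerivAt_travelTime hg hφb hV u).deriv]
      exact hkc
    exact h1.contDiffAt.comp s (contDiffAt_const.sub (Real.contDiffAt_log.2 hs.ne'))
  · rw [Real.log_mul hφb.ne' (Real.exp_pos _).ne', Real.log_exp]
    rw [show Real.log φb - (Real.log φb + -e.symm x) = e.symm x by ring, hKY]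
  · rw [hYK, neg_sub, Real.exp_sub, Real.exp_log hs, Real.exp_log hφb]
    field_simp

end Primitive

end

section

/-! ### Densities of fixed energy profile solve the Vlasov equation -/

variable {α φb r : ℝ} {fb finf hp hm : Vel → ℝ} {g φ X : ℝ → ℝ}

theorem IsPotential.strictAnti (pot : IsPotential g φb φ X) : StrictAnti φ :=
  strictAnti_of_deriv_neg pot.deriv_neg

theorem IsPotential.hasDerivAt (pot : IsPotential g φb φ X) (x : ℝ) :
    HasDerivAt φ (deriv φ x) x :=
  (pot.contDiff.differentiable one_ne_zero x).hasDerivAt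

theorem IsPotential.image (pot : IsPotential g φb φ X) : φ '' Ioi 0 = Ioo 0 φb := by
  ext s
  constructor
  · rintro ⟨x, hx, rfl⟩
    exact ⟨pot.pos x, by rw [← pot.zero]; exact pot.strictAnti hx⟩
  · rintro ⟨h0, h1⟩
    refine ⟨X s, ?_, pot.right_inv s h0⟩
    rw [← pot.right_inv s h0, ← pot.zero] at h1
    exact pot.strictAnti.lt_iff_gt.1 h1

theorem IsPotential.mem (pot : IsPotential g φb φ X) {x : ℝ} (hx : 0 ≤ x) : φ x ∈ Ioc 0 φb :=
  ⟨pot.pos x, by rw [← pot.zero]; exact pot.strictAnti.antitone hx⟩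

/-- A test function in the potential variable `s = φ(x)`. -/
def potTest (X : ℝ → ℝ) (ψ : ℝ × Vel → ℝ) (p : ℝ × Vel) : ℝ :=
  if 0 < p.1 then ψ (X p.1, p.2) else 0

theorem potTest_apply (pot : IsPotential g φb φ X) (ψ : ℝ × Vel → ℝ) (x : ℝ) (ξ : Vel) :
    potTest X ψ (φ x, ξ) = ψ (x, ξ) := by
  rw [potTest, if_pos (pot.pos x), pot.left_inv]

/-- Small potentials correspond to large x, where `ψ` vanishes, so extending by 0 across `s = 0` is
smooth. -/
theorem contDiff_potTest (pot : IsPotential g φb φ X) {ψ : ℝ × Vel → ℝ} (hψ : ContDiff ℝ 1 ψ)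
    (hψc : HasCompactSupport ψ) : ContDiff ℝ 1 (potTest X ψ) := by
  obtain ⟨A, hA0, hA⟩ := exists_abs_le_of_hasCompactSupport hψc
  rw [contDiff_iff_contDiffAt]
  intro p
  by_cases hp : 0 < p.1
  · have h1 : ContDiffAt ℝ 1 (fun p : ℝ × Vel => ψ (X p.1, p.2)) p :=
      hψ.contDiffAt.comp p (((pot.inv_contDiff p.1 hp).comp p contDiffAt_fst).prodMk
        contDiffAt_snd)
    refine h1.congr_of_eventuallyEq ?_
    filter_upwards [(isOpen_lt continuous_const continuous_fst).mem_nhds hp] with q hq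
    exact if_pos hq
  · refine contDiffAt_const (c := (0 : ℝ)).congr_of_eventuallyEq ?_
    have hlt : p.1 < φ A := lt_of_le_of_lt (not_lt.1 hp) (pot.pos A)
    filter_upwards [(isOpen_lt continuous_fst continuous_const).mem_nhds hlt] with q hq
    by_cases hq0 : 0 < q.1
    · rw [potTest, if_pos hq0]
      refine hA _ ?_
      have h2 : A < X q.1 := by
        have hq' : q.1 < φ A := hq
        rw [← pot.right_inv q.1 hq0] at hq'
        exact pot.strictAnti.lt_iff_gt.1 hq'
      rw [Prod.norm_def]
      exact lt_of_lt_of_le h2 ((le_abs_self _).trans (le_max_left _ _))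
    · rw [potTest, if_neg hq0]

/-- The map `((e, ξ'), v) ↦ (v² / 2 - e, (v, ξ'))`. -/
def shear (p : Vel × ℝ) : ℝ × Vel := (p.2 ^ 2 / 2 - p.1.1, (p.2, p.1.2))

/-- At fixed v the energy variable is only reflected and translated; the rest permutes coordinates.
-/
theorem measurePreserving_shear : MeasurePreserving shear (volume.prod volume) volume := by
  have h1 : MeasurePreserving (fun p : ℝ × Vel => ((p.1, (p.1 ^ 2 / 2 - p.2.1, p.2.2)) : ℝ × Vel))
      (volume.prod volume) (volume.prod volume) := by
    refine MeasurePreserving.skew_product (f := id)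
      (g := fun (v : ℝ) (q : Vel) => ((v ^ 2 / 2 - q.1, q.2) : Vel))
      (MeasurePreserving.id volume) ?_ (Eventually.of_forall fun v => ?_)
    · simp only [Function.uncurry_def]
      fun_prop
    · exact ((Measure.measurePreserving_sub_left (volume : Measure ℝ) (v ^ 2 / 2)).prod
        (MeasurePreserving.id (volume : Measure (ℝ × ℝ)))).map_eq
  have h2 : MeasurePreserving (fun p : ℝ × Vel => ((p.2.1, (p.1, p.2.2)) : ℝ × Vel))
      (volume.prod volume) (volume.prod volume) := by
    have a1 := (measurePreserving_prodAssoc (volume : Measure ℝ) (volume : Measure ℝ)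
      (volume : Measure (ℝ × ℝ)))
    have a2 := (Measure.measurePreserving_swap (μ := (volume : Measure ℝ))
      (ν := (volume : Measure ℝ))).prod (MeasurePreserving.id (volume : Measure (ℝ × ℝ)))
    have a3 := a1.symm
    exact a1.comp (a2.comp a3)
  exact h2.comp (h1.comp Measure.measurePreserving_swap)

theorem measurable_profileDensity_prod (hpm : Measurable hp) (hmm : Measurable hm) :
    Measurable fun p : ℝ × Vel => profileDensity hp hm p.1 p.2 := by
  have hk : Measurable fun p : ℝ × Vel => kin p.1 p.2 := by unfold kin; fun_prop
  exact Measurable.ite (measurableSet_lt measurable_const (by fun_prop)) (hpm.comp hk)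
    (hmm.comp hk)

/-- The fundamental theorem of calculus on a trajectory of energy e parametrized by its velocity.
For `e < 0` the branches join through the turning point `v = 0`, where `a = b`; for `e ≥ 0` they end
at `±u`, where the potential and hence `P` vanish. Only the wall velocities `±w` remain. -/
theorem integral_eq_of_speed {P P' : ℝ → ℝ} (hP : ∀ v, HasDerivAt P (P' v) v)
    (hP'c : Continuous P') {a b e φb : ℝ} (hφb : 0 < φb)
    (hab : e ≤ 0 → a = b) (hP0 : ∀ v, v ^ 2 / 2 - e ≤ 0 → P v = 0) :
    ∫ v, (if 0 < v ^ 2 / 2 - e ∧ v ^ 2 / 2 - e < φb then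
      (if 0 < v then a else b) * P' v else 0) =
      if -φb < e then a * P √(2 * (e + φb)) - b * P (-√(2 * (e + φb))) else 0 := by
  by_cases he : -φb < e
  swap
  · rw [if_neg he]
    refine integral_eq_zero_of_ae (Eventually.of_forall fun v => if_neg fun h => he ?_)
    nlinarith [h.2, sq_nonneg v]
  rw [if_pos he]
  set w := √(2 * (e + φb)) with hw
  have hw0 : 0 < w := Real.sqrt_pos.2 (by linarith)
  have hw2 : w ^ 2 = 2 * (e + φb) := Real.sq_sqrt (by linarith)
  set u := √(2 * e) with hu
  have hu0 : 0 ≤ u := Real.sqrt_nonneg _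
  have huw : u < w := (Real.sqrt_lt_sqrt_iff_of_pos (by linarith)).2 (by linarith)
  have hFTC : ∀ c d : ℝ, ∫ v in c..d, P' v = P d - P c := fun c d =>
    intervalIntegral.integral_eq_sub_of_hasDerivAt (fun v _ => hP v) (hP'c.intervalIntegrable _ _)
  rcases lt_or_ge e 0 with hneg | hnn
  · have hE := hab hneg.le
    have hfun : (fun v : ℝ => if 0 < v ^ 2 / 2 - e ∧ v ^ 2 / 2 - e < φb then
      (if 0 < v then a else b) * P' v else 0) = (Ioo (-w) w).indicator fun v => a * P' v := by
      funext v
      by_cases hv : v ∈ Ioo (-w) w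
      · rw [indicator_of_mem hv, if_pos, ← hE, ite_self]
        have := sq_lt_sq' hv.1 hv.2
        exact ⟨by nlinarith [sq_nonneg v], by linarith⟩
      · rw [indicator_of_notMem hv, if_neg]
        rintro ⟨-, h2⟩
        exact hv (abs_lt.1 (abs_lt_of_sq_lt_sq (by linarith) hw0.le))
    rw [hfun, integral_indicator measurableSet_Ioo, ← integral_Ioc_eq_integral_Ioo,
      ← intervalIntegral.integral_of_le (by linarith), intervalIntegral.integral_const_mul, hFTC,
      ← hE]
    ring
  · have hu2 : u ^ 2 = 2 * e := Real.sq_sqrt (by linarith)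
    have hfun : (fun v : ℝ => if 0 < v ^ 2 / 2 - e ∧ v ^ 2 / 2 - e < φb then
      (if 0 < v then a else b) * P' v else 0) = fun v => (Ioo u w).indicator (fun v => a * P' v) v +
        (Ioo (-w) (-u)).indicator (fun v => b * P' v) v := by
      funext v
      by_cases hv : 0 < v
      · have h2 : v ∉ Ioo (-w) (-u) := fun h => by linarith [h.2]
        rw [indicator_of_notMem h2, add_zero]
        by_cases h3 : v ∈ Ioo u w
        · rw [indicator_of_mem h3, if_pos, if_pos hv]
          constructor <;> nlinarith [h3.1, h3.2]
        · rw [indicator_of_notMem h3, if_neg]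
          rintro ⟨h4, h5⟩
          refine h3 ⟨?_, ?_⟩
          · exact lt_of_pow_lt_pow_left₀ 2 hv.le (by linarith)
          · exact lt_of_pow_lt_pow_left₀ 2 hw0.le (by linarith)
      · have h2 : v ∉ Ioo u w := fun h => by linarith [h.1]
        rw [indicator_of_notMem h2, zero_add]
        have hv' : 0 ≤ -v := by linarith
        by_cases h3 : v ∈ Ioo (-w) (-u)
        · rw [indicator_of_mem h3, if_pos, if_neg hv]
          constructor <;> nlinarith [h3.1, h3.2]
        · rw [indicator_of_notMem h3, if_neg]
          rintro ⟨h4, h5⟩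
          have a1 : u < -v := lt_of_pow_lt_pow_left₀ 2 hv' (by nlinarith)
          have a2 : -v < w := lt_of_pow_lt_pow_left₀ 2 hw0.le (by nlinarith)
          exact h3 ⟨by linarith, by linarith⟩
    have hfin_int : ∀ (c d k : ℝ), Integrable ((Ioo c d).indicator fun v => k * P' v) := fun c d k =>
      (integrable_indicator_iff measurableSet_Ioo).2
        ((continuous_const.mul hP'c).integrableOn_Icc.mono_set Ioo_subset_Icc_self)
    rw [hfun, integral_add (hfin_int _ _ _) (hfin_int _ _ _), integral_indicator measurableSet_Ioo,
      integral_indicator measurableSet_Ioo, ← integral_Ioc_eq_integral_Ioo,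
      ← integral_Ioc_eq_integral_Ioo, ← intervalIntegral.integral_of_le huw.le,
      ← intervalIntegral.integral_of_le (by linarith), intervalIntegral.integral_const_mul,
      intervalIntegral.integral_const_mul, hFTC, hFTC, hP0 u (by linarith),
      hP0 (-u) (by rw [neg_sq]; linarith)]
    ring

/-- The density with the energy profiles of the data is a weak solution of the Vlasov equation. -/
theorem IsEnergyProfile.vlasov (hprof : IsEnergyProfile α φb r fb finf hp hm) (hφb : 0 < φb)
    (pot : IsPotential g φb φ X)
    (hloc : LocallyIntegrableOn (fun p : ℝ × Vel => profileDensity hp hm (φ p.1) p.2)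
      (Ici 0 ×ˢ univ) volume) {ψ : ℝ × Vel → ℝ} (hψ : IsTest α ψ) :
    (∫ p in (Ioi 0 ×ˢ univ : Set (ℝ × Vel)), profileDensity hp hm (φ p.1) p.2 *
        (p.2.1 * fderiv ℝ ψ p (1, 0) + deriv φ p.1 * fderiv ℝ ψ p (0, (1, 0))))
      + (∫ ξ in posVel, fb ξ * (ξ.1 * ψ (0, ξ))) = 0 := by
  have hψ1 := contDiff_potTest pot hψ.contDiff hψ.compact
  have hpm := hprof.reg_p.meas
  have hmm := hprof.reg_m.meas
  set Ψ := potTest X ψ with hΨ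
  -- In the variables `(s, ξ)` the characteristics satisfy `ds = v dv`, and `D` is the derivative
  -- along them with v as parameter; the transport operator is `φ'` times it.
  set D : ℝ × Vel → ℝ := fun p => fderiv ℝ Ψ p (p.2.1, (1, 0)) with hD
  have hDc : Continuous D := by
    have h1 : Continuous (fderiv ℝ Ψ) := hψ1.continuous_fderiv one_ne_zero
    exact h1.clm_apply (by fun_prop)
  have hDeq : ∀ p, D p = p.2.1 * fderiv ℝ Ψ p (1, 0) + fderiv ℝ Ψ p (0, (1, 0)) := by
    intro p
    have : ((p.2.1, ((1 : ℝ), (0 : ℝ × ℝ))) : ℝ × Vel) =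
        p.2.1 • ((1, 0) : ℝ × Vel) + (0, (1, 0)) := by
      ext <;> simp
    rw [hD]
    simp only
    rw [this, map_add, map_smul, smul_eq_mul]
  have hψd := hψ.contDiff.differentiable one_ne_zero
  have hΨd := hψ1.differentiable one_ne_zero
  have htr : ∀ p : ℝ × Vel, p.2.1 * fderiv ℝ ψ p (1, 0) + deriv φ p.1 * fderiv ℝ ψ p (0, (1, 0)) =
      deriv φ p.1 * D (φ p.1, p.2) := by
    intro p
    have e1 : HasDerivAt (fun y => ψ (y, p.2)) (fderiv ℝ Ψ (φ p.1, p.2) (1, 0) * deriv φ p.1)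
        p.1 := by
      have h1 := HasDerivAt.comp p.1 (h₂ := fun s => Ψ (s, p.2)) (h := φ)
        (hasDerivAt_fst_of_differentiableAt (hΨd (φ p.1, p.2))) (pot.hasDerivAt p.1)
      refine h1.congr_of_eventuallyEq (Eventually.of_forall fun y => ?_)
      exact (potTest_apply pot ψ y p.2).symm
    have e2 : HasDerivAt (fun w => ψ (p.1, (w, p.2.2))) (fderiv ℝ Ψ (φ p.1, p.2) (0, (1, 0)))
        p.2.1 := by
      refine (hasDerivAt_vel_of_differentiableAt (hΨd (φ p.1, p.2))).congr_of_eventuallyEq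
        (Eventually.of_forall fun w => ?_)
      exact (potTest_apply pot ψ p.1 (w, p.2.2)).symm
    rw [(hasDerivAt_fst_of_differentiableAt (hψd p)).unique e1,
      (hasDerivAt_vel_of_differentiableAt (hψd p)).unique e2, hDeq]
    ring
  -- The sign comes from `φ' = -|φ'|`, since the substitution uses `|φ'|`.
  set N : ℝ × Vel → ℝ := fun p => -(profileDensity hp hm p.1 p.2 * D p) with hN
  have hNm : Measurable N :=
    ((measurable_profileDensity_prod hpm hmm).mul hDc.measurable).neg
  have hvol : ∀ S : Set ℝ, (volume.restrict (S ×ˢ univ) : Measure (ℝ × Vel)) =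
      (volume.restrict S).prod volume := fun S => by
    rw [Measure.volume_eq_prod, ← Measure.prod_restrict, Measure.restrict_univ]
  -- the substitution `s = φ(x)`
  have hmp1 := measurePreserving_withDensity_abs_deriv (S := Ioi 0) (f := φ) (f' := deriv φ)
    measurableSet_Ioi pot.contDiff.continuous.measurable
    (fun x _ => (pot.hasDerivAt x).hasDerivWithinAt) pot.strictAnti.injective.injOn
  rw [pot.image] at hmp1
  have hderm : Measurable fun x => ENNReal.ofReal |deriv φ x| :=
    (continuous_abs.comp pot.contDiff.continuous_deriv_one).measurable.ennreal_ofReal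
  have hmp2 := hmp1.prod (MeasurePreserving.id (volume : Measure Vel))
  rw [prod_withDensity_left hderm] at hmp2
  have hderm' : Measurable fun z : ℝ × Vel => ENNReal.ofReal |deriv φ z.1| :=
    hderm.comp measurable_fst
  have hFeq : ∀ p : ℝ × Vel, profileDensity hp hm (φ p.1) p.2 *
      (p.2.1 * fderiv ℝ ψ p (1, 0) + deriv φ p.1 * fderiv ℝ ψ p (0, (1, 0))) =
      (ENNReal.ofReal |deriv φ p.1|).toReal • N (Prod.map φ id p) := by
    intro p
    rw [htr, ENNReal.toReal_ofReal (abs_nonneg _), abs_of_neg (pot.deriv_neg p.1), hN]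
    simp only [smul_eq_mul, Prod.map, id]
    ring
  have hint0 : Integrable (fun p : ℝ × Vel => (ENNReal.ofReal |deriv φ p.1|).toReal •
      N (Prod.map φ id p)) ((volume.restrict (Ioi 0)).prod volume) := by
    have hkc : Continuous fun p : ℝ × Vel => p.2.1 * fderiv ℝ ψ p (1, 0) +
        deriv φ p.1 * fderiv ℝ ψ p (0, (1, 0)) := by
      have h1 : Continuous (fderiv ℝ ψ) := hψ.contDiff.continuous_fderiv one_ne_zero
      have h2 := pot.contDiff.continuous_deriv_one
      fun_prop
    have hks : HasCompactSupport fun p : ℝ × Vel => p.2.1 * fderiv ℝ ψ p (1, 0) +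
        deriv φ p.1 * fderiv ℝ ψ p (0, (1, 0)) := by
      refine hψ.compact.fderiv (𝕜 := ℝ) |>.mono' fun p hp => ?_
      by_contra hcon
      have h0 : fderiv ℝ ψ p = 0 := image_eq_zero_of_notMem_tsupport hcon
      exact hp (by simp [h0])
    have := (integrableOn_mul_of_hasCompactSupport (isClosed_Ici.prod isClosed_univ) hloc hkc
      hks).mono_set (prod_mono_left (Ioi_subset_Ici_self (a := (0 : ℝ))) (t := univ))
    rw [IntegrableOn, hvol] at this
    exact this.congr (Eventually.of_forall hFeq)
  have hint1 : Integrable N ((volume.restrict (Ioo 0 φb)).prod volume) := by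
    rw [← hmp2.integrable_comp hNm.aestronglyMeasurable,
      integrable_withDensity_iff_integrable_smul' hderm'
      (Eventually.of_forall fun _ => ENNReal.ofReal_lt_top)]
    exact hint0
  have hI1 : ∫ p in (Ioi 0 ×ˢ univ : Set (ℝ × Vel)), profileDensity hp hm (φ p.1) p.2 *
      (p.2.1 * fderiv ℝ ψ p (1, 0) + deriv φ p.1 * fderiv ℝ ψ p (0, (1, 0))) =
      ∫ p in (Ioo 0 φb ×ˢ univ : Set (ℝ × Vel)), N p := by
    rw [hvol, hvol, ← hmp2.map_eq, integral_map hmp2.measurable.aemeasurable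
      hNm.aestronglyMeasurable, integral_withDensity_eq_integral_toReal_smul hderm'
      (Eventually.of_forall fun _ => ENNReal.ofReal_lt_top)]
    exact integral_congr_ae (Eventually.of_forall hFeq)
  -- the shear to energy variables
  have hSm : MeasurableSet (Ioo 0 φb ×ˢ univ : Set (ℝ × Vel)) :=
    measurableSet_Ioo.prod MeasurableSet.univ
  rw [← hvol, ← IntegrableOn, ← integrable_indicator_iff hSm] at hint1
  have hNim := hNm.indicator hSm
  have hint2 := measurePreserving_shear.integrable_comp_of_integrable hint1
  have hI2 : ∫ p in (Ioo 0 φb ×ˢ univ : Set (ℝ × Vel)), N p =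
      ∫ q : Vel, ∫ v : ℝ, (Ioo 0 φb ×ˢ univ : Set (ℝ × Vel)).indicator N (shear (q, v)) := by
    rw [← integral_indicator hSm, ← measurePreserving_shear.map_eq,
      integral_map measurePreserving_shear.measurable.aemeasurable hNim.aestronglyMeasurable]
    exact integral_prod _ hint2
  have hinner : ∀ q : Vel, ∫ v : ℝ, (Ioo 0 φb ×ˢ univ : Set (ℝ × Vel)).indicator N (shear (q, v)) =
      -(energyGT (-φb)).indicator
        (fun q => (hp q - α * hm q) * ψ (0, (√(2 * (q.1 + φb)), q.2))) q := by
    intro q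
    set P : ℝ → ℝ := fun v => Ψ (v ^ 2 / 2 - q.1, (v, q.2)) with hP
    have hPd : ∀ v, HasDerivAt P (D (v ^ 2 / 2 - q.1, (v, q.2))) v := fun v =>
      HasFDerivAt.comp_hasDerivAt v
        (f := fun v : ℝ => ((v ^ 2 / 2 - q.1, (v, q.2)) : ℝ × Vel)) (f' := (v, (1, 0)))
        (hΨd _).hasFDerivAt ((hasDerivAt_half_sq_sub q.1 v).prodMk ((hasDerivAt_id v).prodMk
          (hasDerivAt_const v q.2)))
    have hw := integral_eq_of_speed hPd (hDc.comp (by fun_prop)) (a := hp q) (b := hm q)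
      (e := q.1) hφb (hprof.eq_neg q) fun v hv => if_neg (not_lt.2 hv)
    have hfun : ∀ v : ℝ, (Ioo 0 φb ×ˢ univ : Set (ℝ × Vel)).indicator N (shear (q, v)) =
        -(if 0 < v ^ 2 / 2 - q.1 ∧ v ^ 2 / 2 - q.1 < φb then
          (if 0 < v then hp q else hm q) * D (v ^ 2 / 2 - q.1, (v, q.2)) else 0) := by
      intro v
      have hq : kin (v ^ 2 / 2 - q.1) (v, q.2) = q := by
        ext <;> simp [kin]
      by_cases hc : 0 < v ^ 2 / 2 - q.1 ∧ v ^ 2 / 2 - q.1 < φb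
      · rw [if_pos hc, indicator_of_mem (show shear (q, v) ∈ (Ioo 0 φb ×ˢ univ : Set (ℝ × Vel))
          from ⟨hc, mem_univ _⟩), hN]
        simp only [shear, profileDensity, hq]
      · rw [if_neg hc, indicator_of_notMem (fun h => hc h.1), neg_zero]
    simp only [hfun]
    rw [integral_neg, hw]
    by_cases hq : -φb < q.1
    · rw [if_pos hq, indicator_of_mem (show q ∈ energyGT (-φb) from hq)]
      have hw2 : √(2 * (q.1 + φb)) ^ 2 / 2 - q.1 = φb := by
        rw [Real.sq_sqrt (by linarith)]; ring
      have hPw : ∀ v : ℝ, v ^ 2 / 2 - q.1 = φb → P v = ψ (0, (v, q.2)) := fun v hv => by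
        rw [hP]
        simp only
        rw [hv, ← pot.zero]
        exact potTest_apply pot ψ 0 _
      -- The reflection condition on `ψ` merges the two wall values into `hp - α hm`, which is `fb`.
      rw [hPw _ hw2, hPw _ (by rw [neg_sq, hw2]), ← hψ.bdry (√(2 * (q.1 + φb)), q.2)
        (Real.sqrt_pos.2 (by linarith))]
      ring
    · rw [if_neg hq, indicator_of_notMem (show q ∉ energyGT (-φb) from hq)]
  have hbdry : ∫ ξ in posVel, fb ξ * (ξ.1 * ψ (0, ξ)) = ∫ q : Vel, (energyGT (-φb)).indicator
      (fun q => (hp q - α * hm q) * ψ (0, (√(2 * (q.1 + φb)), q.2))) q := by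
    have hψm := hψ.contDiff.continuous.measurable
    rw [integral_indicator (measurableSet_energyGT _), ← integral_mul_comp_kin φb (by fun_prop)]
    refine integral_congr_ae ?_
    filter_upwards [hprof.fb_eq, ae_restrict_mem measurableSet_posVel] with ξ h1 h2
    rw [h1, sqrt_kin h2]
    have : ((ξ.1, (kin φb ξ).2) : Vel) = ξ := rfl
    rw [this]
    ring
  rw [hI1, hI2, hbdry]
  simp only [hinner]
  rw [integral_neg]
  ring

end

section

/-! ### Existence and uniqueness of solutions -/

variable {ne : ℝ → ℝ} {α φb r : ℝ} {fb finf hp hm : Vel → ℝ} {φ X : ℝ → ℝ} {f : ℝ → Vel → ℝ}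

/-- The charge density as a function of the potential. -/
def charge (ne : ℝ → ℝ) (α φb : ℝ) (fb finf : Vel → ℝ) (s : ℝ) : ℝ :=
  rhoPlus α φb fb finf s - ne s

theorem dx_two {φ : ℝ → ℝ} {d x : ℝ} (hx : 0 ≤ x) (h : HasDerivWithinAt (dx 1 φ) d (Ici 0) x) :
    dx 2 φ x = d := by
  rw [dx, iteratedDerivWithin_succ]
  exact h.derivWithin (uniqueDiffOn_Ici 0 x hx)

theorem contDiffOn_two_of_deriv {φ φ' φ'' : ℝ → ℝ} (h1 : ∀ x, 0 < x → HasDerivAt φ (φ' x) x)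
    (h2 : ∀ x, 0 < x → HasDerivAt φ' (φ'' x) x) (h3 : ContinuousOn φ'' (Ioi 0)) :
    ContDiffOn ℝ 2 φ (Ioi 0) := by
  have h4 : ContDiffOn ℝ 1 φ' (Ioi 0) := by
    rw [show (1 : WithTop ℕ∞) = 0 + 1 by norm_num, contDiffOn_succ_iff_deriv_of_isOpen isOpen_Ioi]
    refine ⟨fun x hx => (h2 x hx).differentiableAt.differentiableWithinAt, by simp, ?_⟩
    rw [contDiffOn_zero]
    exact h3.congr fun x hx => (h2 x hx).deriv
  rw [show (2 : WithTop ℕ∞) = 1 + 1 by norm_num, contDiffOn_succ_iff_deriv_of_isOpen isOpen_Ioi]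
  exact ⟨fun x hx => (h1 x hx).differentiableAt.differentiableWithinAt, by simp,
    h4.congr fun x hx => (h1 x hx).deriv⟩

theorem IsPotential.hasDerivAt_deriv {g : ℝ → ℝ} (hg : ContinuousOn g (Ici 0))
    (pot : IsPotential g φb φ X) (hV : ∀ s ∈ Ioc 0 φb, 0 < primitive g s) {x : ℝ} (hx : 0 < x) :
    HasDerivAt (deriv φ) (g (φ x)) x := by
  have hVx := hV _ (pot.mem hx.le)
  have h1 := (((hasDerivAt_primitive hg (pot.pos x)).comp x (pot.hasDerivAt x)).const_mul 2).sqrt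
    (show (2 : ℝ) * primitive g (φ x) ≠ 0 by linarith)
  have h2 : HasDerivAt (deriv φ)
      (-(2 * (g (φ x) * deriv φ x) / (2 * √(2 * primitive g (φ x))))) x := by
    refine h1.neg.congr_of_eventuallyEq ?_
    filter_upwards [Ioi_mem_nhds hx] with y hy using pot.deriv_eq y (le_of_lt hy)
  refine h2.congr_deriv ?_
  rw [pot.deriv_eq x hx.le]
  have h3 : √(2 * primitive g (φ x)) ≠ 0 := (Real.sqrt_pos.2 (by linarith)).ne'
  field_simp

theorem IsEnergyProfile.nonneg (hprof : IsEnergyProfile α φb r fb finf hp hm) (s : ℝ) (ξ : Vel) :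
    0 ≤ profileDensity hp hm s ξ := by
  rw [profileDensity]
  split_ifs
  · exact hprof.nonneg_p _
  · exact hprof.nonneg_m _

/-- The mass at x is `ρᵢ⁺(φ(x))`, continuous in x, so the density is integrable on bounded slabs. -/
theorem IsEnergyProfile.locallyIntegrableOn (hprof : IsEnergyProfile α φb r fb finf hp hm)
    (hα : α < 1) (hr : 2 < r) (hfinf : Integrable finf) (hφc : Continuous φ)
    (hφ0 : ∀ x, 0 ≤ φ x) :
    LocallyIntegrableOn (fun p : ℝ × Vel => profileDensity hp hm (φ p.1) p.2)
      (Ici 0 ×ˢ univ) volume := by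
  have hmeas : Measurable fun p : ℝ × Vel => profileDensity hp hm (φ p.1) p.2 :=
    (measurable_profileDensity_prod hprof.reg_p.meas hprof.reg_m.meas).comp
      ((hφc.measurable.comp measurable_fst).prodMk measurable_snd)
  intro p _
  refine ⟨Icc (p.1 - 1) (p.1 + 1) ×ˢ univ, nhdsWithin_le_nhds ?_, ?_⟩
  · refine prod_mem_nhds (Icc_mem_nhds (by linarith) (by linarith)) univ_mem
  · rw [IntegrableOn, Measure.volume_eq_prod, ← Measure.prod_restrict, Measure.restrict_univ,
      integrable_prod_iff hmeas.aestronglyMeasurable]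
    refine ⟨Eventually.of_forall fun x => hprof.integrable hr (hφ0 x), ?_⟩
    have hc : Continuous fun x => rhoPlus α φb fb finf (φ x) :=
      (hprof.continuousOn_rhoPlus hα hr hfinf).comp_continuous hφc hφ0
    refine (hc.integrableOn_Icc (a := p.1 - 1) (b := p.1 + 1)).congr
      (Eventually.of_forall fun x => ?_)
    simp only
    rw [hprof.rhoPlus_eq hα hr hfinf (hφ0 x)]
    exact integral_congr_ae (Eventually.of_forall fun ξ =>
      (Real.norm_of_nonneg (hprof.nonneg _ _)).symm)

theorem continuousOn_charge (hprof : IsEnergyProfile α φb r fb finf hp hm)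
    (hα : α < 1) (hr : 2 < r) (hfinf : Integrable finf) (hne : Continuous ne) :
    ContinuousOn (charge ne α φb fb finf) (Ici 0) :=
  (hprof.continuousOn_rhoPlus hα hr hfinf).sub hne.continuousOn

theorem distL1_congr_right {u v w : Vel → ℝ} (h : v =ᵐ[volume] w) : distL1 u v = distL1 u w := by
  refine integral_congr_ae ?_
  filter_upwards [h] with ξ hξ
  rw [hξ]

/-- The density with the energy profiles of the data in the potential well is a solution. -/
theorem IsPotential.isSolution (pot : IsPotential (charge ne α φb fb finf) φb φ X)
    (hprof : IsEnergyProfile α φb r fb finf hp hm) (hα : α < 1) (hφb : 0 < φb) (hr : 2 < r)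
    (hfinf : Integrable finf) (hne : Continuous ne)
    (hV : ∀ s ∈ Ioc 0 φb, 0 < primitive (charge ne α φb fb finf) s) :
    IsSolution ne α φb fb finf (fun x => profileDensity hp hm (φ x)) φ := by
  have hg := continuousOn_charge hprof hα hr hfinf hne
  have hφc := pot.contDiff.continuous
  have hφ0 : ∀ x, 0 ≤ φ x := fun x => (pot.pos x).le
  have hdx : ∀ x, 0 ≤ x → dx 1 φ x = deriv φ x := fun x hx => by
    rw [dx_one]
    exact (pot.hasDerivAt x).differentiableAt.derivWithin (uniqueDiffOn_Ici 0 x hx)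
  have hloc := hprof.locallyIntegrableOn hα hr hfinf hφc hφ0
  have hd2 : ∀ x, 0 < x → HasDerivAt (deriv φ) (charge ne α φb fb finf (φ x)) x := fun x hx =>
    pot.hasDerivAt_deriv hg hV hx
  refine ⟨hloc, fun x _ => hprof.integrable hr (hφ0 x), fun x₀ _ => ?_, pot.contDiff.contDiffOn,
    ?_, fun x _ => Eventually.of_forall fun ξ => hprof.nonneg _ _, Or.inr fun x hx => ?_,
    fun ψ hψ => ?_, ?_, fun x hx => ?_, pot.zero, pot.tendsto⟩
  · refine (hprof.tendsto_distL1 hr (hφ0 x₀)).comp (tendsto_nhdsWithin_iff.2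
      ⟨hφc.continuousAt.continuousWithinAt, Eventually.of_forall hφ0⟩)
  · refine contDiffOn_two_of_deriv (fun x _ => pot.hasDerivAt x) hd2 ?_
    exact hg.comp hφc.continuousOn fun x _ => hφ0 x
  · rw [hdx x hx]; exact pot.deriv_neg x
  · refine Eq.trans ?_ (hprof.vlasov hφb pot hloc hψ)
    congr 1
    refine setIntegral_congr_fun (measurableSet_Ioi.prod MeasurableSet.univ) fun p hp => ?_
    simp only [hdx p.1 (le_of_lt (mem_prod.1 hp).1)]
  · have h1 := (hprof.tendsto_distL1 hr le_rfl).comp (tendsto_nhdsWithin_iff.2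
      ⟨pot.tendsto, Eventually.of_forall hφ0⟩)
    refine h1.congr fun x => ?_
    exact (distL1_congr_right hprof.finf_ae_eq).symm
  · rw [dx_two (d := charge ne α φb fb finf (φ x)) hx.le, charge,
      hprof.rhoPlus_eq hα hr hfinf (hφ0 x)]
    refine ((hd2 x hx).congr_of_eventuallyEq ?_).hasDerivWithinAt
    filter_upwards [Ioi_mem_nhds hx] with y hy using hdx y (le_of_lt hy)

theorem IsSolution.hasDerivAt_dx_one (sol : IsSolution ne α φb fb finf f φ) {x : ℝ}
    (hx : 0 < x) : HasDerivAt (dx 1 φ) (dx 2 φ x) x := by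
  have h1 : ContDiffOn ℝ 1 (deriv φ) (Ioi 0) :=
    ((contDiffOn_succ_iff_deriv_of_isOpen isOpen_Ioi).1
      (show ContDiffOn ℝ (1 + 1) φ (Ioi 0) by
        rw [show (1 + 1 : WithTop ℕ∞) = 2 by norm_num]; exact sol.phi_C2)).2.2
  have h2 : DifferentiableAt ℝ (deriv φ) x :=
    (h1.differentiableOn one_ne_zero x hx).differentiableAt (Ioi_mem_nhds hx)
  have h3 : dx 1 φ =ᶠ[𝓝 x] deriv φ := by
    filter_upwards [Ioi_mem_nhds hx] with y hy
    exact (hasDerivAt_dx sol.phi_C1 hy).deriv.symm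
  have h4 : HasDerivAt (dx 1 φ) (deriv (deriv φ) x) x :=
    h2.hasDerivAt.congr_of_eventuallyEq h3
  rwa [dx_two hx.le h4.hasDerivWithinAt]

theorem IsSolution.dx_two_eq (sol : IsSolution ne α φb fb finf f φ)
    (hprof : IsEnergyProfile α φb r fb finf hp hm) (hα : α < 1) (hφb : 0 < φb) (hr : 2 < r)
    (hfinf : Integrable finf) {x : ℝ} (hx : 0 < x) :
    dx 2 φ x = charge ne α φb fb finf (φ x) := by
  rw [sol.poisson x hx, charge, hprof.rhoPlus_eq hα hr hfinf (sol.pos hφb hx.le).le,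
    integral_congr_ae (sol.ae_eq_profileDensity hφb hα hr hprof hfinf hx.le)]

theorem IsSolution.energy (sol : IsSolution ne α φb fb finf f φ)
    (hprof : IsEnergyProfile α φb r fb finf hp hm) (hα : α < 1) (hφb : 0 < φb) (hr : 2 < r)
    (hfinf : Integrable finf) (hne : Continuous ne) {x : ℝ} (hx : 0 ≤ x) :
    0 < primitive (charge ne α φb fb finf) (φ x) ∧
      dx 1 φ x = -√(2 * primitive (charge ne α φb fb finf) (φ x)) := by
  refine energy_identity (continuousOn_charge hprof hα hr hfinf hne) sol.phi_C1.continuousOn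
    (continuousOn_dx sol.phi_C1) (fun y hy => hasDerivAt_dx sol.phi_C1 hy) (fun y hy => ?_)
    (fun y hy => sol.pos hφb hy) (sol.dx_neg hφb) sol.phi_infty hx
  rw [← sol.dx_two_eq hprof hα hφb hr hfinf hy]
  exact sol.hasDerivAt_dx_one hy

/-- The potential takes every value in `(0, φb]`, and the energy identity gives positivity at each
of them. This is the necessity half of all four cases. -/
theorem IsSolution.primitive_pos (sol : IsSolution ne α φb fb finf f φ)
    (hprof : IsEnergyProfile α φb r fb finf hp hm) (hα : α < 1) (hφb : 0 < φb) (hr : 2 < r)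
    (hfinf : Integrable finf) (hne : Continuous ne) :
    ∀ s ∈ Ioc 0 φb, 0 < primitive (charge ne α φb fb finf) s := by
  intro s hs
  obtain ⟨y, hy, hy0⟩ := ((sol.phi_infty.eventually_lt_const hs.1).and
    (eventually_ge_atTop 0)).exists
  have hmem : s ∈ Icc (φ y) (φ 0) := ⟨hy.le, by rw [sol.phi_zero]; exact hs.2⟩
  obtain ⟨x, hx, rfl⟩ := intermediate_value_Icc' hy0
    (sol.phi_C1.continuousOn.mono Icc_subset_Ici_self) hmem
  exact (sol.energy hprof hα hφb hr hfinf hne hx.1).1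

theorem IsSolution.travelTime_eq (sol : IsSolution ne α φb fb finf f φ)
    (hprof : IsEnergyProfile α φb r fb finf hp hm) (hα : α < 1) (hφb : 0 < φb) (hr : 2 < r)
    (hfinf : Integrable finf) (hne : Continuous ne) {x : ℝ} (hx : 0 ≤ x) :
    travelTime (charge ne α φb fb finf) φb (Real.log φb - Real.log (φ x)) = x := by
  refine travelTime_log (continuousOn_charge hprof hα hr hfinf hne) hφb
    (sol.primitive_pos hprof hα hφb hr hfinf hne) sol.phi_C1.continuousOn (fun y hy => ?_)
    (fun y hy => ⟨sol.pos hφb hy, sol.le hφb hy⟩) sol.phi_zero hx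
  rw [← (sol.energy hprof hα hφb hr hfinf hne hy.le).2]
  exact hasDerivAt_dx sol.phi_C1 hy

/-- Both potentials are recovered from x by inverting the same strictly increasing travel time, and
a potential determines its density. -/
theorem IsSolution.unique (sol : IsSolution ne α φb fb finf f φ) {f' : ℝ → Vel → ℝ} {φ' : ℝ → ℝ}
    (sol' : IsSolution ne α φb fb finf f' φ')
    (hprof : IsEnergyProfile α φb r fb finf hp hm) (hα : α < 1) (hφb : 0 < φb) (hr : 2 < r)
    (hfinf : Integrable finf) (hne : Continuous ne) :
    (∀ x, 0 ≤ x → f x =ᵐ[volume] f' x) ∧ EqOn φ φ' (Ici 0) := by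
  have heq : EqOn φ φ' (Ici 0) := by
    intro x hx
    have h1 := sol.travelTime_eq hprof hα hφb hr hfinf hne hx
    have h2 := sol'.travelTime_eq hprof hα hφb hr hfinf hne hx
    have h3 := (strictMono_travelTime (continuousOn_charge hprof hα hr hfinf hne) hφb
      (sol.primitive_pos hprof hα hφb hr hfinf hne)).injective (h1.trans h2.symm)
    exact Real.log_injOn_pos (sol.pos hφb hx) (sol'.pos hφb hx) (by linarith)
  refine ⟨fun x hx => ?_, heq⟩
  have h1 := sol.ae_eq_profileDensity hφb hα hr hprof hfinf hx
  have h2 := sol'.ae_eq_profileDensity hφb hα hr hprof hfinf hx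
  rw [← heq hx] at h2
  exact h1.trans h2.symm

/-! ### Exponential decay and the threshold `sup B⁺` -/

/-- Exponential decay in a nondegenerate potential well. -/
theorem IsSolution.expDecay (sol : IsSolution ne α φb fb finf f φ)
    (hprof : IsEnergyProfile α φb r fb finf hp hm) (hα : α < 1) (hφb : 0 < φb) (hr : 2 < r)
    (hfinf : Integrable finf) (hne : Continuous ne) {C : ℝ} (hC : 0 < C)
    (hbound : ∀ s ∈ Icc 0 φb, |charge ne α φb fb finf s| ≤ C * s ∧
      |primitive (charge ne α φb fb finf) s| ≤ C * s ^ 2) {κ δ : ℝ} (hκ : 0 < κ)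
    (hδ : δ ∈ Ioc 0 φb)
    (hlow : ∀ s ∈ Ioc 0 δ, κ * s ^ 2 ≤ primitive (charge ne α φb fb finf) s) :
    ExpDecay φ := by
  set g := charge ne α φb fb finf with hgdef
  have hg := continuousOn_charge hprof hα hr hfinf hne
  have hVpos := sol.primitive_pos hprof hα hφb hr hfinf hne
  have hmem : ∀ x, 0 ≤ x → φ x ∈ Ioc 0 φb := fun x hx => ⟨sol.pos hφb hx, sol.le hφb hx⟩
  -- The quadratic lower bound extends from `(0, δ]` to `(0, φb]` because the primitive has a
  -- positive minimum on `[δ, φb]`. It yields `φ' ≤ -c φ` with `c = √(2 k)`.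
  obtain ⟨k, hk, hlow'⟩ : ∃ k > 0, ∀ s ∈ Ioc 0 φb, k * s ^ 2 ≤ primitive g s := by
    obtain ⟨s₀, hs₀, hmin⟩ := isCompact_Icc.exists_isMinOn (nonempty_Icc.2 hδ.2)
      ((continuousOn_primitive hg).mono fun s hs => hδ.1.le.trans hs.1)
    have hm0 := hVpos s₀ ⟨hδ.1.trans_le hs₀.1, hs₀.2⟩
    refine ⟨min κ (primitive g s₀ / φb ^ 2), lt_min hκ (by positivity), fun s hs => ?_⟩
    rcases le_total s δ with h | h
    · refine le_trans ?_ (hlow s ⟨hs.1, h⟩)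
      gcongr
      exact min_le_left _ _
    · have h1 : primitive g s₀ ≤ primitive g s := hmin ⟨h, hs.2⟩
      refine le_trans ?_ h1
      calc min κ (primitive g s₀ / φb ^ 2) * s ^ 2
          ≤ primitive g s₀ / φb ^ 2 * φb ^ 2 := by
            gcongr
            · exact min_le_right _ _
            · exact hs.1.le
            · exact hs.2
        _ = primitive g s₀ := by field_simp
  set c := √(2 * k) with hc
  have hc0 : 0 < c := by positivity
  have hdle : ∀ x, 0 ≤ x → dx 1 φ x ≤ -(c * φ x) := by
    intro x hx
    rw [(sol.energy hprof hα hφb hr hfinf hne hx).2, neg_le_neg_iff]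
    refine Real.le_sqrt_of_sq_le ?_
    rw [mul_pow, hc, Real.sq_sqrt (by positivity)]
    linarith [hlow' _ (hmem x hx)]
  have hφle : ∀ x, 0 ≤ x → φ x ≤ φb * Real.exp (-c * x) := by
    intro x hx
    have hexp : ∀ y : ℝ, HasDerivAt (fun y => Real.exp (c * y)) (Real.exp (c * y) * (c * 1)) y :=
      fun y => ((hasDerivAt_id y).const_mul c).exp
    have hanti : AntitoneOn (fun y => φ y * Real.exp (c * y)) (Ici 0) := by
      refine antitoneOn_of_deriv_nonpos (convex_Ici 0)
        (sol.phi_C1.continuousOn.mul (by fun_prop)) ?_ ?_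
      · rw [interior_Ici]
        exact fun y hy => ((hasDerivAt_dx sol.phi_C1 hy).mul
          (hexp y)).differentiableAt.differentiableWithinAt
      · rw [interior_Ici]
        intro y hy
        have h1 : HasDerivAt (fun y => φ y * Real.exp (c * y)) _ y :=
          (hasDerivAt_dx sol.phi_C1 hy).mul (hexp y)
        rw [h1.deriv]
        have h2 := hdle y (le_of_lt hy)
        have h3 := Real.exp_pos (c * y)
        nlinarith
    have h1 := hanti self_mem_Ici hx hx
    simp only [sol.phi_zero, mul_zero, Real.exp_zero, mul_one] at h1
    rw [neg_mul, Real.exp_neg, ← div_eq_mul_inv, le_div_iff₀ (Real.exp_pos _)]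
    exact h1
  set M := max (max 1 √(2 * C)) C with hM
  have hM1 : 1 ≤ M := (le_max_left _ _).trans (le_max_left _ _)
  have hM2 : √(2 * C) ≤ M := (le_max_right _ _).trans (le_max_left _ _)
  have hM3 : C ≤ M := le_max_right _ _
  have hall : ∀ l ≤ 2, ∀ x, 0 < x ∨ (l < 2 ∧ 0 ≤ x) → |dx l φ x| ≤ M * φ x := by
    intro l hl x hx
    have hx0 : 0 ≤ x := by rcases hx with h | h; exacts [h.le, h.2]
    have hφx := (hmem x hx0).1
    interval_cases l
    · rw [dx, iteratedDerivWithin_zero, abs_of_pos hφx]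
      nlinarith
    · rw [(sol.energy hprof hα hφb hr hfinf hne hx0).2, abs_neg, abs_of_nonneg (Real.sqrt_nonneg _)]
      refine le_trans ?_ (mul_le_mul_of_nonneg_right hM2 hφx.le)
      rw [Real.sqrt_le_iff]
      refine ⟨by positivity, ?_⟩
      rw [mul_pow, Real.sq_sqrt (by positivity)]
      have := (le_abs_self _).trans (hbound (φ x) ⟨hφx.le, (hmem x hx0).2⟩).2
      linarith
    · have hxpos : 0 < x := by
        rcases hx with h | h
        · exact h
        · exact absurd h.1 (lt_irrefl 2)
      rw [sol.dx_two_eq hprof hα hφb hr hfinf hxpos]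
      refine (hbound (φ x) ⟨hφx.le, (hmem x hx0).2⟩).1.trans ?_
      gcongr
  refine ⟨c, hc0, max (M * φb) |dx 2 φ 0|, lt_of_lt_of_le (by positivity) (le_max_left _ _),
    fun l hl x hx => ?_⟩
  by_cases hcase : 0 < x ∨ (l < 2 ∧ 0 ≤ x)
  · calc |dx l φ x| ≤ M * φ x := hall l hl x hcase
      _ ≤ M * (φb * Real.exp (-c * x)) := by
          gcongr
          exact hφle x hx
      _ = M * φb * Real.exp (-c * x) := by ring
      _ ≤ _ := by
          gcongr
          exact le_max_left _ _
  -- The second derivative at `x = 0` lies outside the reach of the Poisson equation, posed for `x >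
  -- 0`; the constant absorbs this single value.
  · rw [not_or, not_lt] at hcase
    have hx0 : x = 0 := le_antisymm hcase.1 hx
    have hl2 : l = 2 := by
      by_contra hne2
      exact hcase.2 ⟨lt_of_le_of_ne hl hne2, hx⟩
    rw [hx0, hl2, mul_zero, Real.exp_zero, mul_one]
    exact le_max_right _ _

/-- Positivity at `φb` persists slightly beyond it by continuity, so membership of `φb` in `BPlus`
already gives strict inequality with the supremum. -/
theorem lt_supBPlus_iff (hφb : 0 < φb)
    (hc : ContinuousAt (VPlus ne α φb fb finf) φb) :
    (φb : EReal) < supBPlus ne α φb fb finf ↔ ∀ s ∈ Ioc 0 φb, 0 < VPlus ne α φb fb finf s := by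
  rw [supBPlus, lt_sSup_iff]
  constructor
  · rintro ⟨_, ⟨β, hβ, rfl⟩, hlt⟩ s hs
    exact hβ.2 s ⟨hs.1, hs.2.trans (EReal.coe_lt_coe_iff.1 hlt).le⟩
  · intro h
    have hev := hc.eventually_const_lt (h φb (right_mem_Ioc.2 hφb))
    obtain ⟨δ, hδ, hball⟩ := Metric.eventually_nhds_iff.1 hev
    refine ⟨_, ⟨φb + δ / 2, ⟨by linarith, fun s hs => ?_⟩, rfl⟩,
      EReal.coe_lt_coe_iff.2 (by linarith)⟩
    rcases le_total s φb with h1 | h1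
    · exact h s ⟨hs.1, h1⟩
    · refine hball ?_
      rw [Real.dist_eq, abs_of_nonneg (by linarith)]
      linarith [hs.2]

end

end VlasovPoisson
end

/-! ### The four cases -/

open VlasovPoisson in
theorem theorem2p3
    (ne : ℝ → ℝ) (hne : ContDiff ℝ 2 ne) (hne0 : ne 0 = 1) (hne1 : deriv ne 0 = -1)
    (α φb r : ℝ) (hα : α ∈ Icc (0 : ℝ) 1) (hα1 : α ≠ 1) (hφb : 0 < φb) (hr : 2 < r)
    (fb finf : Vel → ℝ)
    (hfb : IntegrableOn fb posVel volume) (hfbr : FiniteLrL1 r 0 √(2 * φb) fb)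
    (hfinf : Integrable finf volume)
    (hfb0 : ∀ᵐ ξ ∂(volume.restrict posVel), 0 ≤ fb ξ)
    (hfinf0 : ∀ᵐ ξ : Vel, 0 ≤ finf ξ)
    (hmass : ∫ ξ, finf ξ = 1)
    (hcompat : ∀ᵐ ξ ∂(volume.restrict posVel),
      finf ξ = fb (√(ξ.1 ^ 2 + 2 * φb), ξ.2) + α * finf (-ξ.1, ξ.2))
    (hV : ContDiffOn ℝ 2 (VPlus ne α φb fb finf) (Icc 0 φb)) :
    (0 < d2VPlusZero ne α φb fb finf →
      (BPlus ne α φb fb finf).Nonempty ∧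
      (HasUniqueSolution ne α φb fb finf ↔ (φb : EReal) < supBPlus ne α φb fb finf) ∧
      ∀ f φ, IsSolution ne α φb fb finf f φ →
        (φb : EReal) < supBPlus ne α φb fb finf ∧
        (∀ x, 0 ≤ x → f x =ᵐ[volume] explicitF α φb fb finf φ x) ∧ ExpDecay φ) ∧
    (d2VPlusZero ne α φb fb finf = 0 → (BPlus ne α φb fb finf).Nonempty →
      (HasUniqueSolution ne α φb fb finf ↔ (φb : EReal) < supBPlus ne α φb fb finf) ∧
      ∀ f φ, IsSolution ne α φb fb finf f φ →
        (φb : EReal) < supBPlus ne α φb fb finf ∧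
        (∀ x, 0 ≤ x → f x =ᵐ[volume] explicitF α φb fb finf φ x)) ∧
    (d2VPlusZero ne α φb fb finf = 0 → BPlus ne α φb fb finf = ∅ →
      ¬ ∃ f φ, IsSolution ne α φb fb finf f φ) ∧
    (d2VPlusZero ne α φb fb finf < 0 →
      ¬ ∃ f φ, IsSolution ne α φb fb finf f φ) := by
  have hα' : α < 1 := lt_of_le_of_ne hα.2 hα1
  have hnec : Continuous ne := hne.continuous
  obtain ⟨hp, hm, hprof⟩ := exists_energyProfile hα.1 hα' hφb hr hfb hfbr hfinf hfb0 hfinf0 hcompat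
  have hg := continuousOn_charge (ne := ne) hprof hα' hr hfinf hnec
  have hg0 : charge ne α φb fb finf 0 = 0 := by
    rw [charge, hprof.rhoPlus_zero hα' hr hfinf hmass, hne0, sub_self]
  -- `VPlus` unfolds to `primitive (charge ne α φb fb finf)`, so the regularity hypothesis applies
  -- as it stands.
  obtain ⟨C, hC, hbound⟩ := exists_linear_bound hg hg0 hφb hV
  have hd2 := hasDerivWithinAt_zero_of_primitive hg hφb hV
  have hsup := lt_supBPlus_iff (ne := ne) (α := α) (fb := fb) (finf := finf) hφb
    (hasDerivAt_primitive hg hφb).continuousAt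
  have hpos : ∀ f φ, IsSolution ne α φb fb finf f φ →
      ∀ s ∈ Ioc 0 φb, 0 < VPlus ne α φb fb finf s := fun f φ sol =>
    sol.primitive_pos hprof hα' hφb hr hfinf hnec
  have hiff : HasUniqueSolution ne α φb fb finf ↔ (φb : EReal) < supBPlus ne α φb fb finf := by
    rw [hsup]
    constructor
    · rintro ⟨⟨f, φ, sol⟩, -⟩
      exact hpos f φ sol
    · intro h
      obtain ⟨φ, X, pot⟩ := exists_isPotential hg hφb h hC fun s hs => (hbound s hs).2
      exact ⟨⟨_, φ, pot.isSolution hprof hα' hφb hr hfinf hnec h⟩, fun f φ f' φ' sol sol' =>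
        sol.unique sol' hprof hα' hφb hr hfinf hnec⟩
  have hexp : ∀ f φ, IsSolution ne α φb fb finf f φ →
      ∀ x, 0 ≤ x → f x =ᵐ[volume] explicitF α φb fb finf φ x := fun f φ sol x hx =>
    (sol.ae_eq_profileDensity hφb hα' hr hprof hfinf hx).trans
      (hprof.explicitF_ae_eq hα' φ x (sol.le hφb hx)).symm
  refine ⟨fun h => ?_, fun _ _ => ⟨hiff, fun f φ sol =>
    ⟨hsup.2 (hpos f φ sol), hexp f φ sol⟩⟩, fun _ hB => ?_, fun h => ?_⟩
  · obtain ⟨δ, hδ, hlow⟩ := exists_quadratic_lower hg hg0 hφb h hd2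
    have hκ : 0 < d2VPlusZero ne α φb fb finf / 4 := by linarith
    refine ⟨⟨δ, hδ.1, fun s hs => lt_of_lt_of_le ?_ (hlow s hs)⟩, hiff, fun f φ sol =>
      ⟨hsup.2 (hpos f φ sol), hexp f φ sol,
        sol.expDecay hprof hα' hφb hr hfinf hnec hC hbound hκ hδ hlow⟩⟩
    exact mul_pos hκ (pow_pos hs.1 2)
  · rintro ⟨f, φ, sol⟩
    have : φb ∈ BPlus ne α φb fb finf := ⟨hφb, hpos f φ sol⟩
    rw [hB] at this
    exact this
  · rintro ⟨f, φ, sol⟩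
    obtain ⟨s, hs, hneg⟩ := exists_primitive_neg hg hg0 hφb h hd2
    exact absurd (hpos f φ sol s hs) (not_lt.2 hneg.le)
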